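/- Let $S$ be a Dedekind scheme (an integral, regular, separated, Noetherian scheme of dimension $1$), and let $i\colon D\hookrightarrow S$ be a reduced effective divisor, i.e. the closed immersion of a reduced closed subscheme of dimension $0$ (possibly empty). Let $\mathcal O(-D)=\ker(\mathcal O_S\to i_*\mathcal O_D)$ and, for an $\mathcal O_S$-module $M$, write $M(-D)=M\otimes\mathcal O(-D)$. A $D$-marked bundle is a triple $(\mathcal E,\mathcal L,\phi)$ where $\mathcal E$ is a rank $2$ vector bundle on $S$, $\mathcal L$ is a line bundle on $D$, and $\phi\colon\mathcal E\twoheadrightarrow i_*\mathcal L$ is a surjection of sheaves. (Up to isomorphism of $\mathcal L$, the datum of $(\mathcal L,\phi)$ is the same as a closed subscheme $\mathcal D\subseteq\mathbb P(\mathcal E)$ mapping isomorphically onto $D$.) An isomorphism $(\mathcal E_1,\mathcal L_1,\phi_1)\to(\mathcal E_2,\mathcal L_2,\phi_2)$ of $D$-marked bundles is a pair of isomorphisms $f\colon\mathcal E_1\to\mathcal E_2$, $a\colon\mathcal L_1\to\mathcal L_2$ with $\phi_2\circ f=i_*a\circ\phi_1$. Let $D\mathrm{Bun}$ be the groupoid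 of $D$-marked bundles and, for a line bundle $\mathcal N$ on $S$, let $D\mathrm{Bun}_{\mathcal N}$ be its full subcategory of those $(\mathcal E,\mathcal L,\phi)$ with $\wedge^2\mathcal E\cong\mathcal N$. For a $D$-marked bundle $(\mathcal E,\mathcal L,\phi)$ let $\psi\colon i^*\mathcal E\to\mathcal L$ be the adjoint of $\phi$, and put $\mathcal E'=\ker\phi$, $\mathcal L'=\ker\psi$. The composite $i^*\mathcal E'\to i^*\mathcal E\xrightarrow{\psi}\mathcal L$ is zero, so $i^*\mathcal E'\to i^*\mathcal E$ factors through a map $\psi'\colon i^*\mathcal E'\to\mathcal L'$; let $\phi'\colon\mathcal E'\to i_*\mathcal L'$ be its adjoint, and set $\mathrm{Elm}_D(\mathcal E,\mathcal L,\phi)=(\mathcal E',\mathcal L',\phi')$. Then: 1. $(\mathcal E',\mathcal L',\phi')$ is again a $D$-marked bundle, so $\mathrm{Elm}_D$ is a functor $D\mathrm{Bun}\to D\mathrm{Bun}$. 2. For every line bundle $\mathcal N$ on $S$, $\mathrm{Elm}_D$ restricts to a functor $D\mathrm{Bun}_{\mathcal N}\to D\mathrm{Bun}_{\mathcal N(-D)}$,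 and this functor is an equivalence of groupoids. 3. Twisting by $\mathcal O(-D)$, which sends $\phi\colon\mathcal E\to i_*\mathcal L$ to $\phi\otimes\mathcal O(-D)\colon\mathcal E(-D)\to(i_*\mathcal L)(-D)\cong i_*\bigl(i^*((i_*\mathcal L)(-D))\bigr)$, is a functor $D\mathrm{Bun}\to D\mathrm{Bun}$, and $\mathrm{Elm}_D\circ\mathrm{Elm}_D$ is naturally isomorphic to it. -/

import Mathlib

open CategoryTheory CategoryTheory.Limits AlgebraicGeometry

universe u

noncomputable section

namespace ElementaryTransform

/-! ### Dedekind schemes and reduced effective divisors -/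

/-- A Dedekind scheme: an integral, regular, separated, Noetherian scheme of dimension `1`. -/
structure IsDedekindScheme (S : Scheme.{u}) : Prop where
  isIntegral : IsIntegral S
  isNoetherian : AlgebraicGeometry.IsNoetherian S
  isSeparated : S.IsSeparated
  isRegular : ∀ x : S, IsRegularLocalRing (S.presheaf.stalk x)
  dim_eq_one : topologicalKrullDim S = 1

/-- A reduced effective divisor on a Dedekind scheme `S`: a closed immersion `i : D ⟶ S` from a
reduced scheme of dimension `0`, that is, a finite disjoint union of closed points of `S`.
The empty divisor (whose Krull dimension is `⊥`) is allowed. -/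
structure IsReducedEffectiveDivisor {D S : Scheme.{u}} (i : D ⟶ S) : Prop where
  isClosedImmersion : IsClosedImmersion i
  isReduced : IsReduced D
  dim_le_zero : topologicalKrullDim D ≤ 0

/-! ### Sheaves of modules on a scheme -/

variable {X : Scheme.{u}}

/-- A sheaf of modules is a vector bundle of rank `r` if it is locally isomorphic
to `𝒪 ^ r`. -/
def IsVectorBundle (r : ℕ) (M : X.Modules) : Prop :=
  ∀ x : X, ∃ U : X.Opens, x ∈ U ∧
    Nonempty (M.restrict U.ι ≅
      (SheafOfModules.free (ULift.{u} (Fin r)) : SheafOfModules (U : Scheme.{u}).ringCatSheaf))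

/-- The structure sheaf of `X`, as a sheaf of modules. -/
def structureSheaf (X : Scheme.{u}) : X.Modules := SheafOfModules.unit X.ringCatSheaf

/-- The sheaf of modules associated to a presheaf of modules. -/
def sheafify (X : Scheme.{u}) : X.PresheafOfModules ⥤ X.Modules :=
  PresheafOfModules.sheafification (𝟙 X.ringCatSheaf.obj)

/-- The functor `M ↦ M ⊗ N` on sheaves of modules, where `M ⊗ N` is the sheaf associated to the
presheaf `U ↦ M(U) ⊗_{𝒪(U)} N(U)`. -/
def tensorRight (N : X.Modules) : X.Modules ⥤ X.Modules :=
  Scheme.Modules.toPresheafOfModules X ⋙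
    MonoidalCategory.tensorRight
      (C := _root_.PresheafOfModules.{u} (X.presheaf ⋙ forget₂ CommRingCat RingCat))
      ((Scheme.Modules.toPresheafOfModules X).obj N) ⋙ sheafify X

section
variable {A B : Type u} [CommRing A] [CommRing B] {f : A →+* B}
  {M N : Type u} [AddCommGroup M] [AddCommGroup N] [Module A M] [Module B N]

/-- The map `⋀ⁿ_A M → ⋀ⁿ_B N`, `m₁ ∧ ⋯ ∧ mₙ ↦ g m₁ ∧ ⋯ ∧ g mₙ`, induced by an `f`-semilinear map
`g : M → N`. -/
def exteriorPowerMap (n : ℕ) (g : M →ₛₗ[f] N) : (⋀[A]^n M) →ₛₗ[f] (⋀[B]^n N) :=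
  letI : Module A (⋀[B]^n N) := Module.compHom _ f
  letI φ : M [⋀^Fin n]→ₗ[A] (⋀[B]^n N) :=
    { toFun := fun m => exteriorPower.ιMulti B n (fun k => g (m k))
      map_update_add' := by
        intro _ m k x y
        simp only [Function.apply_update (fun _ => g), map_add, AlternatingMap.map_update_add]
      map_update_smul' := by
        intro _ m k c x
        simp only [Function.apply_update (fun _ => g), map_smulₛₗ,
          AlternatingMap.map_update_smul]
        rfl
      map_eq_zero_of_eq' := by
        intro m k l h hkl
        exact AlternatingMap.map_eq_zero_of_eq _ _ (congrArg g h) hkl }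
  { toFun := exteriorPower.alternatingMapLinearEquiv φ
    map_add' := map_add _
    map_smul' := fun c x => map_smul (exteriorPower.alternatingMapLinearEquiv φ) c x }

lemma exteriorPowerMap_ιMulti (n : ℕ) (g : M →ₛₗ[f] N) (m : Fin n → M) :
    exteriorPowerMap n g (exteriorPower.ιMulti A n m) =
      exteriorPower.ιMulti B n (fun k => g (m k)) := by
  let _ : Module A (⋀[B]^n N) := Module.compHom _ f
  exact exteriorPower.alternatingMapLinearEquiv_apply_ιMulti _ m

lemma exteriorPower_semilinear_ext (n : ℕ) {P : Type u} [AddCommGroup P] [Module B P]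
    {g h : (⋀[A]^n M) →ₛₗ[f] P}
    (H : ∀ m, g (exteriorPower.ιMulti A n m) = h (exteriorPower.ιMulti A n m)) : g = h := by
  apply LinearMap.ext_on_range (exteriorPower.ιMulti_span A n M) H
end

section
variable {C : Type u} [Category.{u} C] {R : Cᵒᵖ ⥤ CommRingCat.{u}}

/-- The presheaf of modules `U ↦ ⋀ⁿ_{R(U)} M(U)`. -/
def presheafExteriorPower (n : ℕ)
    (M : _root_.PresheafOfModules.{u} (R ⋙ forget₂ CommRingCat RingCat)) :
    _root_.PresheafOfModules.{u} (R ⋙ forget₂ CommRingCat RingCat) where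
  obj U := ModuleCat.of (R.obj U) (⋀[R.obj U]^n (M.obj U))
  map {U V} h := ModuleCat.semilinearMapAddEquiv _ _ _
    (exteriorPowerMap (A := R.obj U) (B := R.obj V) n (M.restrictₛₗ h))
  map_id U := by
    ext m
    refine (exteriorPowerMap_ιMulti (A := R.obj U) (B := R.obj U) n
      (M.restrictₛₗ (𝟙 U)) m).trans (congrArg (exteriorPower.ιMulti (R.obj U) n) ?_)
    funext k
    exact ConcreteCategory.congr_hom (M.presheaf.map_id U) (m k)
  map_comp {U V W} h k := by
    ext m
    refine (exteriorPowerMap_ιMulti (A := R.obj U) (B := R.obj W) n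
      (M.restrictₛₗ (h ≫ k)) m).trans ?_
    have e₁ := exteriorPowerMap_ιMulti (A := R.obj U) (B := R.obj V) n (M.restrictₛₗ h) m
    have e₂ := exteriorPowerMap_ιMulti (A := R.obj V) (B := R.obj W) n (M.restrictₛₗ k)
      (fun j => M.restrictₛₗ h (m j))
    refine Eq.trans ?_ (e₂.symm.trans (congrArg (exteriorPowerMap (A := R.obj V) (B := R.obj W) n
      (M.restrictₛₗ k)) e₁.symm))
    refine congrArg (exteriorPower.ιMulti (R.obj W) n) ?_
    funext j
    exact PresheafOfModules.map_comp_apply M h k (m j)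
end

/-- The exterior power `⋀ⁿ M` of a sheaf of modules: the sheaf associated to the presheaf
`U ↦ ⋀ⁿ_{𝒪(U)} M(U)`. -/
def exteriorPower (n : ℕ) (M : X.Modules) : X.Modules :=
  (sheafify X).obj (presheafExteriorPower (R := X.presheaf) n
    ((Scheme.Modules.toPresheafOfModules X).obj M))

/-! ### Marked bundles -/

variable {D S : Scheme.{u}} (i : D ⟶ S)

/-- The ideal sheaf `𝒪(-D)` of `i : D ⟶ S`: the kernel of the canonical map `𝒪_S ⟶ i_* 𝒪_D`. -/
def idealSheaf : S.Modules :=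
  kernel (C := S.Modules) (X := structureSheaf S)
    (Y := (Scheme.Modules.pushforward i).obj (structureSheaf D))
    (SheafOfModules.unitToPushforwardObjUnit i.toRingCatSheafHom)

/-- The twist `N ↦ N(-D) = N ⊗ 𝒪(-D)` on sheaves of modules. -/
def twist : S.Modules ⥤ S.Modules := tensorRight (idealSheaf i)

/-- Triples `(E, L, φ)` with `E` a sheaf of modules on `S`, `L` a sheaf of modules on `D` and
`φ : E ⟶ i_* L`. A morphism is a pair of morphisms `E₁ ⟶ E₂`, `L₁ ⟶ L₂` which commutes with
`φ₁` and `φ₂`. -/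
abbrev Triple := Comma (𝟭 S.Modules) (Scheme.Modules.pushforward i)

variable {i}

/-- The sheaf `E` of a triple `(E, L, φ)`. -/
abbrev Triple.E (T : Triple i) : S.Modules := T.left

/-- The sheaf `L` of a triple `(E, L, φ)`. -/
abbrev Triple.L (T : Triple i) : D.Modules := T.right

/-- The morphism `φ : E ⟶ i_* L` of a triple `(E, L, φ)`. -/
abbrev Triple.φ (T : Triple i) : T.E ⟶ (Scheme.Modules.pushforward i).obj T.L := T.hom

/-- The morphism `ψ : i^* E ⟶ L` adjoint to `φ : E ⟶ i_* L`. -/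
def Triple.ψ (T : Triple i) : (Scheme.Modules.pullback i).obj T.E ⟶ T.L :=
  ((Scheme.Modules.pullbackPushforwardAdjunction i).homEquiv _ _).symm T.φ

variable (i)

/-- A triple `(E, L, φ)` is a `D`-marked bundle if `E` is a vector bundle of rank `2` on `S`, `L` is
a line bundle on `D` and `φ : E ⟶ i_* L` is surjective. -/
def IsMarkedBundle : ObjectProperty (Triple i) := fun T =>
  IsVectorBundle 2 T.E ∧ IsVectorBundle 1 T.L ∧ Epi T.φ

/-- The groupoid of `D`-marked bundles. -/
abbrev DBun := Core (IsMarkedBundle i).FullSubcategory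

/-- The `D`-marked bundles `(E, L, φ)` with `⋀² E ≅ N`. -/
def HasDet (N : S.Modules) : ObjectProperty (DBun i) := fun T =>
  Nonempty (exteriorPower 2 T.of.obj.E ≅ N)

/-- The full subgroupoid of `DBun i` on the `D`-marked bundles `(E, L, φ)` with `⋀² E ≅ N`. -/
abbrev DBunDet (N : S.Modules) := (HasDet i N).FullSubcategory

/-! ### The elementary transform and the twist -/

variable {i}

lemma Triple.pullback_kernel_ψ (T : Triple i) :
    (Scheme.Modules.pullback i).map (kernel.ι T.φ) ≫ T.ψ = 0 := by
  rw [Triple.ψ, ← Adjunction.homEquiv_naturality_left_symm, kernel.condition,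
    Adjunction.homEquiv_counit, Functor.map_zero, zero_comp]

lemma Triple.φ_naturality {T₁ T₂ : Triple i} (f : T₁ ⟶ T₂) :
    T₁.φ ≫ (Scheme.Modules.pushforward i).map f.right = f.left ≫ T₂.φ := f.w.symm

lemma Triple.ψ_naturality {T₁ T₂ : Triple i} (f : T₁ ⟶ T₂) :
    T₁.ψ ≫ f.right = (Scheme.Modules.pullback i).map f.left ≫ T₂.ψ := by
  rw [Triple.ψ, Triple.ψ, ← Adjunction.homEquiv_naturality_left_symm,
    ← Adjunction.homEquiv_naturality_right_symm, Triple.φ_naturality]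

variable (i)

/-- The elementary transform. It sends `φ : E ⟶ i_* L`, with adjoint `ψ : i^* E ⟶ L`, to the triple
`(E', L', φ')` where `E' = ker φ`, `L' = ker ψ` and where the adjoint `ψ' : i^* E' ⟶ L'` of `φ'` is
the factorization of `i^* E' ⟶ i^* E` through `ker ψ`. -/
def elm : Triple i ⥤ Triple i where
  obj T :=
    { left := kernel T.φ
      right := kernel T.ψ
      hom := (Scheme.Modules.pullbackPushforwardAdjunction i).homEquiv _ _
        (kernel.lift T.ψ ((Scheme.Modules.pullback i).map (kernel.ι T.φ)) T.pullback_kernel_ψ) }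
  map {T₁ T₂} f :=
    { left := kernel.map T₁.φ T₂.φ f.left ((Scheme.Modules.pushforward i).map f.right)
        (Triple.φ_naturality f)
      right := kernel.map T₁.ψ T₂.ψ ((Scheme.Modules.pullback i).map f.left) f.right
        (Triple.ψ_naturality f)
      w := by
        dsimp only [Functor.id_map]
        rw [← Adjunction.homEquiv_naturality_left, ← Adjunction.homEquiv_naturality_right]
        congr 1
        rw [← cancel_mono (kernel.ι T₂.ψ)]
        simp only [Category.assoc, kernel.lift_ι, kernel.lift_ι_assoc, kernel.map,
          ← Functor.map_comp] }
  map_id T := by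
    ext1
    · simp [kernel.map]
    · simp [kernel.map]
  map_comp {T₁ T₂ T₃} f g := by
    ext1
    · simp [kernel.map, ← cancel_mono (kernel.ι T₃.φ)]
    · simp [kernel.map, ← cancel_mono (kernel.ι T₃.ψ)]

/-- The functor `- ⊗ 𝒪(-D)`. It sends `φ : E ⟶ i_* L` to
`φ ⊗ 𝒪(-D) : E ⊗ 𝒪(-D) ⟶ (i_* L) ⊗ 𝒪(-D)`, whose target is regarded as the pushforward of a sheaf on
`D` by means of the unit `M ⟶ i_* i^* M` (an isomorphism on quasi-coherent sheaves which, like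
`(i_* L) ⊗ 𝒪(-D)`, are annihilated by the ideal of `D`). -/
def twistFunctor : Triple i ⥤ Triple i where
  obj T :=
    { left := (twist i).obj T.E
      right := (Scheme.Modules.pullback i).obj
        ((twist i).obj ((Scheme.Modules.pushforward i).obj T.L))
      hom := (twist i).map T.φ ≫ (Scheme.Modules.pullbackPushforwardAdjunction i).unit.app
        ((twist i).obj ((Scheme.Modules.pushforward i).obj T.L)) }
  map {T₁ T₂} f :=
    { left := (twist i).map f.left
      right := (Scheme.Modules.pullback i).map
        ((twist i).map ((Scheme.Modules.pushforward i).map f.right))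
      w := by
        have h := congrArg (twist i).map (Triple.φ_naturality f)
        have h' := (Scheme.Modules.pullbackPushforwardAdjunction i).unit.naturality
          ((twist i).map ((Scheme.Modules.pushforward i).map f.right))
        rw [Functor.map_comp, Functor.map_comp] at h
        refine (Category.assoc _ _ _).symm.trans ((congrArg (· ≫ _) h.symm).trans
          ((Category.assoc _ _ _).trans ?_))
        exact (congrArg ((twist i).map T₁.φ ≫ ·) h').trans (Category.assoc _ _ _).symm }
  map_id T := by
    ext1
    · exact (twist i).map_id _
    · exact (Scheme.Modules.pushforward i ⋙ twist i ⋙ Scheme.Modules.pullback i).map_id _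
  map_comp f g := by
    ext1
    · exact (twist i).map_comp _ _
    · exact (Scheme.Modules.pushforward i ⋙ twist i ⋙ Scheme.Modules.pullback i).map_comp _ _

variable {i}

/-- The functor induced on the groupoid of `D`-marked bundles by a functor which preserves
`D`-marked bundles. -/
def onDBun (F : Triple i ⥤ Triple i) (hF : ∀ T, IsMarkedBundle i T → IsMarkedBundle i (F.obj T)) :
    DBun i ⥤ DBun i :=
  ((IsMarkedBundle i).lift ((IsMarkedBundle i).ι ⋙ F) (fun T => hF _ T.property)).core

/-- The functor `DBunDet i N ⥤ DBunDet i N'` induced by `F : DBun i ⥤ DBun i`. -/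
def onDBunDet (F : DBun i ⥤ DBun i) {N N' : S.Modules}
    (hF : ∀ T, HasDet i N T → HasDet i N' (F.obj T)) : DBunDet i N ⥤ DBunDet i N' :=
  (HasDet i N').lift ((HasDet i N).ι ⋙ F) (fun T => hF _ T.property)

end ElementaryTransform

end

open ElementaryTransform

noncomputable section

namespace ElementaryTransform

open TopologicalSpace Opposite Scheme.Modules

variable {X : Scheme.{u}}

/-! ### Sections of sheaves of modules -/

/-! The argument is a computation in local coordinates. Near a point of $S$ choose a basis $e,e'$ of
$\mathcal E$, a generator $l$ of $\mathcal L$ and a generator $\tau$ of $\mathcal O(-D)$ with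
$\phi(e)=l$ and $\phi(e')=0$ (`IsNormal`). Such normal forms exist near every point exactly for
marked bundles, once $\mathcal O(-D)$ is known to be invertible (`IsMarkedBundle.hasNormalForms`,
`HasNormalForms.isMarkedBundle`). Invertibility (`isInvertible_idealSheaf`) is where the hypotheses
on $S$ and $D$ enter: at a point of $D$ the ideal is the maximal ideal of a regular local ring of
dimension at most $1$, and its generator is nonzero and spreads out to a neighbourhood.

In a normal form, $\mathcal E'$ has basis $e',\tau e$, and $\mathcal L'$ is generated by the
restriction of $e'$ to $D$. These sections are again in normal form, with the two roles exchanged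
(`IsNormal.elm`). This proves part 1. The identity $e'\wedge\tau e=\tau\,(e'\wedge e)$ gives
$\wedge^2\mathcal E'\cong(\wedge^2\mathcal E)(-D)$ (`exteriorPower_elm`). Applied twice, the
construction yields the basis $\tau e,\tau e'$, so $\mathcal E''$ and $\mathcal E(-D)$ have the same
image in $\mathcal E$; this gives part 3 (`twistIso`, `twistIso_naturality`).

For part 2, tensoring with an invertible sheaf is an equivalence on all sheaves of modules, with
inverse $\mathcal Hom(\mathcal O(-D),-)$. Together with part 3 this makes $\mathrm{Elm}_D$ fully
faithful on marked bundles, and $\mathrm{Elm}_D$ of the untwisted bundle is a preimage of a given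
one (`nonempty_elm_elm_untwist_iso`). The equivalence restricts to fixed determinants because
twisting reflects isomorphism classes.

All local statements are phrased through `IsBasis`: sections over $U$ that restrict to a basis over
every smaller open set. -/

/-- Restriction of sections of a sheaf of modules. -/
def res (M : X.Modules) {U V : X.Opens} (h : V ≤ U) : Γ(M, U) →+ Γ(M, V) :=
  (M.presheaf.map (homOfLE h).op).hom

/-- Restriction of functions on a scheme. -/
def resO {U V : X.Opens} (h : V ≤ U) : Γ(X, U) →+* Γ(X, V) :=
  (X.presheaf.map (homOfLE h).op).hom

lemma res_refl (M : X.Modules) {U : X.Opens} (s : Γ(M, U)) : res M (le_refl U) s = s :=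
  ConcreteCategory.congr_hom (M.presheaf.map_id (op U)) s

lemma res_res (M : X.Modules) {U V W : X.Opens} (h : V ≤ U) (h' : W ≤ V) (s : Γ(M, U)) :
    res M h' (res M h s) = res M (h'.trans h) s :=
  (ConcreteCategory.congr_hom (M.presheaf.map_comp (homOfLE h).op (homOfLE h').op) s).symm

lemma resO_refl {U : X.Opens} (a : Γ(X, U)) : resO (le_refl U) a = a :=
  ConcreteCategory.congr_hom (X.presheaf.map_id (op U)) a

lemma resO_resO {U V W : X.Opens} (h : V ≤ U) (h' : W ≤ V) (a : Γ(X, U)) :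
    resO h' (resO h a) = resO (h'.trans h) a :=
  (ConcreteCategory.congr_hom (X.presheaf.map_comp (homOfLE h).op (homOfLE h').op) a).symm

lemma res_smul (M : X.Modules) {U V : X.Opens} (h : V ≤ U) (a : Γ(X, U)) (s : Γ(M, U)) :
    res M h (a • s) = resO h a • res M h s :=
  Scheme.Modules.map_smul M (homOfLE h) a s

/-- The additive map on sections induced by a morphism of sheaves of modules. -/
def app {M N : X.Modules} (f : M ⟶ N) (U : X.Opens) : Γ(M, U) →+ Γ(N, U) := (f.app U).hom

lemma app_smul {M N : X.Modules} (f : M ⟶ N) {U : X.Opens} (a : Γ(X, U)) (s : Γ(M, U)) :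
    app f U (a • s) = a • app f U s := Scheme.Modules.Hom.app_smul f a s

lemma app_res {M N : X.Modules} (f : M ⟶ N) {U V : X.Opens} (h : V ≤ U) (s : Γ(M, U)) :
    app f V (res M h s) = res N h (app f U s) :=
  ConcreteCategory.congr_hom (f.mapPresheaf.naturality (homOfLE h).op) s

@[simp] lemma app_comp {M N P : X.Modules} (f : M ⟶ N) (g : N ⟶ P) {U : X.Opens} (s : Γ(M, U)) :
    app (f ≫ g) U s = app g U (app f U s) := rfl

@[simp] lemma app_id {M : X.Modules} {U : X.Opens} (s : Γ(M, U)) : app (𝟙 M) U s = s := rfl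

@[simp] lemma app_zero {M N : X.Modules} {U : X.Opens} (s : Γ(M, U)) :
    app (0 : M ⟶ N) U s = 0 := rfl

lemma hom_ext_app {M N : X.Modules} {f g : M ⟶ N} (h : ∀ U s, app f U s = app g U s) : f = g := by
  apply Scheme.Modules.hom_ext
  intro U
  ext s
  exact h U s

/-! ### Local criteria for equalities, isomorphisms and epimorphisms of sheaves. -/

/-- A property of opens holding for arbitrarily small neighbourhoods of each point. -/
def LocallyOn (X : Scheme.{u}) (p : X.Opens → Prop) : Prop :=
  ∀ (W : X.Opens), ∀ x ∈ W, ∃ V : X.Opens, V ≤ W ∧ x ∈ V ∧ p V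

lemma LocallyOn.mono {p q : X.Opens → Prop} (hp : LocallyOn X p) (h : ∀ V, p V → q V) :
    LocallyOn X q := fun W x hx => by
  obtain ⟨V, hV, hxV, hpV⟩ := hp W x hx
  exact ⟨V, hV, hxV, h V hpV⟩

lemma LocallyOn.of_forall_le {p : X.Opens → Prop}
    (h : ∀ x : X, ∃ U : X.Opens, x ∈ U ∧ ∀ V ≤ U, p V) : LocallyOn X p := fun W x hx => by
  obtain ⟨U, hxU, hU⟩ := h x
  exact ⟨W ⊓ U, inf_le_left, ⟨hx, hxU⟩, hU _ inf_le_right⟩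

/-- Sections which agree locally are equal. -/
lemma section_ext (M : X.Modules) {U : X.Opens} {s t : Γ(M, U)}
    (h : ∀ x ∈ U, ∃ (V : X.Opens) (hV : V ≤ U), x ∈ V ∧ res M hV s = res M hV t) : s = t := by
  choose V hV hx he using h
  refine TopCat.Sheaf.eq_of_locally_eq' (C := Ab) ⟨M.presheaf, M.isSheaf⟩
    (fun x : U => V x x.2) U (fun x => homOfLE (hV x x.2)) ?_ s t (fun x => he x x.2)
  intro x hxU
  exact Opens.mem_iSup.2 ⟨⟨x, hxU⟩, hx x hxU⟩

/-- Sections defined locally and agreeing on overlaps glue. -/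
lemma exists_glue (M : X.Modules) {U : X.Opens} {ι : Type u} (V : ι → X.Opens)
    (hV : ∀ k, V k ≤ U) (hc : U ≤ iSup V) (s : ∀ k, Γ(M, V k))
    (hs : ∀ k l (W : X.Opens) (h : W ≤ V k) (h' : W ≤ V l), res M h (s k) = res M h' (s l)) :
    ∃ t : Γ(M, U), ∀ k, res M (hV k) t = s k := by
  obtain ⟨t, ht, -⟩ := TopCat.Sheaf.existsUnique_gluing' (C := Ab) ⟨M.presheaf, M.isSheaf⟩
    V U (fun k => homOfLE (hV k)) hc s (fun k l => hs k l _ inf_le_left inf_le_right)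
  exact ⟨t, ht⟩

/-- If a condition stable under restriction determines its solution, local solutions agree on
overlaps automatically and therefore glue. -/
lemma exists_glue_of_local (M : X.Modules) {U : X.Opens} (p : ∀ V, V ≤ U → Γ(M, V) → Prop)
    (hp : ∀ V hV W (h : W ≤ V) s, p V hV s → p W (h.trans hV) (res M h s))
    (hu : ∀ V hV s t, p V hV s → p V hV t → s = t)
    (he : ∀ x ∈ U, ∃ V hV, x ∈ V ∧ ∃ s, p V hV s) :
    ∃ t : Γ(M, U), ∀ x ∈ U, ∃ V, ∃ hV : V ≤ U, x ∈ V ∧ p V hV (res M hV t) := by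
  choose V hV hx s hs using he
  obtain ⟨t, ht⟩ := exists_glue M (fun x : U => V x x.2) (fun x => hV x x.2)
    (fun x hxU => Opens.mem_iSup.2 ⟨⟨x, hxU⟩, hx x hxU⟩) (fun x => s x x.2)
    (fun k l W h h' => hu W (h.trans (hV k k.2)) _ _ (hp _ (hV k k.2) _ h _ (hs _ _))
      (hp _ (hV l l.2) _ h' _ (hs _ _)))
  exact ⟨t, fun x hxU => ⟨V x hxU, hV x hxU, hx x hxU, by rw [ht ⟨x, hxU⟩]; exact hs _ _⟩⟩

lemma hom_ext_local {M N : X.Modules} {f g : M ⟶ N}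
    (h : LocallyOn X fun V => ∀ s, app f V s = app g V s) : f = g := by
  refine hom_ext_app fun U s => section_ext N fun x hx => ?_
  obtain ⟨V, hV, hxV, e⟩ := h U x hx
  exact ⟨V, hV, hxV, by rw [← app_res, ← app_res, e]⟩

lemma injective_of_local {M N : X.Modules} (f : M ⟶ N)
    (h : LocallyOn X fun V => Function.Injective (app f V)) (U : X.Opens) :
    Function.Injective (app f U) := fun s t hst => by
  refine section_ext M fun x hx => ?_
  obtain ⟨V, hV, hxV, e⟩ := h U x hx
  exact ⟨V, hV, hxV, e (by rw [app_res, app_res, hst])⟩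

lemma isIso_of_bijective {M N : X.Modules} (f : M ⟶ N)
    (h : ∀ U, Function.Bijective (app f U)) : IsIso f := by
  rw [Scheme.Modules.Hom.isIso_iff_isIso_app]
  exact fun U => (ConcreteCategory.isIso_iff_bijective (f.app U)).2 (h U)

lemma bijective_of_isIso {M N : X.Modules} (f : M ⟶ N) [IsIso f] (U : X.Opens) :
    Function.Bijective (app f U) :=
  (ConcreteCategory.isIso_iff_bijective (f.app U)).1 inferInstance

/-- A morphism of sheaves of modules is locally surjective. -/
def IsLocSurj {M N : X.Modules} (f : M ⟶ N) : Prop :=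
  ∀ (U : X.Opens) (s : Γ(N, U)), ∀ x ∈ U, ∃ (V : X.Opens) (hV : V ≤ U), x ∈ V ∧
    ∃ t, app f V t = res N hV s

/-- Injectivity makes local preimages unique, so they glue. -/
lemma bijective_of_isLocSurj {M N : X.Modules} (f : M ⟶ N)
    (hi : ∀ U, Function.Injective (app f U)) (hs : IsLocSurj f) (U : X.Opens) :
    Function.Bijective (app f U) := by
  refine ⟨hi U, fun s => ?_⟩
  obtain ⟨t, ht⟩ := exists_glue_of_local M (fun V hV t => app f V t = res N hV s)
    (fun V hV W h t ht => by rw [app_res, ht, res_res])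
    (fun V hV s t hs ht => hi V (hs.trans ht.symm)) (fun x hx => by
      obtain ⟨V, hV, h⟩ := hs U s x hx
      exact ⟨V, hV, h⟩)
  refine ⟨t, section_ext N fun x hx => ?_⟩
  obtain ⟨V, hV, hxV, h⟩ := ht x hx
  exact ⟨V, hV, hxV, by rw [← app_res, h]⟩

lemma isIso_of_isLocSurj {M N : X.Modules} (f : M ⟶ N)
    (hi : ∀ U, Function.Injective (app f U)) (hs : IsLocSurj f) : IsIso f :=
  isIso_of_bijective f (bijective_of_isLocSurj f hi hs)

lemma IsLocSurj.of_local {M N : X.Modules} (f : M ⟶ N)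
    (h : LocallyOn X fun V => Function.Surjective (app f V)) : IsLocSurj f := fun U s x hx => by
  obtain ⟨V, hV, hxV, e⟩ := h U x hx
  exact ⟨V, hV, hxV, e _⟩

lemma isIso_of_local {M N : X.Modules} (f : M ⟶ N)
    (h : LocallyOn X fun V => Function.Bijective (app f V)) : IsIso f :=
  isIso_of_isLocSurj f (injective_of_local f (h.mono fun _ h => h.1))
    (.of_local f (h.mono fun _ h => h.2))

lemma IsLocSurj.epi {M N : X.Modules} {f : M ⟶ N} (h : IsLocSurj f) : Epi f where
  left_cancellation {P} g k e := by
    refine hom_ext_app fun U s => section_ext P fun x hx => ?_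
    obtain ⟨V, hV, hxV, t, ht⟩ := h U s x hx
    refine ⟨V, hV, hxV, ?_⟩
    rw [← app_res, ← app_res, ← ht, ← app_comp, ← app_comp, e]

lemma mono_of_injective {M N : X.Modules} {f : M ⟶ N} (h : ∀ U, Function.Injective (app f U)) :
    Mono f where
  right_cancellation {P} g k e := by
    refine hom_ext_app fun U s => h U ?_
    rw [← app_comp, ← app_comp, e]

/-! ### Kernels -/

section kernel

variable {M N : X.Modules} (f : M ⟶ N)

lemma kernel_ι_injective (U : X.Opens) : Function.Injective (app (kernel.ι f) U) := by
  have : Mono ((toPresheaf X).map (kernel.ι f)) := inferInstance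
  rw [NatTrans.mono_iff_mono_app] at this
  exact (AddCommGrpCat.mono_iff_injective _).1 (this (op U))

lemma app_kernel_ι {U : X.Opens} (s : Γ(kernel f, U)) : app f U (app (kernel.ι f) U s) = 0 := by
  rw [← app_comp, kernel.condition]; rfl

/-- Taking sections over `U` preserves kernels. The inclusion of the kernel of `f` on sections over
`U` therefore factors through the sections of the sheaf kernel. -/
lemma exists_kernel_ι {U : X.Opens} (s : Γ(M, U)) (hs : app f U s = 0) :
    ∃ t, app (kernel.ι f) U t = s := by
  have : PreservesFiniteLimits (toPresheaf X) := PreservesLimits.preservesFiniteLimits _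
  let F : X.Modules ⥤ Ab := toPresheaf X ⋙ (evaluation X.Opensᵒᵖ Ab).obj (op U)
  have : F.PreservesZeroMorphisms := ⟨fun _ _ => rfl⟩
  have : PreservesLimit (parallelPair f 0) F :=
    have : PreservesLimit (parallelPair f 0 ⋙ (toPresheaf X : X.Modules ⥤ (X.Opensᵒᵖ ⥤ Ab)))
      ((evaluation X.Opensᵒᵖ Ab).obj (op U)) := evaluation_preservesLimit _ _
    comp_preservesLimit (toPresheaf X) ((evaluation X.Opensᵒᵖ Ab).obj (op U))
  let hl := isLimitForkMapOfIsLimit' F (kernel.condition f) (kernelIsKernel f)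
  let k : AddCommGrpCat.of (f.app U).hom.ker ⟶ Γ(M, U) :=
    AddCommGrpCat.ofHom (AddSubgroup.subtype _)
  have hk : k ≫ F.map f = 0 := by
    ext t
    exact t.2
  have h := KernelFork.IsLimit.lift' hl k hk
  exact ⟨h.1 ⟨s, hs⟩, ConcreteCategory.congr_hom h.2 ⟨s, hs⟩⟩

end kernel

/-! ### Sheafification -/

/-- The adjunction between sheafification and the inclusion of sheaves of modules. -/
def sheafifyAdj (X : Scheme.{u}) : sheafify X ⊣ toPresheafOfModules X :=
  PresheafOfModules.sheafificationAdjunction (𝟙 X.ringCatSheaf.obj)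

/-- The sections of a presheaf of modules. -/
def PSec (P : X.PresheafOfModules) (U : X.Opens) : Type u := P.obj (op U)

instance (P : X.PresheafOfModules) (U : X.Opens) : AddCommGroup (PSec P U) :=
  inferInstanceAs (AddCommGroup (P.obj (op U)))

instance (P : X.PresheafOfModules) (U : X.Opens) : Module Γ(X, U) (PSec P U) :=
  (P.obj (op U)).isModule

/-- Restriction of sections of a presheaf of modules. -/
def pres (P : X.PresheafOfModules) {U V : X.Opens} (h : V ≤ U) : PSec P U →+ PSec P V :=
  (P.map (homOfLE h).op).hom.toAddMonoidHom

lemma pres_smul (P : X.PresheafOfModules) {U V : X.Opens} (h : V ≤ U) (a : Γ(X, U))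
    (s : PSec P U) : pres P h (a • s) = resO h a • pres P h s :=
  (P.map (homOfLE h).op).hom.map_smul a s

/-- The linear map on sections induced by a morphism of presheaves of modules. -/
def papp {P Q : X.PresheafOfModules} (f : P ⟶ Q) (U : X.Opens) : PSec P U →ₗ[Γ(X, U)] PSec Q U :=
  (f.app (op U)).hom

lemma papp_pres {P Q : X.PresheafOfModules} (f : P ⟶ Q) {U V : X.Opens} (h : V ≤ U)
    (s : PSec P U) : papp f V (pres P h s) = pres Q h (papp f U s) :=
  PresheafOfModules.naturality_apply f (homOfLE h).op s

/-- The canonical map from sections of a presheaf of modules to sections of its sheafification. -/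
def toSh (P : X.PresheafOfModules) (U : X.Opens) :
    PSec P U →ₗ[Γ(X, U)] Γ((sheafify X).obj P, U) :=
  (((sheafifyAdj X).unit.app P).app (op U)).hom

lemma toSh_res (P : X.PresheafOfModules) {U V : X.Opens} (h : V ≤ U) (s : PSec P U) :
    toSh P V (pres P h s) = res _ h (toSh P U s) :=
  PresheafOfModules.naturality_apply ((sheafifyAdj X).unit.app P) (homOfLE h).op s

lemma toSh_naturality {P Q : X.PresheafOfModules} (f : P ⟶ Q) {U : X.Opens} (s : PSec P U) :
    app ((sheafify X).map f) U (toSh P U s) = toSh Q U (papp f U s) :=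
  (congrArg (fun g : P ⟶ (toPresheafOfModules X).obj ((sheafify X).obj Q) => papp g U s)
    ((sheafifyAdj X).unit.naturality f)).symm

lemma toSh_locally_injective (P : X.PresheafOfModules) {U : X.Opens} (s : PSec P U)
    (hs : toSh P U s = 0) (x : X) (hx : x ∈ U) :
    ∃ (V : X.Opens) (hV : V ≤ U), x ∈ V ∧ pres P hV s = 0 := by
  have : Presheaf.IsLocallyInjective (Opens.grothendieckTopology X)
    (CategoryTheory.toSheafify (Opens.grothendieckTopology X) P.presheaf) := inferInstance
  obtain ⟨V, g, h, hxV⟩ := this.equalizerSieve_mem (X := op U) s (0 : PSec P U)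
    (hs.trans (map_zero (toSh P U)).symm) x hx
  exact ⟨V, leOfHom g, hxV, h.trans (map_zero (pres P _))⟩

lemma toSh_locally_surjective (P : X.PresheafOfModules) {U : X.Opens}
    (s : Γ((sheafify X).obj P, U)) (x : X) (hx : x ∈ U) :
    ∃ (V : X.Opens) (hV : V ≤ U), x ∈ V ∧ ∃ t, toSh P V t = res _ hV s := by
  have : Presheaf.IsLocallySurjective (Opens.grothendieckTopology X)
    (CategoryTheory.toSheafify (Opens.grothendieckTopology X) P.presheaf) := inferInstance
  obtain ⟨V, g, ⟨t, ht⟩, hxV⟩ := this.imageSieve_mem (U := U) s x hx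
  exact ⟨V, leOfHom g, hxV, t, ht⟩

/-- If a presheaf of modules agrees with a sheaf on the open subsets of `U`, then it agrees there
with its sheafification. -/
lemma toSh_bijective (P : X.PresheafOfModules) (F : X.Modules) (U : X.Opens)
    (e : ∀ V, V ≤ U → (PSec P V ≃+ Γ(F, V)))
    (he : ∀ V hV W (h : W ≤ V) s,
      e W (h.trans hV) (pres P h s) = res F h (e V hV s))
    {V : X.Opens} (hV : V ≤ U) : Function.Bijective (toSh P V) := by
  have inj : ∀ V, V ≤ U → ∀ s, toSh P V s = 0 → s = 0 := fun V hV s hs => by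
    refine (e V hV).injective (section_ext F fun x hx => ?_)
    obtain ⟨W, hW, hxW, h⟩ := toSh_locally_injective P s hs x hx
    exact ⟨W, hW, hxW, by rw [← he V hV, h, map_zero, map_zero, map_zero]⟩
  have inj' : ∀ V, V ≤ U → Function.Injective (toSh P V) := fun V hV s t h => by
    rw [← sub_eq_zero]
    exact inj V hV _ (by rw [map_sub, h, sub_self])
  refine ⟨inj' V hV, fun s => ?_⟩
  -- Local preimages of `s` cannot be glued in the presheaf `P` directly. They are carried by `e` to
  -- the sheaf `F`, glued there and carried back.
  obtain ⟨t, ht⟩ := exists_glue_of_local F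
    (fun W hW t => toSh P W ((e W (hW.trans hV)).symm t) = res _ hW s)
    (fun W hW W' h t ht => by
      rw [← res_res _ hW h, ← ht, ← toSh_res]
      congr 1
      rw [AddEquiv.symm_apply_eq, he W (hW.trans hV), AddEquiv.apply_symm_apply])
    (fun W hW s t hs ht => (e W _).symm.injective (inj' W (hW.trans hV) (hs.trans ht.symm)))
    (fun x hx => by
      obtain ⟨W, hW, hxW, t, ht⟩ := toSh_locally_surjective P s x hx
      exact ⟨W, hW, hxW, e W (hW.trans hV) t, by rw [AddEquiv.symm_apply_apply, ht]⟩)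
  refine ⟨(e V hV).symm t, section_ext _ fun x hx => ?_⟩
  obtain ⟨W, hW, hxW, h⟩ := ht x hx
  refine ⟨W, hW, hxW, ?_⟩
  rw [← h, ← toSh_res]
  congr 1
  rw [← (e W (hW.trans hV)).apply_eq_iff_eq, AddEquiv.apply_symm_apply, he V hV, AddEquiv.apply_symm_apply]

lemma sheafify_hom_ext {P : X.PresheafOfModules} {F : X.Modules} {f g : (sheafify X).obj P ⟶ F}
    (h : ∀ U s, app f U (toSh P U s) = app g U (toSh P U s)) : f = g := by
  refine hom_ext_app fun U s => section_ext F fun x hx => ?_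
  obtain ⟨V, hV, hxV, t, ht⟩ := toSh_locally_surjective P s x hx
  exact ⟨V, hV, hxV, by rw [← app_res, ← app_res, ← ht, h]⟩

/-- The morphism out of a sheafification induced by a morphism of presheaves. -/
def shLift {P : X.PresheafOfModules} {F : X.Modules} (f : P ⟶ (toPresheafOfModules X).obj F) :
    (sheafify X).obj P ⟶ F := ((sheafifyAdj X).homEquiv P F).symm f

lemma app_shLift {P : X.PresheafOfModules} {F : X.Modules}
    (f : P ⟶ (toPresheafOfModules X).obj F) {U : X.Opens} (s : PSec P U) :
    app (shLift f) U (toSh P U s) = papp f U s :=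
  congrArg (fun g : P ⟶ (toPresheafOfModules X).obj F => papp g U s)
    (((sheafifyAdj X).homEquiv P F).apply_symm_apply f)

/-- The map from `N` to the sheafified presheaf cokernel kills `M`, hence is zero because `f` is
epi. So every section of `N` dies locally in the presheaf cokernel. That cokernel is computed on
each open set separately, so the section locally comes from `M`. -/
lemma isLocSurj_of_epi {M N : X.Modules} (f : M ⟶ N) [Epi f] : IsLocSurj f := by
  let f' := (toPresheafOfModules X).map f
  let q := cokernel.π f'
  let g : N ⟶ (sheafify X).obj (cokernel f') :=
    (fullyFaithfulToPresheafOfModules (X := X)).preimage (q ≫ (sheafifyAdj X).unit.app _)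
  have hg : ∀ U s, app g U s = toSh (cokernel f') U (papp q U s) := fun _ _ => rfl
  have h0 : g = 0 := by
    rw [← cancel_epi f, comp_zero]
    refine hom_ext_app fun U s => ?_
    rw [app_comp, hg]
    have : papp q U (app f U s) = 0 := congrArg (fun k : _ ⟶ cokernel f' => papp k U (s : PSec ((toPresheafOfModules X).obj M) U))
      (cokernel.condition f')
    rw [this, map_zero]; rfl
  intro U s x hx
  obtain ⟨V, hV, hxV, h⟩ := toSh_locally_injective _ (papp q U s)
    ((hg U s).symm.trans (by rw [h0]; rfl)) x hx
  refine ⟨V, hV, hxV, ?_⟩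
  have h' : papp q V (res N hV s) = 0 :=
    (papp_pres q hV s).trans h
  let F := PresheafOfModules.evaluation X.ringCatSheaf.obj (op V)
  have hex : (ShortComplex.mk (F.map f') (F.map q)
      (by rw [← F.map_comp]; exact (congrArg F.map (cokernel.condition f')).trans (F.map_zero _ _))).Exact :=
    ShortComplex.exact_of_g_is_cokernel _ (isColimitCoforkMapOfIsColimit' F (cokernel.condition f') (cokernelIsCokernel f'))
  rw [ShortComplex.moduleCat_exact_iff] at hex
  exact hex (res N hV s) h'

end ElementaryTransform

end

noncomputable section

namespace ElementaryTransform

open TopologicalSpace Opposite Scheme.Modules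

variable {X : Scheme.{u}}

/-! ### Local bases -/

section basis

variable {M N : X.Modules} {ι : Type*} [Fintype ι] {U : X.Opens}

/-- Sections `e k` of `M` over `U` form a basis of `M` over `U` if they restrict to a basis
of `Γ(M, V)` over `Γ(X, V)` for all open subsets `V` of `U`. -/
def IsBasis (M : X.Modules) {U : X.Opens} (e : ι → Γ(M, U)) : Prop :=
  ∀ V (h : V ≤ U), Function.Bijective (fun c : ι → Γ(X, V) => ∑ k, c k • res M h (e k))

protected lemma IsBasis.res {e : ι → Γ(M, U)} (he : IsBasis M e) {V : X.Opens} (h : V ≤ U) :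
    IsBasis M (fun k => res M h (e k)) := fun W hW => by
  simpa only [res_res] using he W (hW.trans h)

lemma app_sum (f : M ⟶ N) {V : X.Opens} (c : ι → Γ(X, V)) (e : ι → Γ(M, V)) :
    app f V (∑ k, c k • e k) = ∑ k, c k • app f V (e k) := by
  rw [map_sum]
  exact Finset.sum_congr rfl fun k _ => app_smul f _ _

lemma IsBasis.map {e : ι → Γ(M, U)} (he : IsBasis M e) (f : M ⟶ N)
    (hf : ∀ V ≤ U, Function.Bijective (app f V)) : IsBasis N (fun k => app f U (e k)) :=
  fun V hV => by
    convert! (hf V hV).comp (he V hV) using 1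
    funext c
    rw [Function.comp_apply, app_sum]
    simp only [app_res]

lemma IsBasis.bijective {e : ι → Γ(M, U)} (he : IsBasis M e) (f : M ⟶ N)
    (he' : IsBasis N (fun k => app f U (e k))) {V : X.Opens} (hV : V ≤ U) :
    Function.Bijective (app f V) := by
  refine (Function.Bijective.of_comp_iff _ (he V hV)).1 ?_
  convert! he' V hV using 1
  funext c
  rw [Function.comp_apply, app_sum]
  simp only [app_res]

lemma IsBasis.app_eq {e : ι → Γ(M, U)} (he : IsBasis M e) {f g : M ⟶ N}
    (h : ∀ k, app f U (e k) = app g U (e k)) {V : X.Opens} (hV : V ≤ U) (s : Γ(M, V)) :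
    app f V s = app g V s := by
  obtain ⟨c, rfl⟩ := (he V hV).2 s
  simp only [app_sum, app_res, h]

lemma IsBasis.reindex {κ : Type*} [Fintype κ] {e : ι → Γ(M, U)} (he : IsBasis M e)
    (σ : κ ≃ ι) : IsBasis M (fun k => e (σ k)) := fun V hV => by
  have := (he V hV).comp (σ.arrowCongr (Equiv.refl Γ(X, V))).bijective
  convert! this using 1
  funext c
  simp only [Function.comp_apply]
  exact Fintype.sum_equiv σ _ _ (fun k => by simp)

end basis

/-! ### The structure sheaf -/

/-- Functions as sections of the structure sheaf. -/
def oSec (U : X.Opens) : Γ(X, U) ≃ₗ[Γ(X, U)] Γ(structureSheaf X, U) where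
  toFun a := a
  invFun a := a
  map_add' _ _ := rfl
  map_smul' _ _ := rfl
  left_inv _ := rfl
  right_inv _ := rfl

lemma res_oSec {U V : X.Opens} (h : V ≤ U) (a : Γ(X, U)) :
    res (structureSheaf X) h (oSec U a) = oSec V (resO h a) := rfl

lemma oSec_eq_smul {U : X.Opens} (a : Γ(X, U)) : oSec U a = a • oSec U 1 := by
  rw [← _root_.map_smul, smul_eq_mul, mul_one]

/-! ### Free sheaves -/

section free

variable {ι : Type u} [Fintype ι]

/-- The free sheaf of modules on a finite type. -/
def freeMod (X : Scheme.{u}) (ι : Type u) : X.Modules :=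
  (SheafOfModules.free ι : SheafOfModules X.ringCatSheaf)

/-- The tautological sections of a free sheaf of modules. -/
def freeSec (X : Scheme.{u}) {ι : Type u} (k : ι) (U : X.Opens) : Γ(freeMod X ι, U) :=
  (SheafOfModules.freeSection (R := X.ringCatSheaf) k).val (op U)

lemma res_freeSec (k : ι) {U V : X.Opens} (h : V ≤ U) :
    res _ h (freeSec X k U) = freeSec X k V :=
  (SheafOfModules.freeSection (R := X.ringCatSheaf) k).property (homOfLE h).op

/-- The morphism from a free sheaf determined by sections over the whole space. -/
def freeDesc (M : X.Modules) {U : X.Opens} (hU : ∀ V, V ≤ U) (e : ι → Γ(M, U)) :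
    freeMod X ι ⟶ M :=
  (SheafOfModules.freeHomEquiv (R := X.ringCatSheaf) M).symm
    fun k => PresheafOfModules.sectionsMk (fun V => res M (hU V.unop) (e k))
      (fun {V W} f => res_res M (hU V.unop) (leOfHom f.unop) (e k))

lemma app_freeDesc (M : X.Modules) {U : X.Opens} (hU : ∀ V, V ≤ U) (e : ι → Γ(M, U)) (k : ι)
    (V : X.Opens) : app (freeDesc M hU e) V (freeSec X k V) = res M (hU V) (e k) :=
  congrArg (fun s => s.val (op V))
    (SheafOfModules.sectionsMap_freeHomEquiv_symm_freeSection (R := X.ringCatSheaf) (M := M)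
      (fun k => PresheafOfModules.sectionsMk (fun V => res M (hU V.unop) (e k))
        (fun {V W} f => res_res M (hU V.unop) (leOfHom f.unop) (e k))) k)

lemma free_hom_ext {M : X.Modules} {U : X.Opens} (hU : ∀ V, V ≤ U) {f g : freeMod X ι ⟶ M}
    (h : ∀ k, app f U (freeSec X k U) = app g U (freeSec X k U)) : f = g := by
  apply (SheafOfModules.freeHomEquiv (R := X.ringCatSheaf) M).injective
  funext k
  refine Subtype.ext (funext fun V => ?_)
  have := congrArg (res M (hU V.unop)) (h k)
  rw [← app_res, ← app_res, res_freeSec] at this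
  exact this

lemma freeDesc_bijective (M : X.Modules) {U : X.Opens} (hU : ∀ V, V ≤ U) : Function.Bijective
    (fun (f : freeMod X ι ⟶ M) (k : ι) => app f U (freeSec X k U)) :=
  ⟨fun _ _ h => free_hom_ext hU (fun k => congrFun h k), fun e => ⟨freeDesc M hU e, by
    funext k
    exact (app_freeDesc M hU e k U).trans (res_refl M _)⟩⟩

lemma free_isBasis (U : X.Opens) : IsBasis (freeMod X ι) (fun k => freeSec X k U) := by
  classical
  intro V hV
  simp only [res_freeSec]
  let π (k : ι) : freeMod X ι ⟶ structureSheaf X :=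
    freeDesc (U := ⊤) (structureSheaf X) (fun _ => le_top)
      (fun l => oSec ⊤ (if l = k then 1 else 0))
  have hπ (k l : ι) (V : X.Opens) :
      app (π k) V (freeSec X l V) = oSec V (if l = k then 1 else 0) := by
    rw [app_freeDesc, res_oSec]
    split_ifs
    · rw [map_one]
    · rw [map_zero]
  let j (k : ι) : structureSheaf X ⟶ freeMod X ι := SheafOfModules.ιFree (R := X.ringCatSheaf) k
  have hj (k : ι) (U : X.Opens) (a : Γ(X, U)) : app (j k) U (oSec U a) = a • freeSec X k U := by
    rw [oSec_eq_smul, app_smul]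
    rfl
  -- The coordinate projections `π` and inclusions `j` exhibit the free sheaf as a finite direct sum
  -- of copies of the structure sheaf; the identity is checked on the tautological sections.
  have hid : ∑ k, π k ≫ j k = 𝟙 _ := by
    refine free_hom_ext (U := ⊤) (fun _ => le_top) fun l => ?_
    have hs : ∀ (s : Finset ι) (f : ι → (freeMod X ι ⟶ freeMod X ι)) (x : Γ(freeMod X ι, ⊤)),
        app (∑ k ∈ s, f k) ⊤ x = ∑ k ∈ s, app (f k) ⊤ x := fun s f x => by
      induction s using Finset.induction_on with
      | empty => rfl
      | insert a s ha ih => rw [Finset.sum_insert ha, Finset.sum_insert ha, ← ih]; rfl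
    rw [hs]
    simp [hπ, hj, ite_smul]
  have hs (c : ι → Γ(X, V)) (k : ι) :
      app (π k) V (∑ l, c l • freeSec X l V) = oSec V (c k) := by
    rw [app_sum, oSec_eq_smul]
    simp [hπ, apply_ite, smul_ite]
  refine ⟨fun c d hcd => funext fun k => (oSec V).injective ?_, fun s => ?_⟩
  · rw [← hs, ← hs]
    exact congrArg _ hcd
  · refine ⟨fun k => (oSec V).symm (app (π k) V s), ?_⟩
    have hs' : ∀ (t : Finset ι), app (∑ k ∈ t, π k ≫ j k) V s =
        ∑ k ∈ t, (oSec V).symm (app (π k) V s) • freeSec X k V := fun t => by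
      induction t using Finset.induction_on with
      | empty => rfl
      | insert a t ha ih =>
        rw [Finset.sum_insert ha, Finset.sum_insert ha, ← ih, ← hj, LinearEquiv.apply_symm_apply]
        rfl
    exact (hs' _).symm.trans (by rw [hid]; rfl)

end free

/-! ### Vector bundles and local bases -/

section restrict

variable {M : X.Modules} {ι : Type u} [Fintype ι] {U : X.Opens}

/-- A section of `M` over `U`, regarded as a section of the restriction of `M` to `U`. -/
def resSec (M : X.Modules) {U : X.Opens} (W : (U : Scheme.{u}).Opens) (e : Γ(M, U)) :
    Γ(M.restrict U.ι, W) :=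
  res M (V := U.ι ''ᵁ W) (U := U) (U.ι_image_le W) e

lemma res_resSec (e : Γ(M, U)) {W W' : (U : Scheme.{u}).Opens} (h : W' ≤ W) :
    res (M.restrict U.ι) h (resSec M W e) = resSec M W' e :=
  res_res M (U.ι_image_le W) (Scheme.Hom.image_mono _ h) e

lemma resSec_basis_iff (e : ι → Γ(M, U)) (W : (U : Scheme.{u}).Opens) :
    Function.Bijective (fun c : ι → Γ(U, W) => ∑ k, c k • resSec M W (e k)) ↔
    Function.Bijective (fun c : ι → Γ(X, U.ι ''ᵁ W) =>
      ∑ k, c k • res M (U.ι_image_le W) (e k)) := by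
  have h : ∀ (c : Γ(X, U.ι ''ᵁ W)) (x : Γ(M, U.ι ''ᵁ W)),
      ((U.ι.appIso W).inv c : Γ(X, U.ι ''ᵁ W)) • x = c • x := fun c x => by
    rw [Scheme.Opens.ι_appIso]
    rfl
  convert! Iff.rfl using 2
  funext c
  exact Finset.sum_congr rfl fun k _ => (h _ _).symm

/-- The morphism from a free sheaf on `U` to the restriction of `M` determined by sections. -/
def freeToRestrict (e : ι → Γ(M, U)) : freeMod U ι ⟶ M.restrict U.ι :=
  freeDesc (U := ⊤) _ (fun _ => le_top) (fun k => resSec M ⊤ (e k))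

lemma app_freeToRestrict (e : ι → Γ(M, U)) (k : ι) (W : (U : Scheme.{u}).Opens) :
    app (freeToRestrict e) W (freeSec U k W) = resSec M W (e k) := by
  rw [freeToRestrict, app_freeDesc, res_resSec]

/-- In the tautological basis the map is `c ↦ ∑ k, c k • e k` over each open set of the scheme `U`,
and these open sets are exactly the open sets of `X` below `U`. -/
lemma isIso_freeToRestrict_iff (e : ι → Γ(M, U)) :
    IsIso (freeToRestrict e) ↔ IsBasis M e := by
  have key : ∀ W : (U : Scheme.{u}).Opens, Function.Bijective (app (freeToRestrict e) W) ↔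
      Function.Bijective (fun c : ι → Γ(X, U.ι ''ᵁ W) =>
      ∑ k, c k • res M (U.ι_image_le W) (e k)) := fun W => by
    rw [← resSec_basis_iff, ← Function.Bijective.of_comp_iff _ (free_isBasis W W le_rfl)]
    convert! Iff.rfl using 2
    funext c
    simp only [Function.comp_apply, app_sum, res_refl, app_freeToRestrict]
  constructor
  · intro h V hV
    have := (key (U.ι ⁻¹ᵁ V)).1 (bijective_of_isIso _ _)
    have hVe : U.ι ''ᵁ (U.ι ⁻¹ᵁ V) = V := by
      rw [Scheme.Hom.image_preimage_eq_opensRange_inf, Scheme.Opens.opensRange_ι]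
      exact inf_eq_right.2 hV
    revert hV
    rw [← hVe]
    intro hV
    exact this
  · intro h
    exact isIso_of_bijective _ fun W => (key W).2 (h _ _)

/-- From here on, local freeness is handled by sections over open sets of `X`, without restricted
sheaves. -/
lemma isVectorBundle_iff (r : ℕ) (M : X.Modules) : IsVectorBundle r M ↔
    ∀ x : X, ∃ U : X.Opens, x ∈ U ∧ ∃ e : Fin r → Γ(M, U), IsBasis M e := by
  constructor
  · intro h x
    obtain ⟨U, hx, ⟨f⟩⟩ := h x
    refine ⟨U, hx, ?_⟩
    let g : freeMod U (ULift.{u} (Fin r)) ≅ M.restrict U.ι := f.symm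
    let e (k : ULift.{u} (Fin r)) : Γ(M, U) :=
      res M (V := U) (U := U.ι ''ᵁ ⊤) (by simp) (app g.hom ⊤ (freeSec U k ⊤))
    have he : freeToRestrict e = g.hom := by
      refine free_hom_ext (U := ⊤) (fun _ => le_top) fun k => ?_
      rw [app_freeToRestrict]
      exact (res_res M _ _ _).trans (res_refl M _)
    have hb := (isIso_freeToRestrict_iff e).1 (he ▸ inferInstance)
    exact ⟨_, hb.reindex Equiv.ulift.symm⟩
  · intro h x
    obtain ⟨U, hx, e, he⟩ := h x
    have hb := he.reindex (Equiv.ulift.{u} (α := Fin r))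
    have := (isIso_freeToRestrict_iff _).2 hb
    exact ⟨U, hx, ⟨(asIso (freeToRestrict (fun k => e (Equiv.ulift.{u} k)))).symm⟩⟩

end restrict

end ElementaryTransform

end

noncomputable section

namespace ElementaryTransform

open TopologicalSpace Opposite Scheme.Modules

variable {X : Scheme.{u}}

/-! ### Local bases of pullbacks -/

section pullback

/-- Yoneda: `freeToRestrict e` is an isomorphism if and only if it induces bijections on maps into
every `H`. Maps out of the free sheaf are families of sections, and maps out of the restriction are
maps into a pushforward by adjunction. In this form the notion of basis passes to pullbacks. -/
lemma isBasis_iff_bijective {M : X.Modules} {ι : Type u} [Fintype ι] {U : X.Opens}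
    (e : ι → Γ(M, U)) : IsBasis M e ↔ ∀ H : (U : Scheme.{u}).Modules, Function.Bijective
      (fun (f : M ⟶ (pushforward U.ι).obj H) (k : ι) => app f U (e k)) := by
  rw [← isIso_freeToRestrict_iff, isIso_iff_coyoneda_map_bijective]
  refine forall_congr' fun H => ?_
  have hU : ∀ V, V ≤ U.ι ⁻¹ᵁ U := fun V => by simp
  rw [← Function.Bijective.of_comp_iff' (freeDesc_bijective H hU),
    ← Function.Bijective.of_comp_iff _ ((restrictAdjunction U.ι).homEquiv M H).bijective]
  convert! Iff.rfl using 2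
  funext f k
  rw [Function.comp_apply, Function.comp_apply, app_comp, app_freeToRestrict,
    Adjunction.homEquiv_unit]
  rfl

variable {D S : Scheme.{u}} (i : D ⟶ S)

/-- The adjunction map from sections of `M` to sections of its pullback. -/
def unitSec (M : S.Modules) (U : S.Opens) :
    Γ(M, U) →+ Γ((Scheme.Modules.pullback i).obj M, i ⁻¹ᵁ U) :=
  app ((pullbackPushforwardAdjunction i).unit.app M) U

/-- By adjunction, maps from the pullback of `M` to a sheaf pushed forward from `i ⁻¹ᵁ U` are maps
from `M` to a sheaf pushed forward from `U`, where the mapping criterion for `e` applies. -/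
protected lemma IsBasis.unitSec {M : S.Modules} {ι : Type u} [Fintype ι] {U : S.Opens} {e : ι → Γ(M, U)}
    (he : IsBasis M e) : IsBasis _ (fun k => unitSec i M U (e k)) := by
  rw [isBasis_iff_bijective]
  intro G
  -- The two ways around the square formed by `i`, its restriction over `U` and the two open
  -- inclusions.
  let σ : (pushforward i).obj ((pushforward (i ⁻¹ᵁ U).ι).obj G) ≅
      (pushforward U.ι).obj ((pushforward (i ∣_ U)).obj G) :=
    (pushforwardComp _ _).app G ≪≫ (pushforwardCongr (by simp)).app G ≪≫
      ((pushforwardComp _ _).app G).symm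
  have h := (isBasis_iff_bijective e).1 he ((pushforward (i ∣_ U)).obj G)
  rw [← Function.Bijective.of_comp_iff _
    ((Iso.homCongr (Iso.refl M) σ)).bijective, ← Function.Bijective.of_comp_iff _
    ((pullbackPushforwardAdjunction i).homEquiv M _).bijective] at h
  have h' : Function.Bijective (fun (s : ι → Γ(G, (i ⁻¹ᵁ U).ι ⁻¹ᵁ i ⁻¹ᵁ U)) (k : ι) =>
      app σ.hom U (s k)) := by
    have hb := bijective_of_isIso σ.hom U
    exact (Equiv.arrowCongr (Equiv.refl ι) (Equiv.ofBijective _ hb)).bijective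
  refine (Function.Bijective.of_comp_iff' h' _).1 ?_
  convert! h using 1

lemma app_unitSec {M : S.Modules} {L : D.Modules} (f : (Scheme.Modules.pullback i).obj M ⟶ L)
    {U : S.Opens} (s : Γ(M, U)) :
    app f (i ⁻¹ᵁ U) (unitSec i M U s) =
      app ((pullbackPushforwardAdjunction i).homEquiv M L f) U s := by
  rw [Adjunction.homEquiv_unit]; rfl

end pullback

end ElementaryTransform

end

noncomputable section

namespace ElementaryTransform

open TopologicalSpace Opposite Scheme.Modules
open scoped TensorProduct

variable {X : Scheme.{u}}

/-! ### Constructing morphisms -/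

/-- Constructor for morphisms of presheaves of modules. -/
def presheafHomMk {P Q : X.PresheafOfModules} (f : ∀ U, PSec P U →ₗ[Γ(X, U)] PSec Q U)
    (hf : ∀ U V (h : V ≤ U) s, f V (pres P h s) = pres Q h (f U s)) : P ⟶ Q where
  app U := ModuleCat.ofHom (X := P.obj U) (Y := Q.obj U) (f U.unop)
  naturality {U V} g := by
    ext x
    exact hf U.unop V.unop (leOfHom g.unop) x

/-- Constructor for morphisms from a sheafification. -/
def sheafifyDesc {P : X.PresheafOfModules} {F : X.Modules} (f : ∀ U, PSec P U →ₗ[Γ(X, U)] Γ(F, U))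
    (hf : ∀ U V (h : V ≤ U) s, f V (pres P h s) = res F h (f U s)) : (sheafify X).obj P ⟶ F :=
  shLift (presheafHomMk (Q := (toPresheafOfModules X).obj F) f hf)

lemma app_sheafifyDesc {P : X.PresheafOfModules} {F : X.Modules}
    (f : ∀ U, PSec P U →ₗ[Γ(X, U)] Γ(F, U))
    (hf : ∀ U V (h : V ≤ U) s, f V (pres P h s) = res F h (f U s)) {U : X.Opens} (s : PSec P U) :
    app (sheafifyDesc f hf) U (toSh P U s) = f U s :=
  app_shLift _ _

/-- Constructor for morphisms of sheaves of modules. -/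
def homMk {M N : X.Modules} (f : ∀ U, Γ(M, U) →ₗ[Γ(X, U)] Γ(N, U))
    (hf : ∀ U V (h : V ≤ U) s, f V (res M h s) = res N h (f U s)) : M ⟶ N :=
  fullyFaithfulToPresheafOfModules.preimage
    (presheafHomMk (P := (toPresheafOfModules X).obj M) (Q := (toPresheafOfModules X).obj N) f hf)

lemma app_homMk {M N : X.Modules} (f : ∀ U, Γ(M, U) →ₗ[Γ(X, U)] Γ(N, U))
    (hf : ∀ U V (h : V ≤ U) s, f V (res M h s) = res N h (f U s)) {U : X.Opens} (s : Γ(M, U)) :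
    app (homMk f hf) U s = f U s := rfl

/-! ### Tensor products -/

section tensor

/-- The presheaf tensor product. -/
def preTensor (M N : X.Modules) : X.PresheafOfModules :=
  (MonoidalCategory.tensorRight
      (C := _root_.PresheafOfModules.{u} (X.presheaf ⋙ forget₂ CommRingCat RingCat))
      ((toPresheafOfModules X).obj N)).obj ((toPresheafOfModules X).obj M)

/-- The functoriality of the presheaf tensor product. -/
def preTensorMap {M M' : X.Modules} (f : M ⟶ M') (N : X.Modules) :
    preTensor M N ⟶ preTensor M' N :=
  (MonoidalCategory.tensorRight
      (C := _root_.PresheafOfModules.{u} (X.presheaf ⋙ forget₂ CommRingCat RingCat))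
      ((toPresheafOfModules X).obj N)).map ((toPresheafOfModules X).map f)

/-- Sections of the presheaf tensor product. -/
def preTensorSec (M N : X.Modules) (U : X.Opens) :
    Γ(M, U) ⊗[Γ(X, U)] Γ(N, U) ≃ₗ[Γ(X, U)] PSec (preTensor M N) U :=
  LinearEquiv.refl _ _

lemma pres_preTensorSec (M N : X.Modules) {U V : X.Opens} (h : V ≤ U) (m : Γ(M, U)) (n : Γ(N, U)) :
    pres _ h (preTensorSec M N U (m ⊗ₜ n)) = preTensorSec M N V (res M h m ⊗ₜ res N h n) :=
  rfl

lemma papp_preTensorMap {M M' : X.Modules} (f : M ⟶ M') (N : X.Modules) {U : X.Opens}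
    (m : Γ(M, U)) (n : Γ(N, U)) :
    papp (preTensorMap f N) U (preTensorSec M N U (m ⊗ₜ n)) =
      preTensorSec M' N U (app f U m ⊗ₜ n) :=
  rfl

/-- The pure tensor of two sections. -/
def tmul {M N : X.Modules} {U : X.Opens} (m : Γ(M, U)) (n : Γ(N, U)) :
    Γ((tensorRight N).obj M, U) :=
  toSh (preTensor M N) U (preTensorSec M N U (m ⊗ₜ n))

lemma res_tmul {M N : X.Modules} {U V : X.Opens} (h : V ≤ U) (m : Γ(M, U)) (n : Γ(N, U)) :
    res _ h (tmul m n) = tmul (res M h m) (res N h n) := by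
  rw [tmul, tmul, ← pres_preTensorSec, toSh_res]
  rfl

lemma app_tmul {M M' : X.Modules} (f : M ⟶ M') {N : X.Modules} {U : X.Opens}
    (m : Γ(M, U)) (n : Γ(N, U)) :
    app ((tensorRight N).map f) U (tmul m n) = tmul (app f U m) n := by
  rw [tmul, tmul, ← papp_preTensorMap, ← toSh_naturality]
  rfl

lemma smul_tmul {M N : X.Modules} {U : X.Opens} (a : Γ(X, U)) (m : Γ(M, U)) (n : Γ(N, U)) :
    tmul (a • m) n = a • tmul m n := by
  rw [tmul, tmul, ← TensorProduct.smul_tmul', _root_.map_smul, _root_.map_smul]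
  rfl

lemma tmul_smul {M N : X.Modules} {U : X.Opens} (a : Γ(X, U)) (m : Γ(M, U)) (n : Γ(N, U)) :
    tmul m (a • n) = a • tmul m n := by
  rw [tmul, tmul, TensorProduct.tmul_smul, _root_.map_smul, _root_.map_smul]
  rfl

lemma add_tmul {M N : X.Modules} {U : X.Opens} (m m' : Γ(M, U)) (n : Γ(N, U)) :
    tmul (m + m') n = tmul m n + tmul m' n := by
  rw [tmul, TensorProduct.add_tmul, map_add, map_add]
  rfl

lemma zero_tmul {M N : X.Modules} {U : X.Opens} (n : Γ(N, U)) :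
    tmul (0 : Γ(M, U)) n = 0 := by
  rw [tmul, TensorProduct.zero_tmul, map_zero, map_zero]
  rfl

lemma tensor_hom_ext {M N P : X.Modules} {f g : (tensorRight N).obj M ⟶ P}
    (h : ∀ (U : X.Opens) (m : Γ(M, U)) (n : Γ(N, U)),
      app f U (tmul m n) = app g U (tmul m n)) : f = g := by
  refine sheafify_hom_ext (P := preTensor M N) fun U s => ?_
  obtain ⟨s, rfl⟩ := (preTensorSec M N U).surjective s
  induction s with
  | zero => simp only [map_zero]
  | add x y hx hy => simp only [map_add, hx, hy]
  | tmul m n => exact h U m n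

/-- A morphism out of a tensor product defined by bilinear maps on sections. -/
def tensorLift {M N P : X.Modules} (b : ∀ U : X.Opens, Γ(M, U) →ₗ[Γ(X, U)] Γ(N, U) →ₗ[Γ(X, U)] Γ(P, U))
    (hb : ∀ U V (h : V ≤ U) m n, res P h (b U m n) = b V (res M h m) (res N h n)) :
    (tensorRight N).obj M ⟶ P :=
  sheafifyDesc (P := preTensor M N)
    (fun U => TensorProduct.lift (b U) ∘ₗ (preTensorSec M N U).symm.toLinearMap)
    (fun U V h x => by
      obtain ⟨x, rfl⟩ := (preTensorSec M N U).surjective x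
      induction x with
      | zero => simp only [map_zero]
      | add x y hx hy => simp only [map_add, hx, hy]
      | tmul m n => exact (hb U V h m n).symm)

lemma app_tensorLift {M N P : X.Modules}
    (b : ∀ U : X.Opens, Γ(M, U) →ₗ[Γ(X, U)] Γ(N, U) →ₗ[Γ(X, U)] Γ(P, U))
    (hb : ∀ U V (h : V ≤ U) m n, res P h (b U m n) = b V (res M h m) (res N h n))
    {U : X.Opens} (m : Γ(M, U)) (n : Γ(N, U)) :
    app (tensorLift b hb) U (tmul m n) = b U m n :=
  app_sheafifyDesc (P := preTensor M N) _ _ _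

/-- If `t` is a basis of `N` over `U`, then `m ↦ m ⊗ t` is bijective. -/
lemma tmul_bijective {M N : X.Modules} {U : X.Opens} {t : Γ(N, U)}
    (ht : IsBasis N (fun _ : Fin 1 => t)) {V : X.Opens} (hV : V ≤ U) :
    Function.Bijective (fun m : Γ(M, V) => tmul m (res N hV t)) := by
  have hb : ∀ V (hV : V ≤ U), Function.Bijective (fun c : Γ(X, V) => c • res N hV t) :=
    fun V hV => by
      have := (ht V hV).comp (Equiv.funUnique (Fin 1) Γ(X, V)).symm.bijective
      convert! this using 1
      funext c
      simp
  let e₀ (V) (hV : V ≤ U) : Γ(X, V) ≃ₗ[Γ(X, V)] Γ(N, V) :=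
    LinearEquiv.ofBijective (LinearMap.toSpanSingleton Γ(X, V) _ (res N hV t)) (hb V hV)
  let e (V) (hV : V ≤ U) : Γ(M, V) ≃ₗ[Γ(X, V)] PSec (preTensor M N) V :=
    (TensorProduct.rid Γ(X, V) Γ(M, V)).symm ≪≫ₗ
      TensorProduct.congr (LinearEquiv.refl _ _) (e₀ V hV) ≪≫ₗ preTensorSec M N V
  have he (V) (hV : V ≤ U) (m) : e V hV m = preTensorSec M N V (m ⊗ₜ res N hV t) := by
    simp only [e, e₀, LinearEquiv.trans_apply, TensorProduct.rid_symm_apply,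
      TensorProduct.congr_tmul, LinearEquiv.refl_apply]
    exact congrArg (fun n => preTensorSec M N V (m ⊗ₜ n)) (one_smul _ _)
  -- Below `U` the presheaf tensor product is already isomorphic to the sheaf `M`, through `m ↦ m ⊗
  -- t`, so sheafification does not change it there.
  have := toSh_bijective (preTensor M N) M U (fun V hV => (e V hV).symm.toAddEquiv)
    (fun V hV W h s => by
      obtain ⟨m, rfl⟩ := (e V hV).surjective s
      change (e W _).symm _ = res M h ((e V hV).symm _)
      rw [LinearEquiv.symm_apply_apply, LinearEquiv.symm_apply_eq, he, he, pres_preTensorSec,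
        res_res]) hV
  convert! this.comp (e V hV).bijective using 1
  funext m
  exact congrArg (toSh _ V) (he V hV m).symm

end tensor

end ElementaryTransform

end

noncomputable section

namespace ElementaryTransform

open TopologicalSpace Opposite Scheme.Modules

variable {X : Scheme.{u}}

/-! ### The internal hom -/

section ihom

variable (N M : X.Modules)

/-- Compatible families of linear maps `Γ(N, W) → Γ(M, W)` for `W ≤ V`. -/
def homFamilies (V : X.Opens) :
    AddSubgroup (∀ W : {W : X.Opens // W ≤ V}, (Γ(N, W.1) →ₗ[Γ(X, W.1)] Γ(M, W.1))) where
  carrier := {g | ∀ W h W' (h' : W' ≤ W) n,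
    res M h' (g ⟨W, h⟩ n) = g ⟨W', h'.trans h⟩ (res N h' n)}
  zero_mem' := fun W h W' h' n => map_zero _
  add_mem' := fun {f g} hf hg W h W' h' n => by
    simp only [Pi.add_apply, LinearMap.add_apply, map_add, hf W h, hg W h]
  neg_mem' := fun {f} hf W h W' h' n => by
    simp only [Pi.neg_apply, LinearMap.neg_apply, map_neg, hf W h]

variable {N M}

lemma homFamilies_res {V : X.Opens} (g : homFamilies N M V) {W W' : X.Opens} (h : W ≤ V)
    (h' : W' ≤ W) (n : Γ(N, W)) : res M h' (g.1 ⟨W, h⟩ n) = g.1 ⟨W', (h'.trans h)⟩ (res N h' n) :=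
  g.2 W h W' h' n

lemma homFamilies_ext {V : X.Opens} {f g : homFamilies N M V}
    (h : ∀ W hW n, f.1 ⟨W, hW⟩ n = g.1 ⟨W, hW⟩ n) : f = g :=
  Subtype.ext (funext fun W => LinearMap.ext (h W.1 W.2))

instance (V : X.Opens) : Module Γ(X, V) (homFamilies N M V) where
  smul a g := ⟨fun W => resO W.2 a • g.1 W, fun W h W' h' n => by

    change res M h' (resO h a • g.1 ⟨W, h⟩ n) = resO (h'.trans h) a • g.1 ⟨W', _⟩ (res N h' n)
    rw [res_smul, resO_resO, homFamilies_res]⟩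
  one_smul g := homFamilies_ext fun W h n => by
    change resO h 1 • g.1 ⟨W, h⟩ n = _
    rw [map_one, one_smul]
  mul_smul a b g := homFamilies_ext fun W h n => by
    change resO h (a * b) • g.1 ⟨W, h⟩ n = resO h a • resO h b • g.1 ⟨W, h⟩ n
    rw [map_mul, mul_smul]
  smul_zero a := homFamilies_ext fun W h n => by
    change resO h a • (0 : Γ(M, W)) = 0
    rw [smul_zero]
  smul_add a f g := homFamilies_ext fun W h n => by
    change resO h a • (f.1 ⟨W, h⟩ n + g.1 ⟨W, h⟩ n) = resO h a • f.1 ⟨W, h⟩ n + resO h a • g.1 ⟨W, h⟩ n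
    rw [smul_add]
  add_smul a b g := homFamilies_ext fun W h n => by
    change resO h (a + b) • g.1 ⟨W, h⟩ n = resO h a • g.1 ⟨W, h⟩ n + resO h b • g.1 ⟨W, h⟩ n
    rw [map_add, add_smul]
  zero_smul g := homFamilies_ext fun W h n => by
    change resO h 0 • g.1 ⟨W, h⟩ n = 0
    rw [map_zero, zero_smul]

/-- Restriction of compatible families. -/
def homFamiliesRes {U V : X.Opens} (h : V ≤ U) : homFamilies N M U →+ homFamilies N M V where
  toFun g := ⟨fun W => g.1 ⟨W.1, W.2.trans h⟩, fun W hW W' h' n => g.2 W (hW.trans h) W' h' n⟩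
  map_zero' := rfl
  map_add' _ _ := rfl

/-- Only the sheaf property of `M` is needed: the value at `n` over `W` is glued from the values of
`g k` over `W ⊓ V k`, and linearity is verified on the pieces. -/
lemma homFamilies_glue {ι : Type u} (V : ι → X.Opens) (g : ∀ k, homFamilies N M (V k))
    (hg : ∀ k l W (h : W ≤ V k) (h' : W ≤ V l) n, (g k).1 ⟨W, h⟩ n = (g l).1 ⟨W, h'⟩ n) :
    ∃ f : homFamilies N M (iSup V), ∀ k W (h : W ≤ V k) n,
      f.1 ⟨W, (h.trans (le_iSup V k))⟩ n = (g k).1 ⟨W, h⟩ n := by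
  have hu : ∀ W (_ : W ≤ iSup V) (m m' : Γ(M, W)),
      (∀ k W' (h : W' ≤ W) (_ : W' ≤ V k), res M h m = res M h m') → m = m' :=
    fun W hW m m' h => section_ext M fun x hx => by
      obtain ⟨k, hk⟩ := Opens.mem_iSup.1 (hW hx)
      exact ⟨W ⊓ V k, inf_le_left, ⟨hx, hk⟩, h k _ _ inf_le_right⟩
  have he : ∀ W (_ : W ≤ iSup V) (n : Γ(N, W)), ∃ m : Γ(M, W),
      ∀ k W' (h : W' ≤ W) (h' : W' ≤ V k), res M h m = (g k).1 ⟨W', h'⟩ (res N h n) :=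
    fun W hW n => by
      obtain ⟨m, hm⟩ := exists_glue M (U := W) (fun k => W ⊓ V k) (fun k => inf_le_left)
        (fun x hx => by
          obtain ⟨k, hk⟩ := Opens.mem_iSup.1 (hW hx)
          exact Opens.mem_iSup.2 ⟨k, hx, hk⟩)
        (fun k => (g k).1 ⟨_, inf_le_right⟩ (res N inf_le_left n))
        (fun k l W' h h' => by
          rw [homFamilies_res, homFamilies_res, res_res, res_res]
          exact hg _ _ _ _ _ _)
      refine ⟨m, fun k W' h h' => ?_⟩
      rw [← res_res M inf_le_left (le_inf h h'), hm, homFamilies_res, res_res]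
  choose m hm using he
  refine ⟨⟨fun ⟨W, hW⟩ =>
    { toFun := m W hW
      map_add' := fun n n' => hu W hW _ _ fun k W' h h' => by
        rw [hm _ _ _ k _ h h', map_add, map_add, map_add, hm _ _ _ k _ h h', hm _ _ _ k _ h h']
      map_smul' := fun a n => hu W hW _ _ fun k W' h h' => by
        rw [hm _ _ _ k _ h h', RingHom.id_apply, res_smul, res_smul, _root_.map_smul,
          hm _ _ _ k _ h h'] }, fun W hW W' h n => ?_⟩, fun k W h n => ?_⟩
  · refine hu W' (h.trans hW) _ _ fun k W'' h1 h2 => ?_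
    change res M h1 (res M h (m W hW n)) = res M h1 (m W' _ (res N h n))
    rw [hm _ _ _ k _ h1 h2, res_res, res_res, hm _ _ _ k _ _ h2]
  · change m W _ n = _
    rw [← res_refl M (m W _ n), hm _ _ _ k W le_rfl h, res_refl]

variable (N M)

/-- The presheaf of compatible families. -/
def ihomPresheaf : TopCat.Presheaf Ab.{u} X where
  obj V := AddCommGrpCat.of (homFamilies N M V.unop)
  map f := AddCommGrpCat.ofHom (homFamiliesRes (leOfHom f.unop))

instance (V : X.Opensᵒᵖ) : Module (X.ringCatSheaf.obj.obj V) ((ihomPresheaf N M).obj V) :=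
  inferInstanceAs (Module Γ(X, V.unop) (homFamilies N M V.unop))

/-- The internal hom of sheaves of modules. -/
def ihomObj : X.Modules where
  val := PresheafOfModules.ofPresheaf (ihomPresheaf N M) (fun U V f r m =>
    homFamilies_ext fun W h n =>
      (congrArg (fun a => a • m.1 ⟨W, (h.trans (leOfHom f.unop))⟩ n)
        (resO_resO (leOfHom f.unop) h r)).symm)
  isSheaf := by
    change TopCat.Presheaf.IsSheaf (ihomPresheaf N M)
    rw [TopCat.Presheaf.isSheaf_iff_isSheafUniqueGluing]
    intro ι V g hg
    obtain ⟨f, hf⟩ := homFamilies_glue V g (fun k l W h h' n =>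
      congrArg (fun (q : homFamilies N M (V k ⊓ V l)) => q.1 ⟨W, (le_inf h h')⟩ n) (hg k l))
    refine ⟨f, fun k => homFamilies_ext (hf k), fun (f' : homFamilies N M (iSup V)) hf' => ?_⟩
    refine homFamilies_ext fun W h n => section_ext M fun x hx => ?_
    obtain ⟨k, hk⟩ := Opens.mem_iSup.1 (h hx)
    refine ⟨W ⊓ V k, inf_le_left, ⟨hx, hk⟩, ?_⟩
    rw [homFamilies_res, homFamilies_res, hf k _ inf_le_right]
    exact congrArg (fun (q : homFamilies N M (V k)) => q.1 ⟨(W ⊓ V k), inf_le_right⟩ _) (hf' k)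

/-- Sections of the internal hom. -/
def ihomSec (V : X.Opens) : homFamilies N M V ≃ₗ[Γ(X, V)] Γ(ihomObj N M, V) :=
  LinearEquiv.refl _ _

variable {N M}

/-- Evaluation of a section of the internal hom at a section. -/
def evalSec {V : X.Opens} (g : Γ(ihomObj N M, V)) : Γ(N, V) →ₗ[Γ(X, V)] Γ(M, V) :=
  ((ihomSec N M V).symm g).1 ⟨V, le_rfl⟩

lemma res_evalSec {V W : X.Opens} (h : W ≤ V) (g : Γ(ihomObj N M, V)) (n : Γ(N, V)) :
    res M h (evalSec g n) = evalSec (res _ h g) (res N h n) :=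
  homFamilies_res ((ihomSec N M V).symm g) le_rfl h n

lemma evalSec_add {V : X.Opens} (g g' : Γ(ihomObj N M, V)) (n : Γ(N, V)) :
    evalSec (g + g') n = evalSec g n + evalSec g' n := rfl

lemma evalSec_smul {V : X.Opens} (a : Γ(X, V)) (g : Γ(ihomObj N M, V)) (n : Γ(N, V)) :
    evalSec (a • g) n = a • evalSec g n :=
  congrArg (fun a : Γ(X, V) => a • evalSec g n) (resO_refl a)

lemma ihom_ext {V : X.Opens} {g g' : Γ(ihomObj N M, V)}
    (h : ∀ W (hW : W ≤ V) n, evalSec (res _ hW g) n = evalSec (res _ hW g') n) : g = g' :=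
  homFamilies_ext (f := g) (g := g') h

/-- Constructor for sections of the internal hom. -/
def ihomMk {V : X.Opens} (g : ∀ W : X.Opens, W ≤ V → (Γ(N, W) →ₗ[Γ(X, W)] Γ(M, W)))
    (hg : ∀ W h W' (h' : W' ≤ W) n, res M h' (g W h n) = g W' (h'.trans h) (res N h' n)) :
    Γ(ihomObj N M, V) :=
  ihomSec N M V ⟨fun W => g W.1 W.2, hg⟩

lemma evalSec_res_ihomMk {V : X.Opens}
    (g : ∀ W : X.Opens, W ≤ V → (Γ(N, W) →ₗ[Γ(X, W)] Γ(M, W)))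
    (hg : ∀ W h W' (h' : W' ≤ W) n, res M h' (g W h n) = g W' (h'.trans h) (res N h' n))
    {W : X.Opens} (hW : W ≤ V) (n : Γ(N, W)) :
    evalSec (res _ hW (ihomMk g hg)) n = g W hW n := rfl

lemma evalSec_ihomMk {V : X.Opens}
    (g : ∀ W : X.Opens, W ≤ V → (Γ(N, W) →ₗ[Γ(X, W)] Γ(M, W)))
    (hg : ∀ W h W' (h' : W' ≤ W) n, res M h' (g W h n) = g W' (h'.trans h) (res N h' n))
    (n : Γ(N, V)) : evalSec (ihomMk g hg) n = g V le_rfl n := rfl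

lemma exists_smul_of_isBasis {N : X.Modules} {U : X.Opens} {t : Γ(N, U)}
    (ht : IsBasis N (fun _ : Fin 1 => t)) {V : X.Opens} (hV : V ≤ U) :
    Function.Bijective (fun c : Γ(X, V) => c • res N hV t) := by
  have := (ht V hV).comp (Equiv.funUnique (Fin 1) Γ(X, V)).symm.bijective
  convert! this using 1
  funext c
  simp

/-- If `t` is a basis of `N` over `U`, evaluation at `t` is bijective. -/
lemma evalSec_bijective {U : X.Opens} {t : Γ(N, U)} (ht : IsBasis N (fun _ : Fin 1 => t))
    {V : X.Opens} (hV : V ≤ U) :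
    Function.Bijective (fun g : Γ(ihomObj N M, V) => evalSec g (res N hV t)) := by
  constructor
  · intro g g' h
    refine ihom_ext fun W hW n => ?_
    obtain ⟨c, rfl⟩ := (exists_smul_of_isBasis ht (hW.trans hV)).2 n
    have := congrArg (res M hW) h
    simp only [res_evalSec, res_res] at this
    simp only [_root_.map_smul, this]
  · intro m
    let e (W) (hW : W ≤ V) : Γ(X, W) ≃ₗ[Γ(X, W)] Γ(N, W) :=
      LinearEquiv.ofBijective (LinearMap.toSpanSingleton Γ(X, W) _ (res N (hW.trans hV) t))
        (exists_smul_of_isBasis ht (hW.trans hV))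
    have he (W) (hW : W ≤ V) (c : Γ(X, W)) : e W hW c = c • res N (hW.trans hV) t := rfl
    refine ⟨ihomMk (fun W hW => LinearMap.toSpanSingleton Γ(X, W) _ (res M hW m) ∘ₗ
      (e W hW).symm.toLinearMap) (fun W h W' h' n => ?_), ?_⟩
    · obtain ⟨c, rfl⟩ := (e W h).surjective n
      have : res N h' (e W h c) = e W' (h'.trans h) (resO h' c) := by
        rw [he W h, he W' (h'.trans h), res_smul, res_res]
      simp only [LinearMap.comp_apply, LinearEquiv.coe_coe, this, LinearEquiv.symm_apply_apply,
        LinearMap.toSpanSingleton_apply, res_smul, res_res]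
    · have : res N hV t = e V le_rfl 1 := (one_smul _ _).symm
      simp only [evalSec_ihomMk, LinearMap.comp_apply, LinearEquiv.coe_coe, this,
        LinearEquiv.symm_apply_apply, LinearMap.toSpanSingleton_apply, one_smul, res_refl]

variable (N)

/-- The linear map on sections induced by a morphism of sheaves of modules. -/
def appLin {M M' : X.Modules} (f : M ⟶ M') (U : X.Opens) : Γ(M, U) →ₗ[Γ(X, U)] Γ(M', U) where
  toFun := app f U
  map_add' := map_add _
  map_smul' := app_smul f

/-- Postcomposition on sections of the internal hom. -/
def ihomMapSec {M M' : X.Modules} (f : M ⟶ M') {U : X.Opens} (g : Γ(ihomObj N M, U)) :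
    Γ(ihomObj N M', U) :=
  ihomMk (fun W h => appLin f W ∘ₗ evalSec (res _ h g)) (fun W h W' h' n => by
    simp only [LinearMap.comp_apply, appLin, LinearMap.coe_mk, AddHom.coe_mk]
    rw [← app_res, res_evalSec, res_res])

lemma evalSec_res_ihomMapSec {M M' : X.Modules} (f : M ⟶ M') {U W : X.Opens}
    (g : Γ(ihomObj N M, U)) (h : W ≤ U) (n : Γ(N, W)) :
    evalSec (res _ h (ihomMapSec N f g)) n = app f W (evalSec (res _ h g) n) :=
  evalSec_res_ihomMk _ _ h n

/-- Postcomposition on the internal hom. -/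
def ihomMap {M M' : X.Modules} (f : M ⟶ M') : ihomObj N M ⟶ ihomObj N M' :=
  homMk
    (fun U =>
      { toFun := ihomMapSec N f
        map_add' := fun g g' => ihom_ext fun W h n => by
          rw [map_add, evalSec_add, evalSec_res_ihomMapSec, evalSec_res_ihomMapSec,
            evalSec_res_ihomMapSec, map_add, evalSec_add, map_add]
        map_smul' := fun a g => ihom_ext fun W h n => by
          rw [RingHom.id_apply, res_smul, evalSec_smul, evalSec_res_ihomMapSec,
            evalSec_res_ihomMapSec, res_smul, evalSec_smul, app_smul] })
    (fun U V h g => ihom_ext fun W hW n => by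
      simp only [LinearMap.coe_mk, AddHom.coe_mk]
      rw [evalSec_res_ihomMapSec, res_res, res_res, evalSec_res_ihomMapSec])

lemma app_ihomMap {M M' : X.Modules} (f : M ⟶ M') {U : X.Opens} (g : Γ(ihomObj N M, U)) :
    app (ihomMap N f) U g = ihomMapSec N f g := rfl

lemma evalSec_ihomMap {M M' : X.Modules} (f : M ⟶ M') {U : X.Opens} (g : Γ(ihomObj N M, U))
    (n : Γ(N, U)) : evalSec (app (ihomMap N f) U g) n = app f U (evalSec g n) := by
  rw [app_ihomMap, ← res_refl _ (ihomMapSec N f g), evalSec_res_ihomMapSec, res_refl]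

/-- The internal hom functor. -/
def ihomFunctor : X.Modules ⥤ X.Modules where
  obj M := ihomObj N M
  map f := ihomMap N f
  map_id M := hom_ext_app fun U g => ihom_ext fun W h n => by
    rw [← app_res, evalSec_ihomMap]; rfl
  map_comp f g := hom_ext_app fun U s => ihom_ext fun W h n => by
    rw [← app_res, evalSec_ihomMap, app_comp, app_comp, ← app_res, ← app_res, evalSec_ihomMap,
      evalSec_ihomMap]

/-- The evaluation `ℋom(N, M) ⊗ N ⟶ M`. -/
def ihomEval (M : X.Modules) : (tensorRight N).obj (ihomObj N M) ⟶ M :=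
  tensorLift (fun U =>
    { toFun := evalSec
      map_add' := fun g g' => rfl
      map_smul' := fun a g => LinearMap.ext fun n => evalSec_smul a g n })
    (fun U V h g n => res_evalSec h g n)

lemma app_ihomEval (M : X.Modules) {U : X.Opens} (g : Γ(ihomObj N M, U)) (n : Γ(N, U)) :
    app (ihomEval N M) U (tmul g n) = evalSec g n :=
  app_tensorLift _ _ _ _

/-- Tensoring with a fixed section, as a linear map. -/
def tmulLin {N M : X.Modules} {U : X.Opens} (m : Γ(M, U)) :
    Γ(N, U) →ₗ[Γ(X, U)] Γ((tensorRight N).obj M, U) where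
  toFun n := tmul m n
  map_add' n n' := by
    rw [tmul, TensorProduct.tmul_add, map_add, map_add]; rfl
  map_smul' a n := tmul_smul a _ n

/-- The coevaluation on sections. -/
def ihomCoevalSec (M : X.Modules) {U : X.Opens} (m : Γ(M, U)) :
    Γ(ihomObj N ((tensorRight N).obj M), U) :=
  ihomMk (fun W h => tmulLin (res M h m)) (fun W h W' h' n => by
    simp only [tmulLin, LinearMap.coe_mk, AddHom.coe_mk]
    rw [res_tmul, res_res])

lemma evalSec_res_ihomCoevalSec (M : X.Modules) {U W : X.Opens} (m : Γ(M, U)) (h : W ≤ U)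
    (n : Γ(N, W)) : evalSec (res _ h (ihomCoevalSec N M m)) n = tmul (res M h m) n :=
  evalSec_res_ihomMk _ _ h n

/-- The coevaluation `M ⟶ ℋom(N, M ⊗ N)`. -/
def ihomCoeval (M : X.Modules) : M ⟶ ihomObj N ((tensorRight N).obj M) :=
  homMk (fun U =>
    { toFun := ihomCoevalSec N M
      map_add' := fun m m' => ihom_ext fun W h n => by
        rw [map_add, evalSec_add, evalSec_res_ihomCoevalSec, evalSec_res_ihomCoevalSec,
          evalSec_res_ihomCoevalSec, map_add, add_tmul]
      map_smul' := fun a m => ihom_ext fun W h n => by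
        rw [RingHom.id_apply, res_smul, evalSec_smul, evalSec_res_ihomCoevalSec,
          evalSec_res_ihomCoevalSec, res_smul, smul_tmul] })
    (fun U V h m => ihom_ext fun W hW n => by
      simp only [LinearMap.coe_mk, AddHom.coe_mk]
      rw [evalSec_res_ihomCoevalSec, res_res, res_res, evalSec_res_ihomCoevalSec])

lemma app_ihomCoeval (M : X.Modules) {U : X.Opens} (m : Γ(M, U)) :
    app (ihomCoeval N M) U m = ihomCoevalSec N M m := rfl

lemma evalSec_ihomCoeval (M : X.Modules) {U : X.Opens} (m : Γ(M, U)) (n : Γ(N, U)) :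
    evalSec (app (ihomCoeval N M) U m) n = tmul m n := by
  rw [app_ihomCoeval, ← res_refl _ (ihomCoevalSec N M m), evalSec_res_ihomCoevalSec, res_refl]

variable {N}

/-- A sheaf of modules which is locally free of rank one. -/
def IsInvertible (N : X.Modules) : Prop :=
  ∀ x : X, ∃ U : X.Opens, x ∈ U ∧ ∃ t : Γ(N, U), IsBasis N (fun _ : Fin 1 => t)

/-- Near a point where `t` generates `N`, both `g ↦ g ⊗ t` and `g ↦ g(t)` are bijective, and
evaluation carries the first to the second. -/
lemma IsInvertible.isIso_ihomEval (hN : IsInvertible N) (M : X.Modules) :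
    IsIso (ihomEval N M) := by
  refine isIso_of_local _ (.of_forall_le fun x => ?_)
  obtain ⟨U, hx, t, ht⟩ := hN x
  refine ⟨U, hx, fun V hV => ?_⟩
  rw [← Function.Bijective.of_comp_iff _ (tmul_bijective ht hV)]
  convert! evalSec_bijective (M := M) ht hV using 1
  funext g
  exact app_ihomEval N M g _

/-- Followed by evaluation at a local generator `t`, the coevaluation becomes the bijection `m ↦ m ⊗
t`. -/
lemma IsInvertible.isIso_ihomCoeval (hN : IsInvertible N) (M : X.Modules) :
    IsIso (ihomCoeval N M) := by
  refine isIso_of_local _ (.of_forall_le fun x => ?_)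
  obtain ⟨U, hx, t, ht⟩ := hN x
  refine ⟨U, hx, fun V hV => ?_⟩
  rw [← Function.Bijective.of_comp_iff' (evalSec_bijective ht hV)]
  convert! tmul_bijective (M := M) ht hV using 1
  funext m
  exact evalSec_ihomCoeval N M m _

/-- Tensoring with an invertible sheaf is an equivalence. -/
def IsInvertible.tensorEquivalence (hN : IsInvertible N) : X.Modules ≌ X.Modules :=
  CategoryTheory.Equivalence.mk (tensorRight N) (ihomFunctor N)
    (NatIso.ofComponents (fun M => @asIso _ _ _ _ (ihomCoeval N M) (hN.isIso_ihomCoeval M)) (fun {M M'} f =>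
      hom_ext_app fun U m => ihom_ext fun W h n => by
        change evalSec (res _ h (app (ihomCoeval N M') U (app f U m))) n =
          evalSec (res _ h (app (ihomMap N _) U (app (ihomCoeval N M) U m))) n
        rw [← app_res, ← app_res, ← app_res, ← app_res, evalSec_ihomCoeval, evalSec_ihomMap,
          evalSec_ihomCoeval, app_tmul]))
    (NatIso.ofComponents (fun M => @asIso _ _ _ _ (ihomEval N M) (hN.isIso_ihomEval M)) (fun {M M'} f =>
      tensor_hom_ext fun U (g : Γ(ihomObj N M, U)) n => by
        change app (ihomEval N M') U (app ((tensorRight N).map (ihomMap N f)) U (tmul g n)) =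
          app f U (app (ihomEval N M) U (tmul g n))
        rw [app_tmul, app_ihomEval, app_ihomEval, evalSec_ihomMap]))

lemma IsInvertible.isEquivalence (hN : IsInvertible N) : (tensorRight N).IsEquivalence :=
  hN.tensorEquivalence.isEquivalence_functor

end ihom

end ElementaryTransform

end

noncomputable section

namespace ElementaryTransform

open TopologicalSpace Opposite Scheme.Modules

variable {D S : Scheme.{u}} (i : D ⟶ S)

/-! ### Pushforwards along closed immersions -/

section pushforward

/-- Sections of a pushforward. -/
def pf (L : D.Modules) (U : S.Opens) : Γ(L, i ⁻¹ᵁ U) ≃+ Γ((pushforward i).obj L, U) :=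
  AddEquiv.refl _

variable {i}

lemma preimage_le {U V : S.Opens} (h : V ≤ U) : i ⁻¹ᵁ V ≤ i ⁻¹ᵁ U := fun _ hx => h hx

lemma smul_pf {L : D.Modules} {U : S.Opens} (a : Γ(S, U)) (s : Γ(L, i ⁻¹ᵁ U)) :
    a • pf i L U s = pf i L U (i.app U a • s) := rfl

lemma pf_symm_smul {L : D.Modules} {U : S.Opens} (a : Γ(S, U))
    (s : Γ((pushforward i).obj L, U)) :
    (pf i L U).symm (a • s) = i.app U a • (pf i L U).symm s := rfl

lemma res_pf {L : D.Modules} {U V : S.Opens} (h : V ≤ U) (s : Γ(L, i ⁻¹ᵁ U)) :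
    res _ h (pf i L U s) = pf i L V (res L (preimage_le h) s) := rfl

lemma res_pf_symm {L : D.Modules} {U V : S.Opens} (h : V ≤ U) (s : Γ((pushforward i).obj L, U)) :
    res L (preimage_le h) ((pf i L U).symm s) = (pf i L V).symm (res _ h s) := rfl

lemma app_pf {L L' : D.Modules} (f : L ⟶ L') {U : S.Opens} (s : Γ(L, i ⁻¹ᵁ U)) :
    app ((pushforward i).map f) U (pf i L U s) = pf i L' U (app f (i ⁻¹ᵁ U) s) := rfl

lemma resO_app {U V : S.Opens} (h : V ≤ U) (a : Γ(S, U)) :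
    resO (preimage_le h) (i.app U a) = i.app V (resO h a) :=
  (ConcreteCategory.congr_hom (i.naturality (homOfLE h).op) a).symm

lemma app_unit {M : S.Modules} {U : S.Opens} (m : Γ(M, U)) :
    app ((pullbackPushforwardAdjunction i).unit.app M) U m = pf i _ U (unitSec i M U m) := rfl

lemma unitSec_smul {M : S.Modules} {U : S.Opens} (a : Γ(S, U)) (m : Γ(M, U)) :
    unitSec i M U (a • m) = i.app U a • unitSec i M U m := by
  apply (pf i _ U).injective
  rw [← app_unit, app_smul, app_unit, smul_pf]

lemma res_unitSec {M : S.Modules} {U V : S.Opens} (h : V ≤ U) (m : Γ(M, U)) :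
    res _ (preimage_le h) (unitSec i M U m) = unitSec i M V (res M h m) :=
  (app_res ((pullbackPushforwardAdjunction i).unit.app M) h m).symm

variable (i) in
/-- The largest open subset with preimage contained in a given open subset. -/
def extendOpen (W : D.Opens) : S.Opens := sSup {V | i ⁻¹ᵁ V ≤ W}

lemma le_extendOpen {V : S.Opens} {W : D.Opens} (h : i ⁻¹ᵁ V ≤ W) : V ≤ extendOpen i W :=
  le_sSup h

lemma preimage_extendOpen_le (W : D.Opens) : i ⁻¹ᵁ extendOpen i W ≤ W := fun x hx => by
  obtain ⟨V, hV, hx⟩ := Opens.mem_sSup.1 (show i x ∈ sSup {V | i ⁻¹ᵁ V ≤ W} from hx)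
  exact hV hx

variable [IsClosedImmersion i]

lemma exists_lift {U : S.Opens} (a : Γ(D, i ⁻¹ᵁ U)) (x : S) (hx : x ∈ U) :
    ∃ (V : S.Opens) (hV : V ≤ U), x ∈ V ∧ ∃ b : Γ(S, V), i.app V b = resO (preimage_le hV) a := by
  obtain ⟨V, hVa, hxV, hVU⟩ := Opens.isBasis_iff_nbhd.1 S.isBasis_affineOpens hx
  exact ⟨V, hVU, hxV, i.app_surjective V hVa _⟩

lemma exists_preimage_eq (W : D.Opens) : ∃ V : S.Opens, i ⁻¹ᵁ V = W := by
  obtain ⟨V, hV, h⟩ := i.isClosedEmbedding.isInducing.isOpen_iff.1 W.isOpen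
  exact ⟨⟨V, hV⟩, Opens.ext h⟩

lemma le_preimage_extendOpen (W : D.Opens) : W ≤ i ⁻¹ᵁ extendOpen i W := by
  obtain ⟨V, rfl⟩ := exists_preimage_eq (i := i) W
  exact preimage_le (le_extendOpen le_rfl)

instance : (pushforward i).Faithful where
  map_injective {F G} f g h := hom_ext_app fun W s => by
    obtain ⟨V, rfl⟩ := exists_preimage_eq (i := i) W
    apply (pf i G V).injective
    rw [← app_pf, ← app_pf, h]

/-- The map on sections underlying the preimage under `i_*` of a morphism `i_* F ⟶ i_* G`. -/
def descendFun {F G : D.Modules} (f : (pushforward i).obj F ⟶ (pushforward i).obj G)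
    (W : D.Opens) : Γ(F, W) →+ Γ(G, W) :=
  (res G (le_preimage_extendOpen (i := i) W)).comp
    ((pf i G (extendOpen i W)).symm.toAddMonoidHom.comp ((app f (extendOpen i W)).comp
      ((pf i F (extendOpen i W)).toAddMonoidHom.comp
        (res F (preimage_extendOpen_le (i := i) W)))))

/-- The working description of `descendFun`: on preimages of open sets of `S` it is given by `f`.
Since every open set of `D` is such a preimage, its other properties reduce to this one. -/
lemma res_descendFun {F G : D.Modules} (f : (pushforward i).obj F ⟶ (pushforward i).obj G)
    {W : D.Opens} (s : Γ(F, W)) {V : S.Opens} (h : i ⁻¹ᵁ V ≤ W) :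
    res G h (descendFun f W s) = (pf i G V).symm (app f V (pf i F V (res F h s))) := by
  change res G h (res G _ ((pf i G (extendOpen i W)).symm (app f (extendOpen i W)
    (pf i F (extendOpen i W) (res F _ s))))) = _
  rw [res_res, res_pf_symm (le_extendOpen h), ← app_res, res_pf, res_res]

lemma section_ext_pushforward {G : D.Modules} {W : D.Opens} (s t : Γ(G, W))
    (h : ∀ x ∈ extendOpen i W, ∃ V : S.Opens,
      ∃ h : i ⁻¹ᵁ V ≤ W, x ∈ V ∧ res G h s = res G h t) : s = t :=
  section_ext G fun y hy => by
    obtain ⟨V, h, hx, e⟩ := h (i y) (le_preimage_extendOpen W hy)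
    exact ⟨i ⁻¹ᵁ V, h, hx, e⟩

/-- The map `f` is linear only over functions on `S`. A closed immersion is surjective on functions
over affine open sets, so a function on `D` lifts locally and linearity over $\mathcal O_D$ follows.
-/
lemma descendFun_smul {F G : D.Modules} (f : (pushforward i).obj F ⟶ (pushforward i).obj G)
    {W : D.Opens} (a : Γ(D, W)) (s : Γ(F, W)) :
    descendFun f W (a • s) = a • descendFun f W s := by
  refine section_ext_pushforward (i := i) _ _ fun x hx => ?_
  obtain ⟨V, hV, hxV, b, hb⟩ := exists_lift (resO (preimage_extendOpen_le W) a) x hx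
  have h : i ⁻¹ᵁ V ≤ W := (preimage_le hV).trans (preimage_extendOpen_le W)
  refine ⟨V, h, hxV, ?_⟩
  rw [resO_resO] at hb
  rw [res_smul, res_descendFun, res_descendFun, res_smul, ← hb, ← smul_pf, app_smul,
    pf_symm_smul]

lemma res_descendFun_self {F G : D.Modules} (f : (pushforward i).obj F ⟶ (pushforward i).obj G)
    {W W' : D.Opens} (h : W' ≤ W) (s : Γ(F, W)) :
    descendFun f W' (res F h s) = res G h (descendFun f W s) := by
  refine section_ext_pushforward (i := i) _ _ fun x hx =>
    ⟨extendOpen i W', preimage_extendOpen_le W', hx, ?_⟩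
  rw [res_res, res_descendFun, res_descendFun, res_res]

instance : (pushforward i).Full where
  map_surjective {F G} f := by
    refine ⟨homMk (fun W => { descendFun f W with map_smul' := descendFun_smul f })
      (fun W W' h s => res_descendFun_self f h s), ?_⟩
    refine hom_ext_app fun V s => ?_
    obtain ⟨s, rfl⟩ := (pf i F V).surjective s
    rw [app_pf, app_homMk]
    change pf i G V (descendFun f _ s) = _
    rw [← res_refl G (descendFun f _ s), res_descendFun, AddEquiv.apply_symm_apply, res_refl]

end pushforward

/-! ### The ideal sheaf -/

section ideal

/-- The function defined by a section of the ideal sheaf. -/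
def idealFun (U : S.Opens) : Γ(idealSheaf i, U) →ₗ[Γ(S, U)] Γ(S, U) :=
  (oSec U).symm.toLinearMap ∘ₗ
    appLin (M := idealSheaf i) (M' := structureSheaf S) (kernel.ι (C := S.Modules) _) U

variable {i}

lemma idealFun_injective (U : S.Opens) : Function.Injective (idealFun i U) :=
  (oSec U).symm.injective.comp (kernel_ι_injective _ U)

lemma resO_idealFun {U V : S.Opens} (h : V ≤ U) (s : Γ(idealSheaf i, U)) :
    resO h (idealFun i U s) = idealFun i V (res _ h s) :=
  (app_res (kernel.ι (C := S.Modules) _) h s).symm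

lemma app_idealFun {U : S.Opens} (s : Γ(idealSheaf i, U)) : i.app U (idealFun i U s) = 0 :=
  app_kernel_ι _ s

lemma exists_idealFun {U : S.Opens} (a : Γ(S, U)) (ha : i.app U a = 0) :
    ∃ s, idealFun i U s = a :=
  exists_kernel_ι (X := S) (M := structureSheaf S) _ (oSec U a) ha

/-- The section `m ⊗ n` of the twist `M(-D)`. -/
def twMul {M : S.Modules} {U : S.Opens} (m : Γ(M, U)) (n : Γ(idealSheaf i, U)) :
    Γ((twist i).obj M, U) := tmul m n

lemma res_twMul {M : S.Modules} {U V : S.Opens} (h : V ≤ U) (m : Γ(M, U))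
    (n : Γ(idealSheaf i, U)) : res _ h (twMul m n) = twMul (res M h m) (res _ h n) :=
  res_tmul h m n

lemma app_twMul {M M' : S.Modules} (f : M ⟶ M') {U : S.Opens} (m : Γ(M, U))
    (n : Γ(idealSheaf i, U)) : app ((twist i).map f) U (twMul m n) = twMul (app f U m) n :=
  app_tmul f m n

lemma smul_twMul {M : S.Modules} {U : S.Opens} (a : Γ(S, U)) (m : Γ(M, U))
    (n : Γ(idealSheaf i, U)) : twMul (a • m) n = a • twMul m n :=
  smul_tmul a m n

lemma add_twMul {M : S.Modules} {U : S.Opens} (m m' : Γ(M, U)) (n : Γ(idealSheaf i, U)) :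
    twMul (m + m') n = twMul m n + twMul m' n :=
  add_tmul m m' n

lemma zero_twMul {M : S.Modules} {U : S.Opens} (n : Γ(idealSheaf i, U)) :
    twMul (0 : Γ(M, U)) n = 0 := zero_tmul n

lemma twMul_bijective {M : S.Modules} {U : S.Opens} {t : Γ(idealSheaf i, U)}
    (ht : IsBasis (idealSheaf i) (fun _ : Fin 1 => t)) {V : S.Opens} (hV : V ≤ U) :
    Function.Bijective (fun m : Γ(M, V) => twMul m (res _ hV t)) :=
  tmul_bijective ht hV

lemma twist_hom_ext {M P : S.Modules} {f g : (twist i).obj M ⟶ P}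
    (h : ∀ (U : S.Opens) (m : Γ(M, U)) (n : Γ(idealSheaf i, U)),
      app f U (twMul m n) = app g U (twMul m n)) : f = g :=
  tensor_hom_ext h

variable (i)

/-- The multiplication map `M ⊗ 𝒪(-D) ⟶ M`. -/
def mulIdeal (M : S.Modules) : (twist i).obj M ⟶ M :=
  tensorLift (fun U => LinearMap.flip (LinearMap.lsmul Γ(S, U) Γ(M, U) ∘ₗ idealFun i U))
    (fun U V h m n => by
      simp only [LinearMap.flip_apply, LinearMap.comp_apply, LinearMap.lsmul_apply, res_smul,
        resO_idealFun])

variable {i}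

lemma app_mulIdeal {M : S.Modules} {U : S.Opens} (m : Γ(M, U)) (n : Γ(idealSheaf i, U)) :
    app (mulIdeal i M) U (twMul m n) = idealFun i U n • m := app_tensorLift _ _ _ _

lemma mulIdeal_naturality {M M' : S.Modules} (f : M ⟶ M') :
    (twist i).map f ≫ mulIdeal i M' = mulIdeal i M ≫ f :=
  twist_hom_ext fun U m n => by
    rw [app_comp, app_comp, app_mulIdeal, app_smul, app_twMul, app_mulIdeal]

lemma isBasis_ideal {U : S.Opens} (t : Γ(S, U)) (ht : i.app U t = 0)
    (hd : ∀ V (h : V ≤ U) (a : Γ(S, V)), i.app V a = 0 → ∃ c, c * resO h t = a)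
    (hr : ∀ V (h : V ≤ U) (c : Γ(S, V)), c * resO h t = 0 → c = 0) :
    ∃ τ, IsBasis (idealSheaf i) (U := U) (fun _ : Fin 1 => τ) := by
  obtain ⟨τ, rfl⟩ := exists_idealFun t ht
  refine ⟨τ, fun V hV => ?_⟩
  have key (c : Fin 1 → Γ(S, V)) :
      idealFun i V (∑ k, c k • res _ hV τ) = c 0 * resO hV (idealFun i U τ) := by
    rw [Fin.sum_univ_one, _root_.map_smul, resO_idealFun, smul_eq_mul]
  refine ⟨fun c d h => ?_, fun s => ?_⟩
  · have h' := congrArg (idealFun i V) h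
    simp only [key] at h'
    rw [← sub_eq_zero, ← sub_mul] at h'
    funext k
    rw [Fin.fin_one_eq_zero k, ← sub_eq_zero]
    exact hr V hV _ h'
  · obtain ⟨c, hc⟩ := hd V hV _ (app_idealFun s)
    exact ⟨fun _ => c, idealFun_injective V ((key _).trans hc)⟩

end ideal

end ElementaryTransform

end

noncomputable section

namespace ElementaryTransform

open TopologicalSpace Opposite Scheme.Modules

/-! ### The ideal sheaf of a reduced effective divisor -/

section dimension

/-- The spectrum of the stalk embeds topologically in `X`. -/
lemma ringKrullDim_stalk_le (X : Scheme.{u}) (x : X) :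
    ringKrullDim (X.presheaf.stalk x) ≤ topologicalKrullDim X := by
  rw [← PrimeSpectrum.topologicalKrullDim_eq_ringKrullDim]
  exact (X.fromSpecStalk x).isEmbedding.isInducing.topologicalKrullDim_le

/-- In a local ring of dimension zero every nonunit is nilpotent, and in a reduced ring it is then
zero. -/
lemma isField_stalk {D : Scheme.{u}} [IsReduced D] (hD : topologicalKrullDim D ≤ 0) (y : D) :
    IsField (D.presheaf.stalk y) := by
  have h : Ring.KrullDimLE 0 (D.presheaf.stalk y) := by
    rw [Ring.krullDimLE_iff]
    exact (ringKrullDim_stalk_le D y).trans hD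
  have h3 : ∀ x : D.presheaf.stalk y, IsNilpotent x ↔ ¬ IsUnit x :=
    ((Ring.krullDimLE_zero_and_isLocalRing_tfae (D.presheaf.stalk y)).out 0 2 :
      Ring.KrullDimLE 0 _ ∧ IsLocalRing _ ↔
        ∀ x : D.presheaf.stalk y, IsNilpotent x ↔ ¬ IsUnit x).1 ⟨h, inferInstance⟩
  refine ⟨⟨0, 1, zero_ne_one⟩, mul_comm, fun {a} ha => ?_⟩
  by_contra hu
  refine ha (((h3 a).2 fun hu' => hu ?_).eq_zero)
  obtain ⟨b, hb⟩ := hu'.exists_right_inv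
  exact ⟨b, hb⟩

/-- Regularity says that the minimal number of generators of the maximal ideal equals the dimension.
If that number is zero, the generator is `0`. -/
lemma exists_maximalIdeal_eq_span {R : Type*} [CommRing R] [IsRegularLocalRing R]
    (h : ringKrullDim R ≤ 1) : ∃ g : R, IsLocalRing.maximalIdeal R = Ideal.span {g} := by
  rw [← IsRegularLocalRing.spanFinrank_maximalIdeal] at h
  have h1 : (IsLocalRing.maximalIdeal R).spanFinrank ≤ 1 := by exact_mod_cast h
  obtain ⟨s, hs, hs'⟩ := (IsNoetherian.noetherian
    (IsLocalRing.maximalIdeal R)).exists_span_finset_card_eq_spanFinrank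
  rw [← hs, Finset.card_le_one_iff_subset_singleton] at h1
  obtain ⟨g, hg⟩ := h1
  obtain rfl | rfl := Finset.subset_singleton_iff.1 hg
  · exact ⟨0, by rw [← hs']; simp⟩
  · exact ⟨g, by rw [← hs']; simp⟩

end dimension

variable {D S : Scheme.{u}} {i : D ⟶ S}

/-- As `t` is a nonzerodivisor on every smaller open set, local quotients of `a` by `t` are unique
and glue. -/
lemma exists_mul_eq_of_local {U : S.Opens} {t a : Γ(S, U)}
    (hr : ∀ V (h : V ≤ U) (c : Γ(S, V)), c * resO h t = 0 → c = 0)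
    (h : ∀ x ∈ U, ∃ V, ∃ h : V ≤ U, x ∈ V ∧ ∃ c, c * resO h t = resO h a) :
    ∃ c, c * t = a := by
  obtain ⟨c, hc⟩ := exists_glue_of_local (structureSheaf S)
    (fun V hV s => (oSec V).symm s * resO hV t = resO hV a)
    (fun V hV W h s hs => by
      obtain ⟨s, rfl⟩ := (oSec V).surjective s
      rw [res_oSec, LinearEquiv.symm_apply_apply, ← resO_resO hV h, ← resO_resO hV h, ← map_mul,
        ← hs, LinearEquiv.symm_apply_apply])
    (fun V hV s s' hs hs' => (oSec V).symm.injective (by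
      rw [← sub_eq_zero]
      apply hr V hV
      rw [sub_mul, hs, hs', sub_self]))
    (fun x hx => by
      obtain ⟨V, hV, hxV, c, hc⟩ := h x hx
      exact ⟨V, hV, hxV, oSec V c, by rw [LinearEquiv.symm_apply_apply, hc]⟩)
  obtain ⟨c, rfl⟩ := (oSec U).surjective c
  refine ⟨c, (oSec U).injective (section_ext _ fun x hx => ?_)⟩
  obtain ⟨V, hV, hxV, e⟩ := hc x hx
  rw [res_oSec, LinearEquiv.symm_apply_apply] at e
  exact ⟨V, hV, hxV, by rw [res_oSec, res_oSec, map_mul, e]⟩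

lemma germ_resO {X : Scheme.{u}} {U V : X.Opens} (h : V ≤ U) (x : X) (hx : x ∈ V) (a : Γ(X, U)) :
    X.presheaf.germ V x hx (resO h a) = X.presheaf.germ U x (h hx) a :=
  X.presheaf.germ_res_apply (homOfLE h) x hx a

lemma exists_resO_eq {X : Scheme.{u}} {U : X.Opens} {x : X} (hx : x ∈ U) {a b : Γ(X, U)}
    (h : X.presheaf.germ U x hx a = X.presheaf.germ U x hx b) :
    ∃ V, ∃ h : V ≤ U, x ∈ V ∧ resO h a = resO h b := by
  obtain ⟨W, hW, j, k, e⟩ := X.presheaf.germ_eq x hx hx a b h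
  exact ⟨W, j.le, hW, e⟩

lemma exists_affine {X : Scheme.{u}} {U : X.Opens} {x : X} (hx : x ∈ U) :
    ∃ V : X.affineOpens, V.1 ≤ U ∧ x ∈ V.1 := by
  obtain ⟨V, hVa, hxV, hVU⟩ := Opens.isBasis_iff_nbhd.1 X.isBasis_affineOpens hx
  exact ⟨⟨V, hVa⟩, hVU, hxV⟩

lemma mul_eq_zero_of_germ [IsIntegral S] {U : S.Opens} {x : S} (hx : x ∈ U) {t : Γ(S, U)}
    (ht : S.presheaf.germ U x hx t ≠ 0) {V : S.Opens} (h : V ≤ U) (c : Γ(S, V))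
    (hc : c * resO h t = 0) : c = 0 := by
  -- The ring of functions on `V` is a domain only for nonempty `V`; arguing point by point disposes
  -- of the empty case.
  refine (oSec V).injective (section_ext _ fun y hy => ⟨V, le_rfl, hy, ?_⟩)
  have : Nonempty V := ⟨⟨y, hy⟩⟩
  obtain h0 | h0 := mul_eq_zero.1 hc
  · rw [h0]
  · exfalso
    have := congrArg (S.presheaf.germ V y hy) h0
    rw [germ_resO, map_zero] at this
    refine ht ?_
    rw [germ_injective_of_isIntegral S y (h hy) (this.trans (map_zero _).symm), map_zero]

/-- This is the quasi-coherence of the kernel ideal of a quasi-compact morphism. -/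
lemma ker_eq_map [QuasiCompact i] {V W : S.affineOpens} (h : W.1 ≤ V.1) :
    (RingHom.ker (i.app V.1).hom).map (resO h) = RingHom.ker (i.app W.1).hom := by
  rw [← Scheme.Hom.ker_apply, ← Scheme.Hom.ker_apply]
  exact Scheme.IdealSheafData.map_ideal _ h

/-- If the ideal of `i` is principal at a point, then it is so on a neighbourhood. -/
lemma exists_isBasis_of_stalk [IsIntegral S] [IsLocallyNoetherian S] [IsClosedImmersion i] (y : D)
    (g : S.presheaf.stalk (i y)) (hg : g ≠ 0) (hi : i.stalkMap y g = 0)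
    (hs : ∀ a, i.stalkMap y a = 0 → ∃ c, c * g = a) :
    ∃ U : S.Opens, i y ∈ U ∧ ∃ τ, IsBasis (idealSheaf i) (U := U) (fun _ : Fin 1 => τ) := by
  obtain ⟨U₀, hx₀, t₀, rfl⟩ := S.presheaf.exists_germ_eq g
  obtain ⟨U₁, h₁, hx₁, ht₁⟩ : ∃ U₁, ∃ h : U₁ ≤ U₀, i y ∈ U₁ ∧ i.app U₁ (resO h t₀) = 0 := by
    rw [Scheme.Hom.germ_stalkMap_apply] at hi
    obtain ⟨W, hW, hyW, e⟩ := exists_resO_eq (X := D) (U := i ⁻¹ᵁ U₀) hx₀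
      (hi.trans (map_zero _).symm)
    rw [map_zero] at e
    obtain ⟨V, rfl⟩ := exists_preimage_eq (i := i) W
    refine ⟨V ⊓ U₀, inf_le_right, ⟨hyW, hx₀⟩, ?_⟩
    rw [← resO_app, ← resO_resO hW (preimage_le inf_le_left), e, map_zero]
  obtain ⟨V, hV, hxV⟩ := exists_affine hx₁
  obtain ⟨t, t_def⟩ : ∃ t, t = resO (hV.trans h₁) t₀ := ⟨_, rfl⟩
  have ht : i.app V.1 t = 0 := by
    rw [t_def, ← resO_resO h₁ hV, ← resO_app, ht₁, map_zero]
  have hgt : S.presheaf.germ V.1 (i y) hxV t = S.presheaf.germ U₀ (i y) hx₀ t₀ := by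
    rw [t_def, germ_resO]
  rw [← hgt] at hg hs
  have : IsNoetherianRing Γ(S, V.1) := IsLocallyNoetherian.component_noetherian V
  obtain ⟨A, hA⟩ := IsNoetherian.noetherian (RingHom.ker (i.app V.1).hom)
  have key (a : Γ(S, V.1)) (ha : i.app V.1 a = 0) : ∃ W, ∃ h : W ≤ V.1, i y ∈ W ∧
      ∃ c, c * resO h t = resO h a := by
    obtain ⟨c, hc⟩ := hs (S.presheaf.germ V.1 (i y) hxV a)
      (by rw [Scheme.Hom.germ_stalkMap_apply, ha, map_zero])
    obtain ⟨W, hWV, hW, c, rfl⟩ := S.presheaf.exists_le_germ_eq c hxV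
    obtain ⟨W', h, hxW, e⟩ := exists_resO_eq (X := S) (U := W) hW (a := c * resO hWV t)
      (b := resO hWV a) (by rw [map_mul, germ_resO, germ_resO, hc])
    rw [map_mul, resO_resO, resO_resO] at e
    exact ⟨W', h.trans hWV, hxW, _, e⟩
  classical
  -- Each single element of the ideal is divisible by `t` near `i y`; finitely many elements allow a
  -- common neighbourhood.
  have key' (B : Finset Γ(S, V.1)) (hB : ∀ a ∈ B, i.app V.1 a = 0) :
      ∃ W, ∃ h : W ≤ V.1, i y ∈ W ∧ ∀ a ∈ B, ∃ c, c * resO h t = resO h a := by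
    induction B using Finset.induction_on with
    | empty => exact ⟨V.1, le_rfl, hxV, by simp⟩
    | insert a B _ ih =>
      obtain ⟨W, hW, hxW, h⟩ := ih fun a ha => hB a (Finset.mem_insert_of_mem ha)
      obtain ⟨W', hW', hxW', c, hc⟩ := key a (hB a (Finset.mem_insert_self _ _))
      refine ⟨W ⊓ W', inf_le_left.trans hW, ⟨hxW, hxW'⟩, fun b hb => ?_⟩
      obtain rfl | hb := Finset.mem_insert.1 hb
      · exact ⟨resO inf_le_right c, by
          rw [← resO_resO hW' inf_le_right, ← map_mul, hc, resO_resO]⟩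
      · obtain ⟨c, hc⟩ := h b hb
        exact ⟨resO inf_le_left c, by
          rw [← resO_resO hW inf_le_left, ← map_mul, hc, resO_resO]⟩
  obtain ⟨U, hU, hxU, hc⟩ := key' A fun a ha => (hA.le (Ideal.subset_span ha) :)
  have hr (W) (h : W ≤ U) (c : Γ(S, W)) (hc : c * resO h (resO hU t) = 0) : c = 0 := by
    rw [resO_resO] at hc
    exact mul_eq_zero_of_germ hxV hg _ c hc
  refine ⟨U, hxU, isBasis_ideal (resO hU t) (by rw [← resO_app, ht, map_zero])
    (fun W hW a ha => exists_mul_eq_of_local (fun W' h c e => ?_) fun x hx => ?_) hr⟩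
  · rw [resO_resO] at e
    exact hr W' (h.trans hW) c e
  -- On an affine open set `V'` the ideal is generated by the restrictions of `A`, all of them
  -- multiples of `t`. So `a` is divisible by `t` there, and the quotients glue.
  obtain ⟨V', hV', hxV'⟩ := exists_affine hx
  have hV'V : V'.1 ≤ V.1 := hV'.trans (hW.trans hU)
  have hm : resO hV' a ∈ (RingHom.ker (i.app V'.1).hom) := by
    change i.app V'.1 _ = 0
    rw [← resO_app, ha, map_zero]
  rw [← ker_eq_map hV'V, ← hA] at hm
  have hle : (Ideal.span (A : Set Γ(S, V.1))).map (resO hV'V) ≤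
      Ideal.span {resO hV'V t} := by
    rw [Ideal.map_span, Ideal.span_le]
    rintro _ ⟨b, hb, rfl⟩
    obtain ⟨c, hc⟩ := hc b hb
    refine Ideal.mem_span_singleton'.2 ⟨resO (hV'.trans hW) c, ?_⟩
    rw [← resO_resO hU (hV'.trans hW), ← map_mul, hc, resO_resO]
  obtain ⟨c, hc⟩ := Ideal.mem_span_singleton'.1 (hle hm)
  exact ⟨V'.1, hV', hxV', c, by rw [resO_resO, resO_resO, hc]⟩

/-- At a point of `D` the stalk map is a local homomorphism to a field, so its kernel is the maximal
ideal, which is principal by regularity. Away from `D` the ideal is generated by `1`. -/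
lemma isInvertible_idealSheaf (hS : IsDedekindScheme S) (hD : IsReducedEffectiveDivisor i) :
    IsInvertible (idealSheaf i) := by
  have := hS.isIntegral
  have := hS.isNoetherian
  have := hD.isClosedImmersion
  have := hD.isReduced
  intro x
  by_cases hx : x ∈ Set.range i
  · obtain ⟨y, rfl⟩ := hx
    have := hS.isRegular (i y)
    obtain ⟨g, hg⟩ := exists_maximalIdeal_eq_span (R := S.presheaf.stalk (i y))
      ((ringKrullDim_stalk_le S (i y)).trans hS.dim_eq_one.le)
    have hf := isField_stalk hD.dim_le_zero y
    have hker (a) : i.stalkMap y a = 0 ↔ a ∈ IsLocalRing.maximalIdeal _ := by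
      have h1 : IsUnit (i.stalkMap y a) ↔ IsUnit a := isUnit_map_iff (i.stalkMap y).hom a
      rw [IsLocalRing.mem_maximalIdeal, mem_nonunits_iff, ← h1]
      refine ⟨fun h => ?_, fun h => ?_⟩
      · rw [h]
        exact not_isUnit_zero
      · by_contra h0
        exact h (by
          obtain ⟨b, hb⟩ := hf.mul_inv_cancel h0
          exact IsUnit.of_mul_eq_one b hb)
    refine exists_isBasis_of_stalk y g (fun h0 => ?_) ((hker g).2 ?_) fun a ha => ?_
    -- If the generator were zero, the stalk would be a field and `i y` the generic point. The
    -- closed image of `i` would then be all of `S`, and `D` would be homeomorphic to a space of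
    -- dimension `1`.
    · rw [h0, Ideal.span_singleton_eq_bot.2 rfl, ← IsLocalRing.isField_iff_maximalIdeal_eq] at hg
      have hgen : genericPoint S = i y := by
        have h1 : genericPoint S ∈ Set.range (S.fromSpecStalk (i y)) := by
          rw [Scheme.range_fromSpecStalk]
          exact genericPoint_specializes _
        obtain ⟨z, hz⟩ := h1
        let := hg.toField
        have : Subsingleton (PrimeSpectrum (S.presheaf.stalk (i y))) := inferInstance
        rw [← hz]
        exact (congrArg _ (Subsingleton.elim (α := PrimeSpectrum (S.presheaf.stalk (i y))) _ _)).trans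
          (Scheme.fromSpecStalk_closedPoint (x := i y))
      have hsurj : Function.Surjective i := fun z =>
        (genericPoint_specializes z).mem_closed i.isClosedEmbedding.isClosed_range
          ⟨y, hgen.symm⟩
      have hh : IsHomeomorph i := isHomeomorph_iff_isEmbedding_surjective.2
        ⟨i.isClosedEmbedding.isEmbedding, hsurj⟩
      have := hD.dim_le_zero
      rw [hh.topologicalKrullDim_eq, hS.dim_eq_one] at this
      exact absurd this (by decide)
    · rw [hg]
      exact Ideal.mem_span_singleton_self g
    · rw [hker, hg] at ha
      exact Ideal.mem_span_singleton'.1 ha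
  · refine ⟨⟨(Set.range i)ᶜ, i.isClosedEmbedding.isClosed_range.isOpen_compl⟩, hx, ?_⟩
    have h0 (V : S.Opens)
        (h : V ≤ ⟨(Set.range i)ᶜ, i.isClosedEmbedding.isClosed_range.isOpen_compl⟩) :
        Subsingleton Γ(D, i ⁻¹ᵁ V) := by
      have : i ⁻¹ᵁ V = ⊥ := by
        ext y
        simp only [Opens.coe_bot, Set.mem_empty_iff_false, iff_false]
        exact fun hy => h hy ⟨y, rfl⟩
      rw [this]
      infer_instance
    refine isBasis_ideal (1 : Γ(S, _)) ((h0 _ le_rfl).elim _ _)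
      (fun V h a _ => ⟨a, by rw [map_one, mul_one]⟩)
      (fun V h c hc => by rwa [map_one, mul_one] at hc)

end ElementaryTransform

end

noncomputable section

namespace ElementaryTransform

open TopologicalSpace Opposite Scheme.Modules

/-! ### Bases with one and two elements -/

section basis

variable {X : Scheme.{u}} {M : X.Modules} {U : X.Opens}

lemma isBasis_one_iff {t : Γ(M, U)} : IsBasis M (fun _ : Fin 1 => t) ↔
    ∀ V (h : V ≤ U), (∀ c : Γ(X, V), c • res M h t = 0 → c = 0) ∧
      ∀ s, ∃ c : Γ(X, V), c • res M h t = s := by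
  refine forall₂_congr fun V h => and_congr ⟨fun hi c hc => ?_, fun hi c d hcd => ?_⟩
    (forall_congr' fun s => ⟨?_, ?_⟩)
  · exact congrFun (hi (a₁ := fun _ => c) (a₂ := 0)
      (by simpa only [Fin.sum_univ_one, Pi.zero_apply, zero_smul] using hc)) 0
  · simp only [Fin.sum_univ_one] at hcd
    rw [← sub_eq_zero, ← sub_smul] at hcd
    funext k
    rw [Fin.fin_one_eq_zero k, ← sub_eq_zero]
    exact hi _ hcd
  · rintro ⟨c, hc⟩
    exact ⟨c 0, by simpa only [Fin.sum_univ_one] using hc⟩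
  · rintro ⟨c, hc⟩
    exact ⟨fun _ => c, by simpa only [Fin.sum_univ_one] using hc⟩

lemma isBasis_two_iff {a b : Γ(M, U)} : IsBasis M ![a, b] ↔
    ∀ V (h : V ≤ U), (∀ c d : Γ(X, V), c • res M h a + d • res M h b = 0 → c = 0 ∧ d = 0) ∧
      ∀ s, ∃ c d : Γ(X, V), c • res M h a + d • res M h b = s := by
  have key (V) (h : V ≤ U) (c : Fin 2 → Γ(X, V)) : ∑ k, c k • res M h (![a, b] k) =
      c 0 • res M h a + c 1 • res M h b := by
    rw [Fin.sum_univ_two, Matrix.cons_val_zero, Matrix.cons_val_one, Matrix.cons_val_fin_one]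
  refine forall₂_congr fun V h => and_congr ⟨fun hi c d hc => ?_, fun hi c d hcd => ?_⟩
    (forall_congr' fun s => ⟨?_, ?_⟩)
  · have := hi (a₁ := ![c, d]) (a₂ := 0)
      ((key V h _).trans (hc.trans (by simp)))
    exact ⟨congrFun this 0, congrFun this 1⟩
  · simp only [key] at hcd
    have := hi (c 0 - d 0) (c 1 - d 1) (by
      rw [sub_smul, sub_smul, sub_add_sub_comm, hcd, sub_self])
    funext k
    fin_cases k
    · exact sub_eq_zero.1 this.1
    · exact sub_eq_zero.1 this.2
  · rintro ⟨c, hc⟩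
    exact ⟨c 0, c 1, (key V h c).symm.trans hc⟩
  · rintro ⟨c, d, hc⟩
    exact ⟨![c, d], (key V h _).trans hc⟩

lemma IsBasis.res_two {a b : Γ(M, U)} (h : IsBasis M ![a, b]) {V : X.Opens} (hV : V ≤ U) :
    IsBasis M ![res M hV a, res M hV b] := by
  rw [isBasis_two_iff] at h ⊢
  intro W hW
  simpa only [res_res] using h W (hW.trans hV)

lemma IsBasis.swap {a b : Γ(M, U)} (h : IsBasis M ![a, b]) : IsBasis M ![b, a] := by
  rw [isBasis_two_iff] at h ⊢
  refine fun V hV => ⟨fun c d e => ?_, fun s => ?_⟩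
  · rw [add_comm] at e
    exact ((h V hV).1 _ _ e).symm
  · obtain ⟨c, d, e⟩ := (h V hV).2 s
    exact ⟨d, c, by rw [add_comm, e]⟩

protected lemma IsBasis.sub_smul {a b : Γ(M, U)} (h : IsBasis M ![a, b]) (r : Γ(X, U)) :
    IsBasis M ![a, b - r • a] := by
  rw [isBasis_two_iff] at h ⊢
  have key (V) (hV : V ≤ U) (c d : Γ(X, V)) : c • res M hV a + d • res M hV (b - r • a) =
      (c - d * resO hV r) • res M hV a + d • res M hV b := by
    rw [map_sub, res_smul, smul_sub, _root_.sub_smul, smul_smul]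
    abel
  refine fun V hV => ⟨fun c d e => ?_, fun s => ?_⟩
  · rw [key] at e
    obtain ⟨h1, rfl⟩ := (h V hV).1 _ _ e
    rw [zero_mul, sub_zero] at h1
    exact ⟨h1, rfl⟩
  · obtain ⟨c, d, e⟩ := (h V hV).2 s
    exact ⟨c + d * resO hV r, d, by rw [key, add_sub_cancel_right, e]⟩

lemma IsBasis.smul_isUnit {a : Γ(M, U)} (h : IsBasis M (fun _ : Fin 1 => a)) {r : Γ(X, U)}
    (hr : IsUnit r) : IsBasis M (fun _ : Fin 1 => r • a) := by
  rw [isBasis_one_iff] at h ⊢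
  obtain ⟨r', hr'⟩ := hr.exists_right_inv
  refine fun V hV => ⟨fun c e => ?_, fun s => ?_⟩
  · rw [res_smul, smul_smul] at e
    have := (h V hV).1 _ e
    rw [← mul_one c, ← map_one (resO hV), ← hr', map_mul, ← mul_assoc, this, zero_mul]
  · obtain ⟨c, e⟩ := (h V hV).2 s
    exact ⟨c * resO hV r', by
      rw [res_smul, smul_smul, mul_assoc, ← map_mul, mul_comm r', hr', map_one, mul_one, e]⟩

lemma IsBasis.unitSec_two {D S : Scheme.{u}} {i : D ⟶ S} {M : S.Modules} {U : S.Opens}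
    {a b : Γ(M, U)} (h : IsBasis M ![a, b]) : IsBasis _ ![unitSec i M U a, unitSec i M U b] := by
  have := ((h.reindex (Equiv.ulift.{u} (α := Fin 2))).unitSec i).reindex
    (Equiv.ulift.{u} (α := Fin 2)).symm
  convert! this using 1
  funext k
  fin_cases k <;> rfl

lemma IsBasis.unitSec_one {D S : Scheme.{u}} {i : D ⟶ S} {M : S.Modules} {U : S.Opens}
    {a : Γ(M, U)} (h : IsBasis M (fun _ : Fin 1 => a)) :
    IsBasis _ (fun _ : Fin 1 => unitSec i M U a) :=
  ((h.reindex (Equiv.ulift.{u} (α := Fin 1))).unitSec i).reindex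
    (Equiv.ulift.{u} (α := Fin 1)).symm

end basis

/-! ### Local normal forms of marked bundles -/

variable {D S : Scheme.{u}} {i : D ⟶ S}

/-- Local generators in which `φ : E ⟶ i_* L` is a coordinate function: `e, e'` form a basis of `E`
and `l` is a basis of `L` with `φ e = l` and `φ e' = 0`, and `τ` generates the ideal of `D`. -/
structure IsNormal (T : Triple i) (U : S.Opens) (e e' : Γ(T.E, U)) (l : Γ(T.L, i ⁻¹ᵁ U))
    (τ : Γ(idealSheaf i, U)) : Prop where
  basisE : IsBasis T.E ![e, e']
  basisL : IsBasis T.L (fun _ : Fin 1 => l)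
  basisI : IsBasis (idealSheaf i) (fun _ : Fin 1 => τ)
  φ_fst : app T.φ U e = pf i T.L U l
  φ_snd : app T.φ U e' = 0

/-- A triple has normal forms if it has a normal form near each point. -/
def HasNormalForms (T : Triple i) : Prop :=
  ∀ x : S, ∃ U, x ∈ U ∧ ∃ e e' l τ, IsNormal T U e e' l τ

lemma subsingleton_sections_bot {X : Scheme.{u}} (M : X.Modules) :
    Subsingleton Γ(M, (⊥ : X.Opens)) :=
  ⟨fun s t => section_ext M fun x hx => hx.elim⟩

lemma preimage_eq_bot [IsClosedImmersion i] {V : S.Opens} (h : (V : Set S) ⊆ (Set.range i)ᶜ) :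
    i ⁻¹ᵁ V = ⊥ := by
  ext y
  simp only [Opens.coe_bot, Set.mem_empty_iff_false, iff_false]
  exact fun hy => h hy ⟨y, rfl⟩

lemma isBasis_bot {X : Scheme.{u}} (M : X.Modules) {U : X.Opens} (h : U = ⊥) (s : Γ(M, U)) :
    IsBasis M (fun _ : Fin 1 => s) := isBasis_one_iff.2 fun V hV => by
  obtain rfl : V = ⊥ := le_bot_iff.1 (hV.trans h.le)
  have := subsingleton_sections_bot M
  exact ⟨fun c _ => Subsingleton.elim _ _, fun s => ⟨0, Subsingleton.elim _ _⟩⟩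

/-- On a neighbourhood where `c` is invertible, `c • l` replaces `l` as generator. A suitable
multiple of `a` is then subtracted from `b`, so that `φ` kills the second basis vector. -/
lemma hasNormalForms_of_unit [IsClosedImmersion i] (hI : IsInvertible (idealSheaf i))
    {T : Triple i} {U : S.Opens} {y : D} (hy : i y ∈ U) {a b : Γ(T.E, U)}
    (hE : IsBasis T.E ![a, b]) {l : Γ(T.L, i ⁻¹ᵁ U)} (hl : IsBasis T.L (fun _ : Fin 1 => l))
    {c : Γ(D, i ⁻¹ᵁ U)} (hc : IsUnit (D.presheaf.germ _ y hy c))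
    (ha : app T.φ U a = pf i _ U (c • l)) :
    ∃ U, i y ∈ U ∧ ∃ e e' l τ, IsNormal T U e e' l τ := by
  obtain ⟨W, hyW, hWU, hcW⟩ : ∃ W : D.Opens, y ∈ W ∧ ∃ h : W ≤ i ⁻¹ᵁ U, IsUnit (resO h c) := by
    refine ⟨D.basicOpen c, (D.mem_basicOpen c y hy).2 hc, D.basicOpen_le c, ?_⟩
    exact D.toRingedSpace.isUnit_res_basicOpen c
  obtain ⟨V, rfl⟩ := exists_preimage_eq (i := i) W
  obtain ⟨V', hyV', hV'U, hV'V⟩ : ∃ V' : S.Opens, i y ∈ V' ∧ V' ≤ U ∧ V' ≤ V :=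
    ⟨U ⊓ V, ⟨hy, hyW⟩, inf_le_left, inf_le_right⟩
  have hu : IsUnit (resO (preimage_le hV'U) c) := by
    rw [← resO_resO hWU (preimage_le hV'V)]
    exact hcW.map _
  have hl' := (hl.res (preimage_le hV'U)).smul_isUnit hu
  obtain ⟨q, hq⟩ := (pf i _ _).surjective (app T.φ V' (res _ hV'U b))
  -- Here `d` is the coefficient of `φ b` with respect to `c • l`. It is a function on `D`, and its
  -- local lift `r` to `S` gives the second basis vector `b - r • a`.
  obtain ⟨d, rfl⟩ := (isBasis_one_iff.1 hl' _ le_rfl).2 q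
  rw [res_refl] at hq
  obtain ⟨V₁, hV₁, hy₁, r, hr⟩ := exists_lift d _ hyV'
  obtain ⟨V₂, hy₂, τ, hτ⟩ := hI (i y)
  have hw₁ : V₁ ⊓ V₂ ≤ V₁ := inf_le_left
  have hw₂ : V₁ ⊓ V₂ ≤ V₂ := inf_le_right
  refine ⟨V₁ ⊓ V₂, ⟨hy₁, hy₂⟩, _, _, _, _,
    (hE.res_two (hw₁.trans (hV₁.trans hV'U))).sub_smul (resO hw₁ r),
    hl'.res (preimage_le (hw₁.trans hV₁)), hτ.res hw₂, ?_, ?_⟩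
  · rw [app_res, ha, res_pf, res_smul, res_smul, resO_resO, res_res]
  · rw [map_sub, app_smul, app_res, app_res, ha, ← res_res _ hV'U (hw₁.trans hV₁), ← app_res, ← hq,
      res_pf, res_pf, smul_pf, ← map_sub, ← resO_app, hr, resO_resO, res_smul,
      res_smul, res_smul, resO_resO, res_res, sub_self, map_zero]

/-- At a point of `D`, surjectivity writes `l` locally as the image of a combination of the basis
`a, b`. As the stalk of `D` is local, the image of `a` or of `b` already generates there. -/
lemma IsMarkedBundle.hasNormalForms [IsClosedImmersion i] (hI : IsInvertible (idealSheaf i))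
    {T : Triple i} (hT : IsMarkedBundle i T) : HasNormalForms T := fun x => by
  obtain ⟨hE, hL, hφ⟩ := hT
  rw [isVectorBundle_iff] at hE hL
  obtain ⟨U, hxU, e, he⟩ := hE x
  have he : IsBasis T.E ![e 0, e 1] := by
    convert! he using 1
    funext k
    fin_cases k <;> rfl
  by_cases hx : x ∈ Set.range i
  · obtain ⟨y, rfl⟩ := hx
    obtain ⟨W, hyW, l, hl⟩ := hL y
    have hl : IsBasis T.L (fun _ : Fin 1 => l 0) := by
      convert! hl using 1
      funext k
      rw [Fin.fin_one_eq_zero k]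
    obtain ⟨V, rfl⟩ := exists_preimage_eq (i := i) W
    obtain ⟨V', hyV', hV'U, hV'V⟩ : ∃ V' : S.Opens, i y ∈ V' ∧ V' ≤ U ∧ V' ≤ V :=
      ⟨U ⊓ V, ⟨hxU, hyW⟩, inf_le_left, inf_le_right⟩
    replace hl := hl.res (preimage_le hV'V)
    obtain ⟨V₁, h₁, hy₁, s, hs⟩ := isLocSurj_of_epi T.φ V' (pf i _ _ (res _ (preimage_le hV'V) (l 0)))
      (i y) hyV'
    replace hl := hl.res (preimage_le h₁)
    replace he := he.res_two (h₁.trans hV'U)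
    rw [res_pf] at hs
    generalize res T.L (preimage_le h₁) _ = l at hl hs
    generalize res T.E (h₁.trans hV'U) (e 0) = a at he
    generalize res T.E (h₁.trans hV'U) (e 1) = b at he
    have hc (z : Γ(T.E, V₁)) : ∃ c : Γ(D, i ⁻¹ᵁ V₁), app T.φ V₁ z = pf i T.L V₁ (c • l) := by
      obtain ⟨q, hq⟩ := (pf i _ _).surjective (app T.φ V₁ z)
      obtain ⟨c, rfl⟩ := (isBasis_one_iff.1 hl _ le_rfl).2 q
      rw [res_refl] at hq
      exact ⟨c, hq.symm⟩
    obtain ⟨c, hca⟩ := hc a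
    obtain ⟨d, hdb⟩ := hc b
    obtain ⟨r, r', rfl⟩ := (isBasis_two_iff.1 he _ le_rfl).2 s
    rw [res_refl, res_refl, map_add, app_smul, app_smul, hca, hdb, smul_pf, smul_pf, ← map_add,
      smul_smul, smul_smul, ← add_smul, (pf i _ _).injective.eq_iff, ← sub_eq_zero] at hs
    have h1 : i.app V₁ r * c + i.app V₁ r' * d - 1 = 0 :=
      (isBasis_one_iff.1 hl _ le_rfl).1 _ (by rw [res_refl, sub_smul, one_smul, hs])
    -- With `φ a = c • l` and `φ b = d • l`, the preimage `r • a + r' • b` of `l` makes a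
    -- combination of `c` and `d` equal to `1`; in a local ring one summand is a unit.
    have h2 : IsUnit (D.presheaf.germ _ y hy₁ (i.app V₁ r * c) +
        D.presheaf.germ _ y hy₁ (i.app V₁ r' * d)) := by
      rw [← map_add, sub_eq_zero.1 h1, map_one]
      exact isUnit_one
    obtain h3 | h3 := IsLocalRing.isUnit_or_isUnit_of_isUnit_add h2
    · rw [map_mul] at h3
      exact hasNormalForms_of_unit hI hy₁ he hl (isUnit_of_mul_isUnit_right h3) hca
    · rw [map_mul] at h3
      exact hasNormalForms_of_unit hI hy₁ he.swap hl (isUnit_of_mul_isUnit_right h3) hdb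
  · obtain ⟨V, hxV, τ, hτ⟩ := hI x
    let W : S.Opens := ⟨(Set.range i)ᶜ, i.isClosedEmbedding.isClosed_range.isOpen_compl⟩
    have hW : i ⁻¹ᵁ (U ⊓ V ⊓ W) = ⊥ := preimage_eq_bot fun z hz => hz.2
    have hs : Subsingleton Γ((pushforward i).obj T.L, U ⊓ V ⊓ W) := by
      have : Subsingleton Γ(T.L, i ⁻¹ᵁ (U ⊓ V ⊓ W)) := by
        rw [hW]
        exact subsingleton_sections_bot T.L
      exact (pf i T.L (U ⊓ V ⊓ W)).symm.injective.subsingleton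
    -- Off `D` the preimage is empty, so `0` is a basis of `L` over it and both equations for `φ`
    -- hold trivially.
    exact ⟨U ⊓ V ⊓ W, ⟨⟨hxU, hxV⟩, hx⟩, _, _, 0, _,
      he.res_two (inf_le_left.trans inf_le_left), isBasis_bot _ hW _,
      hτ.res (inf_le_left.trans inf_le_right), hs.elim _ _, hs.elim _ _⟩

/-- For surjectivity, the coefficient of a section of `L` lifts locally to a function `b` on `S`,
and `b • e` is a preimage. -/
lemma HasNormalForms.isMarkedBundle [IsClosedImmersion i] {T : Triple i} (h : HasNormalForms T) :
    IsMarkedBundle i T := by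
  refine ⟨(isVectorBundle_iff _ _).2 fun x => ?_, (isVectorBundle_iff _ _).2 fun y => ?_,
    IsLocSurj.epi fun U s x hx => ?_⟩
  · obtain ⟨U, hx, e, e', l, τ, h⟩ := h x
    exact ⟨U, hx, _, h.basisE⟩
  · obtain ⟨U, hx, e, e', l, τ, h⟩ := h (i y)
    exact ⟨i ⁻¹ᵁ U, hx, _, h.basisL⟩
  · obtain ⟨V, hxV, e, e', l, τ, h⟩ := h x
    obtain ⟨q, hq⟩ := (pf i _ _).surjective (res _ (inf_le_left : U ⊓ V ≤ U) s)
    obtain ⟨c, rfl⟩ := (isBasis_one_iff.1 h.basisL _ (preimage_le (inf_le_right : U ⊓ V ≤ V))).2 q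
    obtain ⟨W, hW, hxW, b, hb⟩ := exists_lift c x ⟨hx, hxV⟩
    refine ⟨W, hW.trans inf_le_left, hxW, b • res _ (hW.trans inf_le_right) e, ?_⟩
    rw [app_smul, app_res, h.φ_fst, res_pf, smul_pf, hb, ← res_res _ inf_le_left hW, ← hq, res_pf,
      res_smul, res_res]

/-! ### Elementary transforms in normal form -/

section elm

variable (T : Triple i)

/-- The inclusion of `E' = ker φ` in `E`. -/
def elmE : ((elm i).obj T).E ⟶ T.E := kernel.ι T.φ

/-- The inclusion of `L' = ker ψ` in `i^* E`. -/
def elmL : ((elm i).obj T).L ⟶ (Scheme.Modules.pullback i).obj T.E := kernel.ι T.ψ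

instance : Mono (elmE T) := inferInstanceAs (Mono (kernel.ι T.φ))

lemma elmE_injective (U : S.Opens) : Function.Injective (app (elmE T) U) :=
  kernel_ι_injective T.φ U

lemma elmL_injective (U : D.Opens) : Function.Injective (app (elmL T) U) :=
  kernel_ι_injective T.ψ U

lemma app_elmE {U : S.Opens} (s : Γ(((elm i).obj T).E, U)) :
    app T.φ U (app (elmE T) U s) = 0 := app_kernel_ι T.φ s

lemma app_elmL {U : D.Opens} (s : Γ(((elm i).obj T).L, U)) :
    app T.ψ U (app (elmL T) U s) = 0 := app_kernel_ι T.ψ s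

variable {T}

lemma exists_elmE {U : S.Opens} (s : Γ(T.E, U)) (hs : app T.φ U s = 0) :
    ∃ t, app (elmE T) U t = s := exists_kernel_ι T.φ s hs

lemma exists_elmL {U : D.Opens} (s : Γ((Scheme.Modules.pullback i).obj T.E, U))
    (hs : app T.ψ U s = 0) : ∃ t, app (elmL T) U t = s := exists_kernel_ι T.ψ s hs

variable (T) in
-- Since `L'` embeds in the pullback of `E`, this determines `φ'`: it is the restriction of the unit
-- of adjunction to `E'`.
lemma elm_φ_comp : ((elm i).obj T).φ ≫ (pushforward i).map (elmL T) =
    elmE T ≫ (pullbackPushforwardAdjunction i).unit.app T.E := by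
  have h1 := (pullbackPushforwardAdjunction i).homEquiv_naturality_right
    (kernel.lift T.ψ ((Scheme.Modules.pullback i).map (kernel.ι T.φ)) T.pullback_kernel_ψ)
    (kernel.ι T.ψ)
  rw [kernel.lift_ι] at h1
  refine h1.symm.trans ?_
  rw [Adjunction.homEquiv_unit]
  exact ((pullbackPushforwardAdjunction i).unit.naturality (kernel.ι T.φ)).symm

lemma app_elm_φ {U : S.Opens} (s : Γ(((elm i).obj T).E, U)) (l : Γ(((elm i).obj T).L, i ⁻¹ᵁ U))
    (h : unitSec i _ U (app (elmE T) U s) = app (elmL T) _ l) :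
    app ((elm i).obj T).φ U s = pf i _ U l := by
  obtain ⟨q, hq⟩ := (pf i _ U).surjective (app ((elm i).obj T).φ U s)
  have h1 : app (((elm i).obj T).φ ≫ (pushforward i).map (elmL T)) U s =
      app (elmE T ≫ (pullbackPushforwardAdjunction i).unit.app T.E) U s := by rw [elm_φ_comp]
  rw [app_comp, app_comp, ← hq, app_pf, app_unit, (pf i _ _).injective.eq_iff] at h1
  rw [← hq, elmL_injective T _ (h1.trans h)]

lemma app_ψ {U : S.Opens} (s : Γ(T.E, U)) {l : Γ(T.L, i ⁻¹ᵁ U)} (h : app T.φ U s = pf i _ U l) :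
    app T.ψ (i ⁻¹ᵁ U) (unitSec i _ U s) = l := by
  rw [app_unitSec, Triple.ψ, Equiv.apply_symm_apply, h]
  rfl

/-- A section `a • e + b • e'` lies in `E'` if and only if `a` vanishes on `D`, that is, if and only
if `a` is a multiple of `τ`; hence the basis `e', τ e`. Over `D`, `ψ` sends `e` to the generator `l`
and `e'` to `0`, so `L'` is generated by the restriction of `e'`. Finally `φ'` sends `e'` to this
generator and kills `τ e`, because `τ` vanishes on `D`. -/
protected lemma IsNormal.elm {U : S.Opens} {e e' : Γ(T.E, U)} {l : Γ(T.L, i ⁻¹ᵁ U)}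
    {τ : Γ(idealSheaf i, U)} (h : IsNormal T U e e' l τ) :
    ∃ f f' m, IsNormal ((elm i).obj T) U f f' m τ ∧ app (elmE T) U f = e' ∧
      app (elmE T) U f' = idealFun i U τ • e ∧ app (elmL T) _ m = unitSec i _ U e' := by
  obtain ⟨f, hf⟩ := exists_elmE e' h.φ_snd
  obtain ⟨f', hf'⟩ := exists_elmE (idealFun i U τ • e) (by
    rw [app_smul, h.φ_fst, smul_pf, app_idealFun, zero_smul, map_zero])
  have h0 : app T.ψ (i ⁻¹ᵁ U) (unitSec i _ U e') = 0 :=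
    app_ψ e' (by rw [h.φ_snd, map_zero])
  obtain ⟨m, hm⟩ := exists_elmL _ h0
  have hE := isBasis_two_iff.1 h.basisE
  have hL := isBasis_one_iff.1 h.basisL
  have hI := isBasis_one_iff.1 h.basisI
  have hP := isBasis_two_iff.1 (h.basisE.unitSec_two (i := i))
  refine ⟨f, f', m, ⟨isBasis_two_iff.2 fun V hV => ⟨fun c d e => ?_, fun s => ?_⟩,
    isBasis_one_iff.2 fun V hV => ⟨fun c e => ?_, fun s => ?_⟩, h.basisI, ?_, ?_⟩, hf, hf', hm⟩
  · replace e := congrArg (app (elmE T) V) e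
    rw [map_add, app_smul, app_smul, app_res, app_res, hf, hf', map_zero, res_smul, smul_smul,
      resO_idealFun, add_comm] at e
    obtain ⟨h1, h2⟩ := (hE V hV).1 _ _ e
    refine ⟨h2, (hI V hV).1 _ (idealFun_injective V ?_)⟩
    rw [_root_.map_smul, map_zero, smul_eq_mul, h1]
  · obtain ⟨c, d, hcd⟩ := (hE V hV).2 (app (elmE T) V s)
    have h1 := congrArg (app T.φ V) hcd
    rw [app_elmE, map_add, app_smul, app_smul, app_res, app_res, h.φ_fst, h.φ_snd, map_zero,
      smul_zero, add_zero, res_pf, smul_pf, ← map_zero (pf i _ V), (pf i _ V).injective.eq_iff] at h1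
    -- The coefficient `c` of `e` vanishes on `D`, so it is a section of the ideal sheaf and a
    -- multiple of `τ`.
    obtain ⟨σ, rfl⟩ := exists_idealFun c ((hL _ _).1 _ h1)
    obtain ⟨b, rfl⟩ := (hI V hV).2 σ
    refine ⟨d, b, elmE_injective T V ?_⟩
    rw [← hcd, map_add, app_smul, app_smul, app_res, app_res, hf, hf', res_smul, smul_smul,
      resO_idealFun, _root_.map_smul, smul_eq_mul, add_comm]
  · replace e := congrArg (app (elmL T) V) e
    rw [app_smul, app_res, hm, map_zero] at e
    exact ((hP V hV).1 0 c (by rw [zero_smul, zero_add, e])).2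
  · obtain ⟨c, d, hcd⟩ := (hP V hV).2 (app (elmL T) V s)
    have h1 := congrArg (app T.ψ V) hcd
    rw [app_elmL, map_add, app_smul, app_smul, app_res, app_res, h0, app_ψ e h.φ_fst, map_zero,
      smul_zero, add_zero] at h1
    obtain rfl := (hL V hV).1 _ h1
    refine ⟨d, elmL_injective T V ?_⟩
    rw [app_smul, app_res, hm, ← hcd, zero_smul, zero_add]
  · exact app_elm_φ f m (by rw [hf, hm])
  · rw [← map_zero (pf i _ U)]
    exact app_elm_φ f' 0 (by rw [hf', unitSec_smul, app_idealFun, zero_smul, map_zero])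

protected lemma HasNormalForms.elm (h : HasNormalForms T) : HasNormalForms ((elm i).obj T) := fun x => by
  obtain ⟨U, hx, e, e', l, τ, h⟩ := h x
  obtain ⟨f, f', m, h', -⟩ := h.elm
  exact ⟨U, hx, f, f', m, τ, h'⟩

end elm

end ElementaryTransform

end

noncomputable section

namespace ElementaryTransform

open TopologicalSpace Opposite Scheme.Modules

/-! ### Exterior squares -/

section exterior

/-- The inverse is induced by the determinant with respect to `b`: it takes the value `1` on `b`,
and every wedge is its determinant times the wedge of the basis. -/
lemma ιMulti_two_smul_bijective {R M : Type*} [CommRing R] [AddCommGroup M] [Module R M]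
    (b : Module.Basis (Fin 2) R M) : Function.Bijective
      (fun r : R => r • _root_.exteriorPower.ιMulti R 2 b) := by
  refine ⟨fun r s h => ?_, fun s => ?_⟩
  · have := congrArg (_root_.exteriorPower.alternatingMapLinearEquiv b.det) h
    simpa [_root_.exteriorPower.alternatingMapLinearEquiv_apply_ιMulti, b.det_self] using this
  · have key : _root_.exteriorPower.ιMulti R 2 =
        (LinearMap.toSpanSingleton R _ (_root_.exteriorPower.ιMulti R 2 b)).compAlternatingMap
          b.det := by
      -- Alternating maps are compared on tuples of distinct basis vectors, which are permutations
      -- of `b`.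
      refine b.ext_alternating fun v hv => ?_
      obtain ⟨σ, rfl⟩ : ∃ σ : Equiv.Perm (Fin 2), v = σ :=
        ⟨Equiv.ofBijective v (Finite.injective_iff_bijective.1 hv), rfl⟩
      simp only [LinearMap.compAlternatingMap_apply]
      have h1 := AlternatingMap.map_perm (_root_.exteriorPower.ιMulti R 2) b σ
      have h2 := AlternatingMap.map_perm b.det b σ
      rw [Function.comp_def] at h1 h2
      rw [h1, h2, b.det_self, LinearMap.toSpanSingleton_apply]
      simp
    have hs : s ∈ Submodule.span R (Set.range (_root_.exteriorPower.ιMulti R 2 (M := M))) := by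
      rw [_root_.exteriorPower.ιMulti_span]
      trivial
    induction hs using Submodule.span_induction with
    | mem x h =>
      obtain ⟨v, rfl⟩ := h
      exact ⟨b.det v, by
        conv_rhs => rw [key]
        rfl⟩
    | zero => exact ⟨0, zero_smul _ _⟩
    | add x y _ _ hx hy =>
      obtain ⟨r, rfl⟩ := hx
      obtain ⟨r', rfl⟩ := hy
      exact ⟨r + r', add_smul _ _ _⟩
    | smul a x _ hx =>
      obtain ⟨r, rfl⟩ := hx
      exact ⟨a * r, mul_smul _ _ _⟩

lemma presheafExteriorPower_map_ιMulti {C : Type u} [Category.{u} C] {R : Cᵒᵖ ⥤ CommRingCat.{u}}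
    (n : ℕ) (M : _root_.PresheafOfModules.{u} (R ⋙ forget₂ CommRingCat RingCat)) {U V : Cᵒᵖ}
    (h : U ⟶ V) (m : Fin n → M.obj U) :
    (presheafExteriorPower n M).map h (_root_.exteriorPower.ιMulti (R.obj U) n m) =
      _root_.exteriorPower.ιMulti (R.obj V) n (fun k => M.restrictₛₗ h (m k)) :=
  exteriorPowerMap_ιMulti (A := R.obj U) (B := R.obj V) n (M.restrictₛₗ h) m

variable {X : Scheme.{u}}

/-- The presheaf exterior square. -/
def preExt (M : X.Modules) : X.PresheafOfModules :=
  presheafExteriorPower (R := X.presheaf) 2 ((toPresheafOfModules X).obj M)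

/-- Sections of the presheaf exterior square. -/
def extSec (M : X.Modules) (U : X.Opens) :
    (⋀[Γ(X, U)]^2 Γ(M, U)) ≃ₗ[Γ(X, U)] PSec (preExt M) U where
  toFun a := a
  invFun a := a
  map_add' _ _ := rfl
  map_smul' _ _ := rfl

/-- The section `m ∧ n` of the presheaf exterior square. -/
def preWedge {M : X.Modules} {U : X.Opens} (v : Fin 2 → Γ(M, U)) : PSec (preExt M) U :=
  extSec M U (_root_.exteriorPower.ιMulti Γ(X, U) 2 v)

lemma pres_preWedge {M : X.Modules} {U V : X.Opens} (h : V ≤ U) (v : Fin 2 → Γ(M, U)) :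
    pres _ h (preWedge v) = preWedge (fun k => res M h (v k)) :=
  presheafExteriorPower_map_ιMulti (R := X.presheaf) 2 ((toPresheafOfModules X).obj M)
    (homOfLE h).op v

/-- The section `m ∧ n` of the exterior square. -/
def wedge {M : X.Modules} {U : X.Opens} (v : Fin 2 → Γ(M, U)) : Γ(exteriorPower 2 M, U) :=
  toSh (preExt M) U (preWedge v)

lemma res_wedge {M : X.Modules} {U V : X.Opens} (h : V ≤ U) (v : Fin 2 → Γ(M, U)) :
    res _ h (wedge v) = wedge (fun k => res M h (v k)) :=
  (toSh_res _ h _).symm.trans (congrArg _ (pres_preWedge h v))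

lemma wedge_smul_snd {M : X.Modules} {U : X.Opens} (m n : Γ(M, U)) (a : Γ(X, U)) :
    wedge ![m, a • n] = a • wedge ![m, n] := by
  have h := (_root_.exteriorPower.ιMulti Γ(X, U) 2 (M := Γ(M, U))).map_update_smul ![m, n] 1 a n
  have h0 (z : Γ(M, U)) : Function.update ![m, n] 1 z = ![m, z] := by
    ext k; fin_cases k <;> rfl
  rw [h0, h0] at h
  rw [wedge, preWedge, h, _root_.map_smul, _root_.map_smul]
  rfl

lemma span_preWedge {M : X.Modules} {U : X.Opens} (s : PSec (preExt M) U) :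
    s ∈ Submodule.span Γ(X, U) (Set.range (preWedge (M := M) (U := U))) := by
  have h := congrArg (Submodule.map (extSec M U).toLinearMap)
    (_root_.exteriorPower.ιMulti_span Γ(X, U) 2 Γ(M, U))
  rw [Submodule.map_span, ← Set.range_comp, Submodule.map_top, LinearEquiv.range] at h
  exact h.ge trivial

lemma linearMap_ext_preWedge {M N : X.Modules} {U V : X.Opens} {f g : PSec (preExt M) U →+ Γ(N, V)}
    (r : Γ(X, U) →+* Γ(X, V))
    (hf : ∀ a s, f (a • s) = r a • f s) (hg : ∀ a s, g (a • s) = r a • g s)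
    (h : ∀ v, f (preWedge v) = g (preWedge v)) (s : PSec (preExt M) U) : f s = g s := by
  induction span_preWedge s using Submodule.span_induction with
  | mem x h' =>
    obtain ⟨v, rfl⟩ := h'
    exact h v
  | zero => rw [map_zero, map_zero]
  | add x y _ _ hx hy => rw [map_add, map_add, hx, hy]
  | smul a x _ hx => rw [hf, hg, hx]

lemma wedge_hom_ext {M : X.Modules} {P : X.Modules} {f g : exteriorPower 2 M ⟶ P}
    (h : ∀ U (v : Fin 2 → Γ(M, U)), app f U (wedge v) = app g U (wedge v)) : f = g := by
  refine sheafify_hom_ext (P := preExt M) fun U s => ?_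
  have key (f : (sheafify X).obj (preExt M) ⟶ P) (a : Γ(X, U)) (s) :
      app f U (toSh (preExt M) U (a • s)) = a • app f U (toSh (preExt M) U s) := by
    rw [_root_.map_smul, app_smul]
  exact linearMap_ext_preWedge (f := (app f U).comp (toSh (preExt M) U).toAddMonoidHom)
    (g := (app g U).comp (toSh (preExt M) U).toAddMonoidHom) (RingHom.id _)
    (key f) (key g) (h U) s

/-- The map on sections induced by a morphism of sheaves of modules. -/
def preExtMap {M N : X.Modules} (f : M ⟶ N) (U : X.Opens) :
    PSec (preExt M) U →ₗ[Γ(X, U)] PSec (preExt N) U :=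
  (extSec N U).toLinearMap ∘ₗ _root_.exteriorPower.map 2 (appLin f U) ∘ₗ
    (extSec M U).symm.toLinearMap

lemma preExtMap_preWedge {M N : X.Modules} (f : M ⟶ N) {U : X.Opens} (v : Fin 2 → Γ(M, U)) :
    preExtMap f U (preWedge v) = preWedge (fun k => app f U (v k)) :=
  congrArg (extSec N U) (_root_.exteriorPower.map_apply_ιMulti (appLin f U) v)

/-- The morphism of exterior squares induced by a morphism of sheaves of modules. -/
def extMap {M N : X.Modules} (f : M ⟶ N) : exteriorPower 2 M ⟶ exteriorPower 2 N :=
  sheafifyDesc (P := preExt M) (F := (sheafify X).obj (preExt N))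
    (fun U => (toSh (preExt N) U).comp (preExtMap f U)) (fun U V h s =>
      linearMap_ext_preWedge (N := (sheafify X).obj (preExt N))
        (f := ((toSh (preExt N) V).comp (preExtMap f V)).toAddMonoidHom.comp (pres _ h))
        (g := (res _ h).comp ((toSh (preExt N) U).comp (preExtMap f U)).toAddMonoidHom) (resO h)
        (fun a s => by
          change toSh _ V (preExtMap f V (pres _ h (a • s))) =
            resO h a • toSh _ V (preExtMap f V (pres _ h s))
          rw [pres_smul, _root_.map_smul, _root_.map_smul])
        (fun a s => by
          change res _ h (toSh _ U (preExtMap f U (a • s))) =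
            resO h a • res _ h (toSh _ U (preExtMap f U s))
          rw [_root_.map_smul, _root_.map_smul, res_smul])
        (fun v => by
          change toSh _ V (preExtMap f V (pres _ h (preWedge v))) =
            res _ h (toSh _ U (preExtMap f U (preWedge v)))
          rw [pres_preWedge, preExtMap_preWedge, preExtMap_preWedge, ← toSh_res, pres_preWedge]
          simp only [app_res]) s)

lemma app_extMap {M N : X.Modules} (f : M ⟶ N) {U : X.Opens} (v : Fin 2 → Γ(M, U)) :
    app (extMap f) U (wedge v) = wedge (fun k => app f U (v k)) :=
  (app_sheafifyDesc (P := preExt M) (F := (sheafify X).obj (preExt N)) _ _ _).trans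
    (congrArg (toSh (preExt N) U) (preExtMap_preWedge f v))

/-- Isomorphic sheaves have isomorphic exterior squares. -/
def extIso {M N : X.Modules} (f : M ≅ N) : exteriorPower 2 M ≅ exteriorPower 2 N where
  hom := extMap f.hom
  inv := extMap f.inv
  hom_inv_id := wedge_hom_ext fun U v => by
    simp only [app_comp, app_extMap, app_id, ← app_comp f.hom, f.hom_inv_id]
  inv_hom_id := wedge_hom_ext fun U v => by
    simp only [app_comp, app_extMap, app_id, ← app_comp f.inv, f.inv_hom_id]

/-- Below `U` the presheaf exterior square is already isomorphic to the structure sheaf, hence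
agrees with its sheafification. -/
lemma IsBasis.wedge {M : X.Modules} {U : X.Opens} {e : Fin 2 → Γ(M, U)} (he : IsBasis M e) :
    IsBasis (exteriorPower 2 M) (fun _ : Fin 1 => wedge e) := by
  let b (V : X.Opens) (hV : V ≤ U) : Module.Basis (Fin 2) Γ(X, V) Γ(M, V) :=
    .ofEquivFun (LinearEquiv.ofBijective (Fintype.linearCombination Γ(X, V)
      (fun k => ElementaryTransform.res M hV (e k))) (he V hV)).symm
  have hb (V) (hV : V ≤ U) : ⇑(b V hV) = fun k => ElementaryTransform.res M hV (e k) := by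
    funext k
    rw [Module.Basis.coe_ofEquivFun, LinearEquiv.symm_symm]
    exact (Fintype.linearCombination_apply_single Γ(X, V)
      (fun k => ElementaryTransform.res M hV (e k)) k 1).trans (one_smul Γ(X, V) _)
  have h1 (V) (hV : V ≤ U) : Function.Bijective (fun r : Γ(X, V) =>
      r • preWedge (fun k => ElementaryTransform.res M hV (e k))) := by
    rw [← hb V hV]
    exact (extSec M V).bijective.comp (ιMulti_two_smul_bijective (b V hV))
  let q (V) (hV : V ≤ U) : Γ(structureSheaf X, V) ≃+ PSec (preExt M) V :=
    (oSec V).symm.toAddEquiv.trans (AddEquiv.ofBijective ((LinearMap.toSpanSingleton Γ(X, V) _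
      (preWedge (fun k => ElementaryTransform.res M hV (e k)))).toAddMonoidHom) (h1 V hV))
  have hq (V) (hV : V ≤ U) (r) : q V hV (oSec V r) =
    r • preWedge (fun k => ElementaryTransform.res M hV (e k)) := rfl
  have h2 (V) (hV : V ≤ U) : Function.Bijective (toSh (preExt M) V) := by
    refine toSh_bijective _ (structureSheaf X) U (fun V hV => (q V hV).symm)
      (fun V hV W h s => ?_) hV
    obtain ⟨r, rfl⟩ := (q V hV).surjective s
    obtain ⟨r, rfl⟩ := (oSec V).surjective r
    rw [AddEquiv.symm_apply_apply, AddEquiv.symm_apply_eq, res_oSec, hq, hq, pres_smul,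
      pres_preWedge]
    simp only [ElementaryTransform.res_res]
  refine fun V hV => ?_
  convert! (h2 V hV).comp ((h1 V hV).comp (Equiv.funUnique (Fin 1) Γ(X, V)).bijective) using 1
  funext c
  rw [Fin.sum_univ_one, Function.comp_apply, Function.comp_apply, _root_.map_smul, res_wedge]
  rfl

end exterior

/-! ### Isomorphisms from local bases -/

section isoOfBases

variable {X : Scheme.{u}} {A B C : X.Modules}

/-- Local bases of `A` and `B` have the same images in `C`. So `f` factors through the mono `g`, and
the factorization takes a basis to a basis. This is the device for identifying two sheaves that have
the same image in a third. -/
lemma exists_iso_of_bases (f : A ⟶ C) (g : B ⟶ C) (hg : ∀ U, Function.Injective (app g U))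
    (h : ∀ x : X, ∃ U : X.Opens, x ∈ U ∧ ∃ (n : ℕ) (a : Fin n → Γ(A, U)) (b : Fin n → Γ(B, U)),
      IsBasis A a ∧ IsBasis B b ∧ ∀ k, app f U (a k) = app g U (b k)) :
    ∃ k : A ≅ B, k.hom ≫ g = f := by
  have := mono_of_injective hg
  have h0 : f ≫ cokernel.π g = 0 := by
    refine hom_ext_local (.of_forall_le fun x => ?_)
    obtain ⟨U, hx, n, a, b, ha, hb, hab⟩ := h x
    refine ⟨U, hx, fun V hV s => ha.app_eq (fun k => ?_) hV s⟩
    rw [app_comp, hab, ← app_comp, cokernel.condition, app_zero, app_zero]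
  have hk : Abelian.monoLift g f h0 ≫ g = f := Abelian.monoLift_comp _ _ _
  have : IsIso (Abelian.monoLift g f h0) := by
    refine isIso_of_local _ (.of_forall_le fun x => ?_)
    obtain ⟨U, hx, n, a, b, ha, hb, hab⟩ := h x
    refine ⟨U, hx, fun V hV => ha.bijective _ ?_ hV⟩
    convert! hb using 1
    funext k
    apply hg U
    rw [← app_comp, hk, hab]
  exact ⟨asIso (Abelian.monoLift g f h0), hk⟩

end isoOfBases

/-! ### The determinant of the elementary transform. -/

section det

variable {D S : Scheme.{u}} {i : D ⟶ S}

lemma IsBasis.twMul {M : S.Modules} {U : S.Opens} {ι : Type*} [Fintype ι] {e : ι → Γ(M, U)}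
    (he : IsBasis M e) {τ : Γ(idealSheaf i, U)} (hτ : IsBasis (idealSheaf i) (fun _ : Fin 1 => τ)) :
    IsBasis ((twist i).obj M) (fun k => twMul (e k) τ) := fun V hV => by
  convert! (twMul_bijective (M := M) hτ hV).comp (he V hV) using 1
  funext c
  let q : Γ(M, V) →+ Γ((twist i).obj M, V) :=
    { toFun := fun m => ElementaryTransform.twMul m (ElementaryTransform.res _ hV τ)
      map_zero' := zero_twMul _
      map_add' := fun m m' => add_twMul m m' _ }
  refine Eq.trans ?_ (map_sum q _ _).symm
  exact Finset.sum_congr rfl fun k _ => by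
    rw [res_twMul, ← smul_twMul]
    rfl

/-- Both sheaves map to the exterior square of `E`, with local generator going to `e' ∧ τ e = τ •
(e' ∧ e)`. The multiplication map is injective because `τ` is a nonzerodivisor. -/
lemma exteriorPower_elm [IsClosedImmersion i] {T : Triple i} (hT : HasNormalForms T) :
    Nonempty (exteriorPower 2 ((elm i).obj T).E ≅ (twist i).obj (exteriorPower 2 T.E)) := by
  refine (exists_iso_of_bases (extMap (elmE T)) (mulIdeal i (exteriorPower 2 T.E))
    (injective_of_local _ (.of_forall_le fun x => ?_)) (fun x => ?_)).nonempty
  · obtain ⟨U, hx, e, e', l, τ, h⟩ := hT x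
    have hb := isBasis_one_iff.1 (h.basisE.wedge.twMul h.basisI)
    have hw := isBasis_one_iff.1 h.basisE.wedge
    have hI := isBasis_one_iff.1 h.basisI
    refine ⟨U, hx, fun V hV => (injective_iff_map_eq_zero _).2 fun s hs => ?_⟩
    obtain ⟨c, rfl⟩ := (hb V hV).2 s
    rw [app_smul, app_res, app_mulIdeal, res_smul, smul_smul] at hs
    have h1 := (hw V hV).1 _ hs
    rw [resO_idealFun, ← smul_eq_mul, ← _root_.map_smul, ← map_zero (idealFun i V),
      (idealFun_injective V).eq_iff] at h1
    rw [(hI V hV).1 _ h1, zero_smul]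
  · obtain ⟨U, hx, e, e', l, τ, h⟩ := hT x
    obtain ⟨f, f', m, h', h1, h2, -⟩ := h.elm
    -- The basis of `E` is swapped since the generators of `E'` come in the order `e', τ e`; this
    -- avoids a sign.
    refine ⟨U, hx, 1, _, _, h'.basisE.wedge, h.basisE.swap.wedge.twMul h.basisI, fun _ => ?_⟩
    rw [app_extMap, app_mulIdeal, ← wedge_smul_snd]
    congr 1
    funext k
    fin_cases k
    · exact h1
    · exact h2

end det

end ElementaryTransform

end

noncomputable section

namespace ElementaryTransform

open TopologicalSpace Opposite Scheme.Modules

/-! ### Isomorphisms of quotients -/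

/-- Two quotients of `A` with the same kernel are isomorphic under `A`. The kernels need to be
compared only on small open sets. -/
lemma exists_iso_of_isLocSurj {X : Scheme.{u}} {A B C : X.Modules} {p : A ⟶ B} {q : A ⟶ C}
    (hp : IsLocSurj p) (hq : IsLocSurj q)
    (h : LocallyOn X fun V => ∀ s, app p V s = 0 ↔ app q V s = 0) :
    ∃ θ : B ≅ C, p ≫ θ.hom = q := by
  have := hp.epi
  have h0 : kernel.ι p ≫ q = 0 := hom_ext_local (h.mono fun V hV s => by
    rw [app_comp, app_zero, ← hV, app_kernel_ι])
  have hθ : p ≫ Abelian.epiDesc p q h0 = q := Abelian.comp_epiDesc _ _ _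
  have : IsIso (Abelian.epiDesc p q h0) := by
    refine isIso_of_isLocSurj _ (fun U => (injective_iff_map_eq_zero _).2 fun s hs =>
      section_ext B fun x hx => ?_) fun U s x hx => ?_
    · obtain ⟨V, hV, hxV, t, ht⟩ := hp U s x hx
      obtain ⟨W, hW, hxW, e⟩ := h V x hxV
      refine ⟨W, hW.trans hV, hxW, ?_⟩
      rw [← res_res _ hV hW, ← ht, ← app_res, map_zero, e, ← hθ, app_comp, app_res, ht, res_res,
        app_res, hs, map_zero]
    · obtain ⟨V, hV, hxV, t, ht⟩ := hq U s x hx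
      exact ⟨V, hV, hxV, app p V t, by rw [← app_comp, hθ, ht]⟩
  exact ⟨asIso (Abelian.epiDesc p q h0), hθ⟩

variable {D S : Scheme.{u}} {i : D ⟶ S}

lemma app_φ_left {T T' : Triple i} (f : T ⟶ T') {U : S.Opens} (e : Γ(T.E, U))
    (l : Γ(T.L, i ⁻¹ᵁ U)) (h : app T.φ U e = pf i _ U l) :
    app T'.φ U (app f.left U e) = pf i _ U (app f.right _ l) := by
  rw [← app_comp, ← Triple.φ_naturality, app_comp, h, app_pf]

lemma HasNormalForms.of_iso {T T' : Triple i} (f : T ≅ T') (h : HasNormalForms T) :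
    HasNormalForms T' := fun x => by
  obtain ⟨U, hx, e, e', l, τ, h⟩ := h x
  have hl := fun V => bijective_of_isIso f.hom.left V
  have hr := fun V => bijective_of_isIso f.hom.right V
  refine ⟨U, hx, app f.hom.left U e, app f.hom.left U e', app f.hom.right _ l, τ, ?_,
    h.basisL.map _ (fun V _ => hr V), h.basisI, app_φ_left _ _ _ h.φ_fst, ?_⟩
  · convert! h.basisE.map f.hom.left (fun V _ => hl V) using 1
    funext k
    fin_cases k <;> rfl
  · rw [app_φ_left f.hom e' 0 (by rw [h.φ_snd, map_zero]), map_zero, map_zero]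

/-- As `φ` is epi and `i_*` is faithful, the component on `L` is determined by the component on `E`.
-/
lemma triple_hom_ext [IsClosedImmersion i] {T T' : Triple i} [Epi T.φ] {f g : T ⟶ T'} (h : f.left = g.left) :
    f = g := by
  ext1
  · exact h
  · apply (pushforward i).map_injective
    rw [← cancel_epi T.φ, Triple.φ_naturality, Triple.φ_naturality, h]

lemma IsNormal.φ_eq_zero_iff {T : Triple i} {U : S.Opens} {e e' : Γ(T.E, U)}
    {l : Γ(T.L, i ⁻¹ᵁ U)} {τ : Γ(idealSheaf i, U)} (h : IsNormal T U e e' l τ) {V : S.Opens}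
    (hV : V ≤ U) (a b : Γ(S, V)) :
    app T.φ V (a • res _ hV e + b • res _ hV e') = 0 ↔ i.app V a = 0 := by
  rw [map_add, app_smul, app_smul, app_res, app_res, h.φ_fst, h.φ_snd, map_zero, smul_zero,
    add_zero, res_pf, smul_pf, map_eq_zero_iff _ (pf i _ V).injective]
  refine ⟨(isBasis_one_iff.1 h.basisL _ _).1 _, fun h => ?_⟩
  rw [h, zero_smul]

/-! ### The square of the elementary transform -/

/-- Each transform exchanges the generators and multiplies one of them by `τ`; after two steps both
are multiplied and their order is restored. -/
lemma exists_isNormal_elm_elm {T : Triple i} (hT : HasNormalForms T) (x : S) :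
    ∃ U, x ∈ U ∧ ∃ e e' l τ f f' m, IsNormal T U e e' l τ ∧
      IsNormal ((elm i).obj ((elm i).obj T)) U f f' m τ ∧
      app (elmE T) U (app (elmE ((elm i).obj T)) U f) = idealFun i U τ • e ∧
      app (elmE T) U (app (elmE ((elm i).obj T)) U f') = idealFun i U τ • e' := by
  obtain ⟨U, hx, e, e', l, τ, h⟩ := hT x
  obtain ⟨f, f', m, h', h1, h2, -⟩ := h.elm
  obtain ⟨g, g', n, h'', h3, h4, -⟩ := h'.elm
  exact ⟨U, hx, e, e', l, τ, g, g', n, h, h'', by rw [h3, h2], by rw [h4, app_smul, h1]⟩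

lemma exists_twist_iso_elm_elm_left {T : Triple i} (hT : HasNormalForms T) :
    ∃ α : (twist i).obj T.E ≅ ((elm i).obj ((elm i).obj T)).E,
      α.hom ≫ elmE ((elm i).obj T) ≫ elmE T = mulIdeal i T.E := by
  refine exists_iso_of_bases _ _ (fun U => ?_) fun x => ?_
  · convert! (elmE_injective T U).comp (elmE_injective _ U) using 1
  · obtain ⟨U, hx, e, e', l, τ, f, f', m, h, h', h1, h2⟩ := exists_isNormal_elm_elm hT x
    refine ⟨U, hx, 2, _, _, h.basisE.twMul h.basisI, h'.basisE, fun k => ?_⟩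
    rw [app_mulIdeal, app_comp]
    fin_cases k
    · exact h1.symm
    · exact h2.symm

/-- The isomorphism `E(-D) ≅ E''`, where `E''` is the underlying bundle of the square of the
elementary transform. -/
def twistIsoLeft {T : Triple i} (hT : HasNormalForms T) :
    (twist i).obj T.E ≅ ((elm i).obj ((elm i).obj T)).E :=
  (exists_twist_iso_elm_elm_left hT).choose

lemma twistIsoLeft_comp {T : Triple i} (hT : HasNormalForms T) :
    (twistIsoLeft hT).hom ≫ elmE ((elm i).obj T) ≫ elmE T = mulIdeal i T.E :=
  (exists_twist_iso_elm_elm_left hT).choose_spec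

lemma exists_isNormal_twistIsoLeft {T : Triple i} (hT : HasNormalForms T) (x : S) :
    ∃ U, x ∈ U ∧ ∃ e e' l τ m, IsNormal T U e e' l τ ∧
      IsNormal ((elm i).obj ((elm i).obj T)) U (app (twistIsoLeft hT).hom U (twMul e τ))
        (app (twistIsoLeft hT).hom U (twMul e' τ)) m τ := by
  obtain ⟨U, hx, e, e', l, τ, f, f', m, h, h', h1, h2⟩ := exists_isNormal_elm_elm hT x
  have key (z : Γ(T.E, U)) (w) (hw : app (elmE T) U (app (elmE ((elm i).obj T)) U w) =
      idealFun i U τ • z) : app (twistIsoLeft hT).hom U (twMul z τ) = w := by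
    apply elmE_injective
    apply elmE_injective
    rw [hw, ← app_comp, ← app_comp, twistIsoLeft_comp, app_mulIdeal]
  exact ⟨U, hx, e, e', l, τ, m, h, by rwa [key e f h1, key e' f' h2]⟩

/-- Both sheaves are quotients of $\mathcal E(-D)\cong\mathcal E''$. In a normal form either kernel
consists of the sections `(a • e + b • e') ⊗ τ` with `a` vanishing on `D`. -/
lemma exists_twist_iso_elm_elm_right [IsClosedImmersion i] (hI : IsInvertible (idealSheaf i)) {T : Triple i}
    (hT : HasNormalForms T) :
    ∃ θ : (twist i).obj ((pushforward i).obj T.L) ≅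
        (pushforward i).obj ((elm i).obj ((elm i).obj T)).L,
      (twist i).map T.φ ≫ θ.hom = (twistIsoLeft hT).hom ≫ ((elm i).obj ((elm i).obj T)).φ := by
  have := hI.isEquivalence
  have := hT.isMarkedBundle.2.2
  have := hT.elm.elm.isMarkedBundle.2.2
  have : Epi ((twist i).map T.φ) := inferInstanceAs (Epi ((tensorRight _).map T.φ))
  refine exists_iso_of_isLocSurj (isLocSurj_of_epi _) (isLocSurj_of_epi _)
    (.of_forall_le fun x => ?_)
  obtain ⟨U, hx, e, e', l, τ, m, h, h'⟩ := exists_isNormal_twistIsoLeft hT x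
  refine ⟨U, hx, fun V hV s => ?_⟩
  obtain ⟨s, rfl⟩ := (twMul_bijective h.basisI hV).2 s
  obtain ⟨a, b, rfl⟩ := (isBasis_two_iff.1 h.basisE V hV).2 s
  have h1 := h.φ_eq_zero_iff hV a b
  have h2 := h'.φ_eq_zero_iff hV a b
  have h3 : app (twistIsoLeft hT).hom V (twMul (a • res _ hV e + b • res _ hV e')
      (res _ hV τ)) = a • res _ hV (app (twistIsoLeft hT).hom U (twMul e τ)) +
        b • res _ hV (app (twistIsoLeft hT).hom U (twMul e' τ)) := by
    rw [add_twMul, smul_twMul, smul_twMul, ← res_twMul, ← res_twMul, map_add, app_smul, app_smul,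
      app_res, app_res]
  have h4 (m : Γ((pushforward i).obj T.L, V)) :
      twMul m (res _ hV τ) = 0 ↔ m = 0 :=
    ⟨fun h0 => (twMul_bijective h.basisI hV).1 (h0.trans (zero_twMul _).symm),
      fun h0 => by rw [h0, zero_twMul]⟩
  change app ((twist i).map T.φ) V (twMul _ _) = 0 ↔ app _ V (twMul _ _) = 0
  rw [app_twMul, h4, h1, app_comp, h3, h2]

/-- The isomorphism `(i_* L)(-D) ≅ i_* L''` for the square of the elementary transform. -/
def twistIsoRight [IsClosedImmersion i] (hI : IsInvertible (idealSheaf i)) {T : Triple i} (hT : HasNormalForms T) :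
    (twist i).obj ((pushforward i).obj T.L) ≅
      (pushforward i).obj ((elm i).obj ((elm i).obj T)).L :=
  (exists_twist_iso_elm_elm_right hI hT).choose

lemma comp_twistIsoRight [IsClosedImmersion i] (hI : IsInvertible (idealSheaf i)) {T : Triple i}
    (hT : HasNormalForms T) : (twist i).map T.φ ≫ (twistIsoRight hI hT).hom =
      (twistIsoLeft hT).hom ≫ ((elm i).obj ((elm i).obj T)).φ :=
  (exists_twist_iso_elm_elm_right hI hT).choose_spec

lemma unit_comp_map_counit {Q : S.Modules} {L : D.Modules} (θ : Q ⟶ (pushforward i).obj L) :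
    (pullbackPushforwardAdjunction i).unit.app Q ≫ (pushforward i).map
      ((Scheme.Modules.pullback i).map θ ≫ (pullbackPushforwardAdjunction i).counit.app L) = θ := by
  exact ((pullbackPushforwardAdjunction i).homEquiv_unit _ _ _).symm.trans
    ((Equiv.symm_apply_eq _).1 ((pullbackPushforwardAdjunction i).homEquiv_counit _ _ θ)).symm

/-- The twist of a marked bundle is the square of its elementary transform. -/
def twistIso [IsClosedImmersion i] (hI : IsInvertible (idealSheaf i)) {T : Triple i} (hT : HasNormalForms T) :
    (twistFunctor i).obj T ≅ (elm i).obj ((elm i).obj T) :=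
  Comma.isoMk (twistIsoLeft hT)
    -- The second component of the twist is a pullback from `S`, so the counit is needed; it is
    -- invertible because `i_*` is fully faithful.
    ((Scheme.Modules.pullback i).mapIso (twistIsoRight hI hT) ≪≫
      (asIso (pullbackPushforwardAdjunction i).counit).app _) (by
    refine (comp_twistIsoRight hI hT).symm.trans ?_
    exact ((Category.assoc _ _ _).trans (congrArg ((twist i).map T.φ ≫ ·)
      (unit_comp_map_counit (twistIsoRight hI hT).hom))).symm)

protected lemma HasNormalForms.twistFunctor [IsClosedImmersion i] (hI : IsInvertible (idealSheaf i)) {T : Triple i}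
    (hT : HasNormalForms T) : HasNormalForms ((twistFunctor i).obj T) :=
  hT.elm.elm.of_iso (twistIso hI hT).symm

lemma elmE_naturality {T T' : Triple i} (f : T ⟶ T') :
    ((elm i).map f).left ≫ elmE T' = elmE T ≫ f.left :=
  kernel.lift_ι _ _ _

/-- It suffices to compare the components on `E` after the embedding into `T'.E`, where the
identification becomes the multiplication map, which is natural. -/
lemma twistIso_naturality [IsClosedImmersion i] (hI : IsInvertible (idealSheaf i)) {T T' : Triple i}
    (hT : HasNormalForms T) (hT' : HasNormalForms T') (f : T ⟶ T') :
    (ElementaryTransform.twistFunctor i).map f ≫ (twistIso hI hT').hom =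
      (twistIso hI hT).hom ≫ (elm i).map ((elm i).map f) := by
  have := (hT.twistFunctor hI).isMarkedBundle.2.2
  refine triple_hom_ext ?_
  change (twist i).map f.left ≫ (twistIsoLeft hT').hom =
    (twistIsoLeft hT).hom ≫ ((elm i).map ((elm i).map f)).left
  rw [← cancel_mono (elmE _ ≫ elmE T')]
  have h1 := elmE_naturality ((elm i).map f)
  have h2 := elmE_naturality f
  calc
    _ = (twist i).map f.left ≫ mulIdeal i _ := by rw [Category.assoc, twistIsoLeft_comp]
    _ = mulIdeal i _ ≫ f.left := mulIdeal_naturality _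
    _ = (twistIsoLeft hT).hom ≫ elmE _ ≫ elmE T ≫ f.left := by
      rw [← twistIsoLeft_comp hT, Category.assoc, Category.assoc]
    _ = _ := by
      rw [← h2, ← Category.assoc (elmE _), ← h1, Category.assoc, Category.assoc]

end ElementaryTransform

end

noncomputable section

namespace ElementaryTransform

open TopologicalSpace Opposite Scheme.Modules

lemma IsBasis.of_evalSec {X : Scheme.{u}} {M N : X.Modules} {U : X.Opens} {ι : Type*} [Fintype ι]
    {t : Γ(N, U)} (ht : IsBasis N (fun _ : Fin 1 => t)) {g : ι → Γ(ihomObj N M, U)}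
    (hg : IsBasis M (fun k => evalSec (g k) t)) : IsBasis (ihomObj N M) g := fun V hV => by
  rw [← Function.Bijective.of_comp_iff' (evalSec_bijective (M := M) ht hV)]
  convert! hg V hV using 1
  funext c
  let q : Γ(ihomObj N M, V) →+ Γ(M, V) :=
    { toFun := fun g => evalSec g (ElementaryTransform.res N hV t)
      map_zero' := rfl
      map_add' := fun g g' => evalSec_add _ _ _ }
  refine (map_sum q _ _).trans (Finset.sum_congr rfl fun k _ => ?_)
  change evalSec (c k • ElementaryTransform.res _ hV (g k)) _ = _
  rw [evalSec_smul, res_evalSec]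

variable {D S : Scheme.{u}} {i : D ⟶ S}

/-! ### Untwisting -/

section untwist

variable (N : S.Modules) (L : D.Modules)

/-- A section of `i_* ℋom(i^* N, L)` as a section of `ℋom(N, i_* L)`. -/
def pfIhomSec {U : S.Opens} (g : Γ(ihomObj ((Scheme.Modules.pullback i).obj N) L, i ⁻¹ᵁ U)) :
    Γ(ihomObj N ((pushforward i).obj L), U) :=
  ihomMk (fun W h =>
    { toFun := fun n => pf i L W (evalSec (res _ (preimage_le h) g) (unitSec i N W n))
      map_add' := fun n n' => by rw [map_add, map_add, map_add]
      map_smul' := fun a n => by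
        rw [unitSec_smul, _root_.map_smul, RingHom.id_apply, smul_pf] })
    (fun W h W' h' n => by
      change res _ h' (pf i L W _) = pf i L W' _
      rw [res_pf, res_evalSec, res_res, res_unitSec])

lemma evalSec_res_pfIhomSec {U W : S.Opens} (h : W ≤ U)
    (g : Γ(ihomObj ((Scheme.Modules.pullback i).obj N) L, i ⁻¹ᵁ U)) (n : Γ(N, W)) :
    evalSec (res _ h (pfIhomSec N L g)) n =
      pf i L W (evalSec (res _ (preimage_le h) g) (unitSec i N W n)) :=
  evalSec_res_ihomMk _ _ h n

/-- The morphism `i_* ℋom(i^* N, L) ⟶ ℋom(N, i_* L)`. -/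
def pfIhom : (pushforward i).obj (ihomObj ((Scheme.Modules.pullback i).obj N) L) ⟶
    ihomObj N ((pushforward i).obj L) :=
  homMk (fun U =>
    { toFun := fun g => pfIhomSec N L ((pf i _ U).symm g)
      map_add' := fun g g' => ihom_ext fun W h n => by
        rw [map_add, map_add, evalSec_add, evalSec_res_pfIhomSec, evalSec_res_pfIhomSec,
          evalSec_res_pfIhomSec, map_add, evalSec_add, map_add]
      map_smul' := fun a g => ihom_ext fun W h n => by
        rw [RingHom.id_apply, res_smul, evalSec_smul, evalSec_res_pfIhomSec,
          evalSec_res_pfIhomSec, pf_symm_smul, res_smul, evalSec_smul, smul_pf, resO_app] })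
    (fun U V h g => ihom_ext fun W hW n => by
      change evalSec (res _ hW (pfIhomSec N L ((pf i _ V).symm (res _ h g)))) n =
        evalSec (res _ hW (res _ h (pfIhomSec N L ((pf i _ U).symm g)))) n
      rw [evalSec_res_pfIhomSec, res_res, evalSec_res_pfIhomSec, ← res_pf_symm, res_res])

variable {N L}

lemma evalSec_pfIhom {U : S.Opens}
    (g : Γ(ihomObj ((Scheme.Modules.pullback i).obj N) L, i ⁻¹ᵁ U)) (n : Γ(N, U)) :
    evalSec (app (pfIhom N L) U (pf i _ U g)) n = pf i L U (evalSec g (unitSec i N U n)) := by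
  change evalSec (pfIhomSec N L g) n = _
  rw [← res_refl _ (pfIhomSec N L g), evalSec_res_pfIhomSec, res_refl]

/-- Evaluation at a local generator of `N`, or at its pullback, identifies both sides with sections
of `i_* L`. -/
lemma IsInvertible.isIso_pfIhom (hN : IsInvertible N) : IsIso (pfIhom (i := i) N L) := by
  refine isIso_of_local _ (.of_forall_le fun x => ?_)
  obtain ⟨U, hx, t, ht⟩ := hN x
  refine ⟨U, hx, fun V hV => ?_⟩
  rw [← Function.Bijective.of_comp_iff' (evalSec_bijective ht hV),
    ← Function.Bijective.of_comp_iff _ (pf i _ V).bijective]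
  convert! (pf i L V).bijective.comp
    (evalSec_bijective (M := L) (ht.unitSec_one (i := i)) (preimage_le hV)) using 1
  funext g
  refine (evalSec_pfIhom _ _).trans ?_
  rw [Function.comp_apply, res_unitSec]

variable (hI : IsInvertible (idealSheaf i)) (T : Triple i)

/-- The triple `T ⊗ 𝒪(D)`. -/
def untwist : Triple i where
  left := ihomObj (idealSheaf i) T.E
  right := ihomObj ((Scheme.Modules.pullback i).obj (idealSheaf i)) T.L
  hom := ihomMap (idealSheaf i) T.φ ≫ @inv _ _ _ _ (pfIhom (idealSheaf i) T.L) hI.isIso_pfIhom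

lemma untwist_φ_comp : (untwist hI T).φ ≫ pfIhom (idealSheaf i) T.L =
    ihomMap (idealSheaf i) T.φ := by
  exact (Category.assoc _ _ _).trans ((congrArg _
    (@IsIso.inv_hom_id _ _ _ _ (pfIhom (idealSheaf i) T.L) hI.isIso_pfIhom)).trans
      (Category.comp_id _))

variable {T}

/-- Evaluation of a section of the untwist. -/
def untwistEval {V : S.Opens} (s : Γ((untwist hI T).E, V)) :
    Γ(idealSheaf i, V) →ₗ[Γ(S, V)] Γ(T.E, V) :=
  evalSec (N := idealSheaf i) (M := T.E) s

/-- The map `φ` of the untwist involves the inverse of `pfIhom`. Applying `pfIhom` and evaluating at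
`τ`, both injective, turns its values into values of the original `φ`. -/
lemma untwist_φ_eq_iff {U : S.Opens} {τ : Γ(idealSheaf i, U)}
    (hτ : IsBasis (idealSheaf i) (fun _ : Fin 1 => τ)) {V : S.Opens} (hV : V ≤ U)
    (g : Γ((untwist hI T).E, V)) (l : Γ((untwist hI T).L, i ⁻¹ᵁ V)) :
    app (untwist hI T).φ V g = pf i _ V l ↔ app T.φ V (untwistEval hI g (res _ hV τ)) =
      pf i T.L V (evalSec (N := (Scheme.Modules.pullback i).obj (idealSheaf i)) (M := T.L) l
        (unitSec i _ V (res _ hV τ))) := by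
  have := hI.isIso_pfIhom (i := i) (L := T.L)
  have h := (bijective_of_isIso (pfIhom (idealSheaf i) T.L) V).1.eq_iff
    (a := app (untwist hI T).φ V g) (b := pf i (untwist hI T).L V l)
  have h0 : app (pfIhom (idealSheaf i) T.L) V (app (untwist hI T).φ V g) =
      app (ihomMap (idealSheaf i) T.φ) V g := by
    rw [← untwist_φ_comp hI T]
    rfl
  have h' := (evalSec_bijective (M := (pushforward i).obj T.L) hτ hV).1.eq_iff
    (a := app (ihomMap (idealSheaf i) T.φ) V g) (b := app (pfIhom (idealSheaf i) T.L) V (pf i _ V l))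
  refine h.symm.trans (((Eq.congr_left h0).trans h'.symm).trans ?_)
  exact Iff.of_eq (congrArg₂ Eq (evalSec_ihomMap _ T.φ _ _) (evalSec_pfIhom _ _))

lemma untwist_φ_eq_zero_iff {U : S.Opens} {τ : Γ(idealSheaf i, U)}
    (hτ : IsBasis (idealSheaf i) (fun _ : Fin 1 => τ)) {V : S.Opens} (hV : V ≤ U)
    (g : Γ((untwist hI T).E, V)) :
    app (untwist hI T).φ V g = 0 ↔ app T.φ V (untwistEval hI g (res _ hV τ)) = 0 :=
  untwist_φ_eq_iff hI hτ hV g 0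

/-- The isomorphism between the twist of the untwist of `E` and `E`. -/
def untwistIso (T : Triple i) : (twist i).obj (untwist hI T).E ≅ T.E :=
  @asIso _ _ _ _ (ihomEval (idealSheaf i) T.E) (hI.isIso_ihomEval T.E)

lemma app_untwistIso {V : S.Opens} (s : Γ((untwist hI T).E, V)) (n : Γ(idealSheaf i, V)) :
    app (untwistIso hI T).hom V (twMul s n) = untwistEval hI s n :=
  app_ihomEval (idealSheaf i) T.E _ _

/-- The new generators are the homomorphisms taking `τ` (on `D`, its pullback) to the old ones. -/
lemma HasNormalForms.untwist (hT : HasNormalForms T) :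
    HasNormalForms (ElementaryTransform.untwist hI T) := fun x => by
  obtain ⟨U, hx, e, e', l, τ, h⟩ := hT x
  have ev {X : Scheme.{u}} {M N : X.Modules} {U : X.Opens} {t : Γ(N, U)}
      (ht : IsBasis N (fun _ : Fin 1 => t)) (m : Γ(M, U)) :
      ∃ g : Γ(ihomObj N M, U), evalSec g t = m := by
    obtain ⟨g, hg⟩ := (evalSec_bijective (M := M) ht le_rfl).2 m
    exact ⟨g, by simpa only [res_refl] using hg⟩
  obtain ⟨a, rfl⟩ := ev h.basisI e
  obtain ⟨b, rfl⟩ := ev h.basisI e'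
  have hI' := h.basisI.unitSec_one (i := i)
  obtain ⟨m, rfl⟩ := ev hI' l
  refine ⟨U, hx, a, b, m, τ, h.basisI.of_evalSec ?_, hI'.of_evalSec h.basisL, h.basisI, ?_, ?_⟩
  · convert! h.basisE using 1
    funext k
    fin_cases k <;> rfl
  · refine (untwist_φ_eq_iff hI h.basisI le_rfl _ _).2 ?_
    rw [res_refl]
    exact h.φ_fst
  · refine (untwist_φ_eq_zero_iff hI h.basisI le_rfl _).2 ?_
    rw [res_refl]
    exact h.φ_snd

variable [IsClosedImmersion i]

/-- The underlying bundle of the double transform is the twist of the untwist of `E`, hence `E`. Its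
two surjections, onto the pushforwards of the respective line bundles, have the same kernel; the
resulting isomorphism descends to `D` because `i_*` is fully faithful. -/
lemma nonempty_elm_elm_untwist_iso (hT : HasNormalForms T) :
    Nonempty ((elm i).obj ((elm i).obj (untwist hI T)) ≅ T) := by
  let hT' := hT.untwist hI
  have := hT.isMarkedBundle.2.2
  have := hT'.elm.elm.isMarkedBundle.2.2
  let p := (twistIsoLeft hT').hom ≫ ((elm i).obj ((elm i).obj (untwist hI T))).φ
  let q := (untwistIso hI T).hom ≫ T.φ
  have hp : p = (twist i).map (untwist hI T).φ ≫ (twistIsoRight hI hT').hom :=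
    (comp_twistIsoRight hI hT').symm
  obtain ⟨θ, hθ⟩ := exists_iso_of_isLocSurj (p := p) (q := q) (isLocSurj_of_epi p)
      (isLocSurj_of_epi q) (.of_forall_le fun x => by
    obtain ⟨U, hx, τ, hτ⟩ := hI x
    refine ⟨U, hx, fun V hV s => ?_⟩
    obtain ⟨s, rfl⟩ := (twMul_bijective hτ hV).2 s
    change app p V (twMul s _) = 0 ↔ app q V (twMul s _) = 0
    have h2 := bijective_of_isIso (twistIsoRight hI hT').hom V
    have h4 (m : Γ((pushforward i).obj (untwist hI T).L, V)) :
        twMul m (res _ hV τ) = 0 ↔ m = 0 :=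
      ⟨fun h0 => (twMul_bijective hτ hV).1 (h0.trans (zero_twMul _).symm),
        fun h0 => by rw [h0, zero_twMul]⟩
    rw [hp, app_comp, app_comp, app_untwistIso, map_eq_zero_iff _ h2.1, app_twMul, h4,
      untwist_φ_eq_zero_iff hI hτ hV])
  refine ⟨Comma.isoMk ((twistIsoLeft hT').symm ≪≫ untwistIso hI T)
    ((pushforward i).preimageIso θ) ?_⟩
  change ((twistIsoLeft hT').inv ≫ (untwistIso hI T).hom) ≫ T.φ =
    ((elm i).obj ((elm i).obj (untwist hI T))).φ ≫
      (pushforward i).map ((pushforward i).preimage θ.hom)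
  rw [Functor.map_preimage, Category.assoc, Iso.inv_comp_eq, ← Category.assoc]
  exact hθ.symm

end untwist

end ElementaryTransform

end

noncomputable section

namespace ElementaryTransform

open TopologicalSpace Opposite Scheme.Modules

variable {D S : Scheme.{u}} {i : D ⟶ S}

/-! ### Functors on marked bundles with fixed determinant -/

/-- Full faithfulness is inherited by full subcategories. For essential surjectivity, a preimage
under `F` must have the right determinant, which is what `hF'` supplies. -/
lemma isEquivalence_onDBunDet {N N' : S.Modules} (F : DBun i ⥤ DBun i) [F.IsEquivalence]
    (hF : ∀ T, HasDet i N T → HasDet i N' (F.obj T))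
    (hF' : ∀ T, HasDet i N' (F.obj T) → HasDet i N T) :
    (onDBunDet F hF).IsEquivalence where
  faithful := inferInstanceAs ((HasDet i N').lift _ _).Faithful
  full := inferInstanceAs ((HasDet i N').lift _ _).Full
  essSurj := ⟨fun T => by
    let e := F.objObjPreimageIso T.obj
    refine ⟨⟨F.objPreimage T.obj, hF' _ ?_⟩, ⟨(HasDet i N').isoMk e⟩⟩
    obtain ⟨g⟩ := T.property
    exact ⟨extIso ((Comma.fst _ _).mapIso ((IsMarkedBundle i).ι.mapIso e.hom.iso)) ≪≫ g⟩⟩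

variable [IsClosedImmersion i]

/-! ### The elementary transform is an equivalence -/

/-- By naturality of `twistIso`, the morphisms agree after twisting, and twisting is faithful on
sheaves of modules. -/
lemma elm_map_injective {T T' : Triple i} [Epi T.φ] (hI : IsInvertible (idealSheaf i))
    (hT : HasNormalForms T) (hT' : HasNormalForms T') {f g : T ⟶ T'}
    (h : (elm i).map f = (elm i).map g) : f = g := by
  have := hI.isEquivalence
  have h1 : (twistFunctor i).map f = (twistFunctor i).map g := by
    rw [← cancel_mono (twistIso hI hT').hom, twistIso_naturality hI hT, twistIso_naturality hI hT, h]
  exact triple_hom_ext ((tensorRight (idealSheaf i)).map_injective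
    (congrArg (fun k => CommaMorphism.left k) h1))

/-- Twisting is full on sheaves of modules, which gives the component `v` on `E`. It is compatible
with the markings after twisting, hence induces a map on `L`. -/
lemma exists_elm_elm_map {T T' : Triple i} (hI : IsInvertible (idealSheaf i))
    (hT : HasNormalForms T) (hT' : HasNormalForms T')
    (h : (elm i).obj ((elm i).obj T) ⟶ (elm i).obj ((elm i).obj T')) :
    ∃ f : T ⟶ T', (elm i).map ((elm i).map f) = h := by
  have := hI.isEquivalence
  have := hT.isMarkedBundle.2.2
  have := hT.elm.elm.isMarkedBundle.2.2
  obtain ⟨v, hv⟩ := (tensorRight (idealSheaf i)).map_surjective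
    ((twistIsoLeft hT).hom ≫ h.left ≫ (twistIsoLeft hT').inv)
  replace hv : (twist i).map v = (twistIsoLeft hT).hom ≫ h.left ≫ (twistIsoLeft hT').inv := hv
  have key : (twist i).map v ≫ (twist i).map T'.φ ≫ (twistIsoRight hI hT').hom =
      (twist i).map T.φ ≫ (twistIsoRight hI hT).hom ≫ (pushforward i).map h.right := by
    rw [comp_twistIsoRight, hv, ← Category.assoc ((twist i).map T.φ), comp_twistIsoRight]
    simp only [Category.assoc, Iso.inv_hom_id_assoc]
    rw [Triple.φ_naturality]
  -- The vanishing is tested after the faithful twist, where `key` rewrites the composite through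
  -- the twist of `φ`.
  have h0 : kernel.ι T.φ ≫ v ≫ T'.φ = 0 := by
    have := Functor.preservesZeroMorphisms_of_full (tensorRight (idealSheaf i))
    have hk : (twist i).map (kernel.ι T.φ) ≫ (twist i).map T.φ = 0 :=
      ((twist i).map_comp _ _).symm.trans ((congrArg (twist i).map (kernel.condition _)).trans
        ((tensorRight (idealSheaf i)).map_zero _ _))
    apply (tensorRight (idealSheaf i)).map_injective
    rw [Functor.map_zero]
    change (twist i).map _ = 0
    rw [← cancel_mono (twistIsoRight hI hT').hom, Functor.map_comp, Functor.map_comp,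
      Category.assoc, Category.assoc, key, ← Category.assoc, hk, zero_comp, zero_comp]
  have hw : T.φ ≫ Abelian.epiDesc T.φ (v ≫ T'.φ) h0 = v ≫ T'.φ := Abelian.comp_epiDesc _ _ _
  let f : T ⟶ T' :=
    { left := v
      right := (pushforward i).preimage (Abelian.epiDesc T.φ (v ≫ T'.φ) h0)
      w := by
        change v ≫ T'.φ = T.φ ≫ (pushforward i).map _
        rw [Functor.map_preimage, hw] }
  refine ⟨f, triple_hom_ext ?_⟩
  have h1 := congrArg (fun k => CommaMorphism.left k) (twistIso_naturality hI hT hT' f)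
  replace h1 : (twist i).map v ≫ (twistIsoLeft hT').hom =
    (twistIsoLeft hT).hom ≫ ((elm i).map ((elm i).map f)).left := h1
  rw [← cancel_epi (twistIsoLeft hT).hom, ← h1, hv, Category.assoc, Category.assoc,
    Iso.inv_hom_id, Category.comp_id]

variable (hI : IsInvertible (idealSheaf i))

lemma isMarkedBundle_elm (hI : IsInvertible (idealSheaf i)) (T : Triple i) (hT : IsMarkedBundle i T) :
    IsMarkedBundle i ((elm i).obj T) :=
  (hT.hasNormalForms hI).elm.isMarkedBundle

lemma isMarkedBundle_twist (hI : IsInvertible (idealSheaf i)) (T : Triple i) (hT : IsMarkedBundle i T) :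
    IsMarkedBundle i ((twistFunctor i).obj T) :=
  ((hT.hasNormalForms hI).twistFunctor hI).isMarkedBundle

/-- The elementary transform as a functor on the category of marked bundles. -/
def elmMarked : (IsMarkedBundle i).FullSubcategory ⥤ (IsMarkedBundle i).FullSubcategory :=
  (IsMarkedBundle i).lift ((IsMarkedBundle i).ι ⋙ elm i)
    (fun T => isMarkedBundle_elm hI _ T.property)

/-- The twist as a functor on the category of marked bundles. -/
def twistMarked : (IsMarkedBundle i).FullSubcategory ⥤ (IsMarkedBundle i).FullSubcategory :=
  (IsMarkedBundle i).lift ((IsMarkedBundle i).ι ⋙ twistFunctor i)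
    (fun T => isMarkedBundle_twist hI _ T.property)

/-- The square of the elementary transform is the twist. -/
def elmMarkedComp : elmMarked hI ⋙ elmMarked hI ≅ twistMarked hI :=
  NatIso.ofComponents
    (fun T => (IsMarkedBundle i).isoMk (twistIso hI (T.property.hasNormalForms hI)).symm)
    (fun {T T'} f => by
      apply (IsMarkedBundle i).ι.map_injective
      change (elm i).map ((elm i).map f.hom) ≫ (twistIso hI _).inv =
        (twistIso hI _).inv ≫ (twistFunctor i).map f.hom
      rw [Iso.comp_inv_eq, Category.assoc, twistIso_naturality hI
        (T.property.hasNormalForms hI) (T'.property.hasNormalForms hI), Iso.inv_hom_id_assoc])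

instance : (elmMarked hI).Faithful where
  map_injective {T T'} f g h := by
    apply (IsMarkedBundle i).ι.map_injective
    have := T.property.2.2
    exact elm_map_injective hI (T.property.hasNormalForms hI) (T'.property.hasNormalForms hI)
      (congrArg (IsMarkedBundle i).ι.map h)

/-- The transform of `h` is the double transform of some `f`, so `h` is the transform of `f` by
faithfulness. -/
instance : (elmMarked hI).Full where
  map_surjective {T T'} h := by
    obtain ⟨f, hf⟩ := exists_elm_elm_map hI (T.property.hasNormalForms hI)
      (T'.property.hasNormalForms hI) ((elm i).map h.hom)
    have := (isMarkedBundle_elm hI _ T.property).2.2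
    refine ⟨ObjectProperty.homMk f, ?_⟩
    apply (IsMarkedBundle i).ι.map_injective
    exact elm_map_injective hI (T.property.hasNormalForms hI).elm
      (T'.property.hasNormalForms hI).elm hf

instance : (elmMarked hI).EssSurj where
  mem_essImage T := by
    have h := T.property.hasNormalForms hI
    obtain ⟨f⟩ := nonempty_elm_elm_untwist_iso hI h
    exact ⟨⟨_, (h.untwist hI).elm.isMarkedBundle⟩, ⟨(IsMarkedBundle i).isoMk f⟩⟩

instance : (elmMarked hI).IsEquivalence where

lemma isEquivalence_onDBun (hI : IsInvertible (idealSheaf i))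
    (hF : ∀ T, IsMarkedBundle i T → IsMarkedBundle i ((elm i).obj T)) :
    (onDBun (elm i) hF).IsEquivalence :=
  (elmMarked hI).asEquivalence.core.isEquivalence_functor

/-! ### Determinants -/

lemma hasDet_onDBun (hI : IsInvertible (idealSheaf i))
    (hF : ∀ T, IsMarkedBundle i T → IsMarkedBundle i ((elm i).obj T))
    {N : S.Modules} (T : DBun i) (hT : HasDet i N T) :
    HasDet i ((twist i).obj N) ((onDBun (elm i) hF).obj T) := by
  obtain ⟨f⟩ := hT
  obtain ⟨g⟩ := exteriorPower_elm (T.of.property.hasNormalForms hI)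
  exact ⟨g ≪≫ (twist i).mapIso f⟩

/-- Twisting is fully faithful, so an isomorphism between the twists of the two determinants comes
from one between the determinants. -/
lemma hasDet_of_hasDet_onDBun (hI : IsInvertible (idealSheaf i))
    (hF : ∀ T, IsMarkedBundle i T → IsMarkedBundle i ((elm i).obj T))
    {N : S.Modules} (T : DBun i) (hT : HasDet i ((twist i).obj N) ((onDBun (elm i) hF).obj T)) :
    HasDet i N T := by
  obtain ⟨f⟩ := hT
  obtain ⟨g⟩ := exteriorPower_elm (T.of.property.hasNormalForms hI)
  have := hI.isEquivalence
  exact ⟨(tensorRight (idealSheaf i)).preimageIso (g.symm ≪≫ f)⟩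

end ElementaryTransform

end

open ElementaryTransform
theorem mainTheorem3 {S D : Scheme.{u}} (hS : IsDedekindScheme S)
    (i : D ⟶ S) (hD : IsReducedEffectiveDivisor i) :
    ∃ (hElm : ∀ T : Triple i, IsMarkedBundle i T → IsMarkedBundle i ((elm i).obj T))
      (hTwist : ∀ T : Triple i, IsMarkedBundle i T → IsMarkedBundle i ((twistFunctor i).obj T)),
      (∀ N : S.Modules, IsVectorBundle 1 N →
        ∃ hDet : ∀ T : DBun i, HasDet i N T →
            HasDet i ((twist i).obj N) ((onDBun (elm i) hElm).obj T),
          (onDBunDet (onDBun (elm i) hElm) hDet).IsEquivalence) ∧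
      Nonempty (onDBun (elm i) hElm ⋙ onDBun (elm i) hElm ≅ onDBun (twistFunctor i) hTwist) := by
  have := hD.isClosedImmersion
  have hI := isInvertible_idealSheaf hS hD
  have := isEquivalence_onDBun hI (isMarkedBundle_elm hI)
  refine ⟨isMarkedBundle_elm hI, isMarkedBundle_twist hI, fun N _ => ⟨hasDet_onDBun hI _,
    isEquivalence_onDBunDet _ _ (hasDet_of_hasDet_onDBun hI _)⟩, ⟨?_⟩⟩
  exact ((elmMarked hI).coreComp (elmMarked hI)).symm ≪≫ (elmMarkedComp hI).core
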